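/- Let $\Gamma\subset \mathrm{Isom}_+(\mathbb H^3)$ be a discrete group acting freely and cocompactly on hyperbolic space, so that $M=\mathbb H^3/\Gamma$ is a closed hyperbolic three-manifold, with hyperbolic metric $\overline g$. Let $QC_0$ be the space of round circles of $S^2=\partial_\infty\mathbb H^3$ with the Hausdorff distance, and let $\mathcal G=(S^2\times S^2-\{(x,x)\})/\big((x,y)\sim(y,x)\big)$ with the quotient topology. Let $$X=\{(\sigma,\{x,y\})\in QC_0\times\mathcal G:\ x,y \text{ lie in different connected components of } S^2-\sigma\},$$ on which $\Gamma$ acts diagonally. For Radon measures $\mu$ on $QC_0$ and $\lambda$ on $\mathcal G$, both $\Gamma$-invariant, let $[\mu\times\lambda]$ be the unique Radon measure on $X/\Gamma$ such that $$\int_{X/\Gamma}\tilde f\,d[\mu\times\lambda]=\int_X f\,d(\mu\times\lambda)\quad\text{for all } f\in C_c(X),$$ where $\tilde f$ is the function on $X/\Gamma$ which pulls back to $x\mapsto\sum_{\phi\in\Gamma}f(\phi(x))$ on $X$; the intersection form is $I(\mu,\lambda)=[\mu\times\lambda](X/\Gamma)$. Let $\nu$ be the Möbius-invariant measure on $QC_0$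 with Santaló's normalisation: identifying a round circle with the totally geodesic plane that it bounds, and describing the plane by its unit normal direction $\omega\in S^2$ at its foot point from a fixed origin and its signed distance $p\in\mathbb R$ from the origin, with $(\omega,p)$ and $(-\omega,-p)$ giving the same plane, $\nu$ is the measure with density $\cosh^2 p\,dp\,d\omega$ (each plane counted once, $d\omega$ of total mass $4\pi$ on $S^2$). Let $[\gamma]$ be a nontrivial homotopy class of continuous maps $S^1\to M$, and let $l_{\overline g}([\gamma])$ be the least $\overline g$-length of the curves in $[\gamma]$. Let $\alpha$ be a closed geodesic in $[\gamma]$, $\tilde\alpha$ a lift of $\alpha$ to a complete geodesic of $\mathbb H^3$ with end points $p,q\in S^2$, and $H<\Gamma$ the infinite cyclic group with $\alpha=\tilde\alpha/H$, generated by the element which translates $\tilde\alpha$ by the length of $\alpha$ (counted with multiplicity if $\alpha$ is not primitive). Let $$\delta_{[\gamma]}=\sum_{\phi H\in\Gamma/H}\delta_{\phi(\{p,q\})},$$ a measure on $\mathcal G$. Then $l_{\overline g}([\gamma])<\infty$ and $$I(\nu,\delta_{[\gamma]})=\pi\, l_{\overline g}([\gamma]).$$ -/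

import Mathlib

open MeasureTheory Topology Filter
open scoped ENNReal

noncomputable section

namespace HypCurrents

/-! ### Hyperbolic three-space and its orientation-preserving isometries -/

/-- Euclidean three-space. -/
abbrev E3 : Type := EuclideanSpace ℝ (Fin 3)

/-- The vector space of Minkowski space-time `ℝ^{1,3}`, time coordinate first. -/
abbrev Mink : Type := ℝ × E3

/-- The Minkowski form `⟨(s, v), (t, w)⟩ = v · w - s t`. -/
def form (v w : Mink) : ℝ := inner ℝ v.2 w.2 - v.1 * w.1

/-- The upper sheet of the hyperboloid, as a set. -/
def hyperboloid : Set Mink := {v | form v v = -1 ∧ 0 < v.1}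

/-- Hyperbolic three-space (hyperboloid model). -/
abbrev Hyp3 : Type := hyperboloid

/-- The hyperbolic distance, `cosh d(x, y) = -⟨x, y⟩`. -/
def hdist (x y : Hyp3) : ℝ := Real.arcosh (-form x y)

/-- `Isom₊(ℍ³) = SO⁺(1,3)`: the linear automorphisms which preserve the Minkowski form and the upper
sheet of the hyperboloid and have determinant one. -/
def IsomPlus : Subgroup (Mink ≃ₗ[ℝ] Mink) where
  carrier := {A | (∀ v w, form (A v) (A w) = form v w) ∧
    (∀ v, A v ∈ hyperboloid ↔ v ∈ hyperboloid) ∧ LinearEquiv.det A = 1}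
  mul_mem' := by
    rintro A B ⟨hA, hA', hA''⟩ ⟨hB, hB', hB''⟩
    refine ⟨fun v w => ?_, fun v => ?_, ?_⟩
    · rw [LinearEquiv.mul_apply, LinearEquiv.mul_apply, hA, hB]
    · rw [LinearEquiv.mul_apply, hA', hB']
    · rw [map_mul, hA'', hB'', mul_one]
  one_mem' := ⟨fun _ _ => rfl, fun _ => Iff.rfl, map_one _⟩
  inv_mem' := by
    rintro A ⟨hA, hA', hA''⟩
    have key : ∀ v, A (A⁻¹ v) = v := fun v => by
      rw [← LinearEquiv.mul_apply, mul_inv_cancel, LinearEquiv.coe_one, id]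
    refine ⟨fun v w => ?_, fun v => ?_, ?_⟩
    · rw [← hA, key, key]
    · rw [← hA', key]
    · rw [map_inv, hA'', inv_one]

theorem form_map (g : IsomPlus) (v w : Mink) : form (g.1 v) (g.1 w) = form v w := g.2.1 v w

theorem inv_apply_self (g : IsomPlus) (v : Mink) : (g⁻¹).1 (g.1 v) = v := by
  rw [← LinearEquiv.mul_apply, ← Subgroup.coe_mul, inv_mul_cancel]; rfl

theorem apply_inv_self (g : IsomPlus) (v : Mink) : g.1 ((g⁻¹).1 v) = v := by
  rw [← LinearEquiv.mul_apply, ← Subgroup.coe_mul, mul_inv_cancel]; rfl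

/-- The action on `ℍ³`. -/
instance : MulAction IsomPlus Hyp3 where
  smul g x := ⟨g.1 x.1, (g.2.2.1 x.1).2 x.2⟩
  one_smul _ := rfl
  mul_smul _ _ _ := rfl

/-! ### The sphere at infinity -/

/-- The sphere `S² = ∂_∞ ℍ³`; the point `ξ` is the end of the isotropic ray through `(1, ξ)`. -/
abbrev S2 : Type := Metric.sphere (0 : E3) 1

/-- The isotropic vector `(1, ξ)`. -/
def lightVec (ξ : S2) : Mink := (1, ξ.1)

theorem form_lightVec_self (ξ : S2) : form (lightVec ξ) (lightVec ξ) = 0 := by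
  have h : ‖ξ.1‖ = 1 := mem_sphere_zero_iff_norm.1 ξ.2
  simp [form, lightVec, h]

theorem form_lightVec_neg (ξ : S2) (x : Hyp3) : form (lightVec ξ) x < 0 := by
  obtain ⟨⟨s, v⟩, hx, hs⟩ := x
  have h : ‖ξ.1‖ = 1 := mem_sphere_zero_iff_norm.1 ξ.2
  have h1 : inner ℝ ξ.1 v ≤ ‖ξ.1‖ * ‖v‖ := real_inner_le_norm _ _
  have hx' : ‖v‖ ^ 2 - s * s = -1 := by
    rw [← real_inner_self_eq_norm_sq]
    exact hx
  have hs' : 0 < s := hs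
  have hv : ‖v‖ < s := by nlinarith [norm_nonneg v]
  change inner ℝ ξ.1 v - 1 * s < 0
  rw [h] at h1
  linarith

/-- The base point `(1, 0)` of the hyperboloid. -/
def basePoint : Hyp3 := ⟨(1, 0), by simp [hyperboloid, form]⟩

theorem fst_map_lightVec_pos (g : IsomPlus) (ξ : S2) : 0 < (g.1 (lightVec ξ)).1 := by
  have h := form_lightVec_neg ξ (g⁻¹ • basePoint)
  have h2 : form (lightVec ξ) (g⁻¹ • basePoint : Hyp3).1
      = form (g.1 (lightVec ξ)) (basePoint : Hyp3).1 := by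
    rw [← form_map g]
    congr 1
    exact apply_inv_self g _
  rw [h2] at h
  simpa [form, basePoint] using h

/-- The boundary action: `g • ξ` spans the image under `g` of the isotropic ray of `ξ`. -/
def bdryMap (g : IsomPlus) (ξ : S2) : S2 :=
  ⟨((g.1 (lightVec ξ)).1)⁻¹ • (g.1 (lightVec ξ)).2, by
    have hp := fst_map_lightVec_pos g ξ
    have h0 : form (g.1 (lightVec ξ)) (g.1 (lightVec ξ)) = 0 := by
      rw [form_map, form_lightVec_self]
    rw [mem_sphere_zero_iff_norm, norm_smul, norm_inv, Real.norm_of_nonneg hp.le]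
    simp only [form, real_inner_self_eq_norm_sq] at h0
    have : ‖(g.1 (lightVec ξ)).2‖ = (g.1 (lightVec ξ)).1 := by
      nlinarith [norm_nonneg (g.1 (lightVec ξ)).2]
    rw [this, inv_mul_cancel₀ hp.ne']⟩

theorem lightVec_bdryMap (g : IsomPlus) (ξ : S2) :
    lightVec (bdryMap g ξ) = ((g.1 (lightVec ξ)).1)⁻¹ • g.1 (lightVec ξ) := by
  have hp := fst_map_lightVec_pos g ξ
  ext1
  · change 1 = ((g.1 (lightVec ξ)).1)⁻¹ * (g.1 (lightVec ξ)).1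
    rw [inv_mul_cancel₀ hp.ne']
  · rfl

instance : MulAction IsomPlus S2 where
  smul := bdryMap
  one_smul ξ := by
    change bdryMap 1 ξ = ξ
    apply Subtype.ext
    change ((lightVec ξ).1)⁻¹ • (lightVec ξ).2 = ξ.1
    simp [lightVec]
  mul_smul g h ξ := by
    change bdryMap (g * h) ξ = bdryMap g (bdryMap h ξ)
    apply Subtype.ext
    have hp := fst_map_lightVec_pos h ξ
    change ((g.1 (h.1 (lightVec ξ))).1)⁻¹ • (g.1 (h.1 (lightVec ξ))).2
      = ((g.1 (lightVec (bdryMap h ξ))).1)⁻¹ • (g.1 (lightVec (bdryMap h ξ))).2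
    rw [lightVec_bdryMap, map_smul, Prod.smul_fst, Prod.smul_snd, smul_eq_mul, smul_smul, mul_inv,
      inv_inv, mul_right_comm, mul_inv_cancel₀ hp.ne', one_mul]

theorem lightVec_smul (g : IsomPlus) (ξ : S2) :
    lightVec (g • ξ) = ((g.1 (lightVec ξ)).1)⁻¹ • g.1 (lightVec ξ) := lightVec_bdryMap g ξ

theorem continuous_smul_S2 (g : IsomPlus) : Continuous fun ξ : S2 => g • ξ := by
  have hg : Continuous fun v : Mink => g.1 v :=
    LinearMap.continuous_of_finiteDimensional (g.1 : Mink →ₗ[ℝ] Mink)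
  have hl : Continuous fun ξ : S2 => g.1 (lightVec ξ) :=
    hg.comp (Continuous.prodMk continuous_const continuous_subtype_val)
  refine Continuous.subtype_mk ?_ _
  exact (hl.fst.inv₀ fun ξ => (fst_map_lightVec_pos g ξ).ne').smul hl.snd

instance : ContinuousConstSMul IsomPlus S2 := ⟨continuous_smul_S2⟩

/-! ### Round circles and the measure `ν` -/

/-- The subset `{ξ : ω · ξ = t}` of the sphere, a round circle when `|t| < 1`. -/
def circleSet (ω : S2) (t : ℝ) : Set S2 := {ξ | inner ℝ ω.1 ξ.1 = t}

theorem isCompact_circleSet (ω : S2) (t : ℝ) : IsCompact (circleSet ω t) := by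
  apply IsClosed.isCompact
  exact isClosed_eq (continuous_const.inner continuous_subtype_val) continuous_const

theorem circleSet_nonempty (ω : S2) (t : ℝ) (ht : |t| < 1) : (circleSet ω t).Nonempty := by
  have hω : ‖ω.1‖ = 1 := mem_sphere_zero_iff_norm.1 ω.2
  obtain ⟨w, hw, hw0⟩ : ∃ w : E3, inner ℝ ω.1 w = 0 ∧ w ≠ 0 := by
    have h3 : Module.finrank ℝ E3 = 2 + 1 := by simp
    have : Fact (Module.finrank ℝ E3 = 2 + 1) := ⟨h3⟩
    have h0 : ω.1 ≠ 0 := fun h => by simp [h] at hω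
    have h2 : Module.finrank ℝ (ℝ ∙ ω.1)ᗮ = 2 := Submodule.finrank_orthogonal_span_singleton h0
    have : Nontrivial (ℝ ∙ ω.1)ᗮ := Module.nontrivial_of_finrank_pos (R := ℝ) (by omega)
    obtain ⟨w, hw⟩ := exists_ne (0 : (ℝ ∙ ω.1)ᗮ)
    exact ⟨w.1, Submodule.mem_orthogonal_singleton_iff_inner_right.1 w.2,
      fun h => hw (Subtype.ext h)⟩
  have hwn : ‖w‖ ≠ 0 := norm_ne_zero_iff.2 hw0
  have ht2 : 0 ≤ 1 - t ^ 2 := by nlinarith [abs_lt.1 ht]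
  refine ⟨⟨t • ω.1 + (Real.sqrt (1 - t ^ 2) / ‖w‖) • w, ?_⟩, ?_⟩
  · rw [mem_sphere_zero_iff_norm, ← sq_eq_sq₀ (norm_nonneg _) zero_le_one,
      norm_add_sq_real, inner_smul_left, inner_smul_right, hw, norm_smul, norm_smul, hω]
    simp only [Real.norm_eq_abs, mul_zero, mul_pow, sq_abs, div_pow, Real.sq_sqrt ht2]
    field_simp
    ring
  · change inner ℝ ω.1 (t • ω.1 + (Real.sqrt (1 - t ^ 2) / ‖w‖) • w) = t
    rw [inner_add_right, inner_smul_right, inner_smul_right, hw, real_inner_self_eq_norm_sq, hω]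
    ring

/-- A compact subset of the sphere is a round circle. -/
def IsRound (K : TopologicalSpace.NonemptyCompacts S2) : Prop :=
  ∃ (ω : S2) (t : ℝ), |t| < 1 ∧ (K : Set S2) = circleSet ω t

/-- The space `QC₀` of round circles in `S²`, with the Hausdorff distance. -/
def RoundCircle : Type := {K : TopologicalSpace.NonemptyCompacts S2 // IsRound K}

instance : MetricSpace RoundCircle :=
  inferInstanceAs (MetricSpace {K : TopologicalSpace.NonemptyCompacts S2 // IsRound K})

instance : MeasurableSpace RoundCircle := borel RoundCircle

instance : BorelSpace RoundCircle := ⟨rfl⟩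

/-- The set of points of a round circle. -/
def RoundCircle.pts (σ : RoundCircle) : Set S2 := σ.1

theorem isRound_of_eq {K : TopologicalSpace.NonemptyCompacts S2} (n : Mink) (hn : 0 < form n n)
    (hK : (K : Set S2) = {ξ | form n (lightVec ξ) = 0}) : IsRound K := by
  obtain ⟨s, w⟩ := n
  simp only [form, lightVec, real_inner_self_eq_norm_sq, mul_one] at hn hK
  have hw : 0 < ‖w‖ := by
    rcases (norm_nonneg w).eq_or_lt with h | h
    · rw [← h] at hn; nlinarith
    · exact h
  refine ⟨⟨‖w‖⁻¹ • w, ?_⟩, s / ‖w‖, ?_, ?_⟩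
  · rw [mem_sphere_zero_iff_norm, norm_smul, norm_inv, norm_norm, inv_mul_cancel₀ hw.ne']
  · rw [abs_div, abs_norm, div_lt_one hw]
    apply abs_lt_of_sq_lt_sq _ hw.le
    linarith
  · rw [hK]
    ext ξ
    simp only [circleSet, Set.mem_ofPred_eq, inner_smul_left, conj_trivial]
    rw [eq_div_iff hw.ne', mul_comm, ← mul_assoc, mul_inv_cancel₀ hw.ne', one_mul, sub_eq_zero]

theorem IsRound.smul {K : TopologicalSpace.NonemptyCompacts S2} (hK : IsRound K) (g : IsomPlus) :
    IsRound (K.map (fun ξ => g • ξ) (continuous_smul_S2 g)) := by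
  obtain ⟨ω, t, ht, hK⟩ := hK
  have hω : ‖ω.1‖ = 1 := mem_sphere_zero_iff_norm.1 ω.2
  refine isRound_of_eq (g.1 (t, ω.1)) ?_ ?_
  · rw [form_map]
    simp only [form, real_inner_self_eq_norm_sq, hω]
    nlinarith [abs_lt.1 ht]
  · have key : ∀ ξ : S2, form (g.1 (t, ω.1)) (lightVec (g • ξ)) = 0 ↔ ξ ∈ circleSet ω t := by
      intro ξ
      have hp := fst_map_lightVec_pos g ξ
      have : form (g.1 (t, ω.1)) (lightVec (g • ξ))
          = ((g.1 (lightVec ξ)).1)⁻¹ * form (g.1 (t, ω.1)) (g.1 (lightVec ξ)) := by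
        rw [lightVec_smul]
        simp only [form, Prod.smul_fst, Prod.smul_snd, inner_smul_right, smul_eq_mul]
        ring
      rw [this, form_map, mul_eq_zero, or_iff_right (inv_ne_zero hp.ne')]
      simp [form, lightVec, circleSet, sub_eq_zero]
    rw [TopologicalSpace.NonemptyCompacts.coe_map, hK]
    ext ξ
    constructor
    · rintro ⟨η, hη, rfl⟩
      exact (key η).2 hη
    · intro h
      refine ⟨g⁻¹ • ξ, (key _).1 ?_, smul_inv_smul g ξ⟩
      rw [smul_inv_smul]
      exact h

/-- Isometries act on round circles by taking images. -/
instance : MulAction IsomPlus RoundCircle where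
  smul g σ := ⟨σ.1.map (fun ξ => g • ξ) (continuous_smul_S2 g), σ.2.smul g⟩
  one_smul σ := by
    refine Subtype.ext (SetLike.coe_injective ?_)
    change (fun ξ : S2 => (1 : IsomPlus) • ξ) '' (σ.1 : Set S2) = σ.1
    simp
  mul_smul g h σ := by
    refine Subtype.ext (SetLike.coe_injective ?_)
    change (fun ξ : S2 => (g * h) • ξ) '' (σ.1 : Set S2)
      = (fun ξ : S2 => g • ξ) '' ((fun ξ : S2 => h • ξ) '' (σ.1 : Set S2))
    rw [Set.image_image]
    simp only [mul_smul]

theorem RoundCircle.pts_smul (g : IsomPlus) (σ : RoundCircle) :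
    (g • σ).pts = (fun ξ : S2 => g • ξ) '' σ.pts := rfl

/-- The circle at infinity of the totally geodesic plane which is orthogonal to the geodesic ray
issuing from the base point in the direction `ω`, at signed distance `p`. -/
def circleAt (ω : S2) (p : ℝ) : RoundCircle :=
  ⟨⟨⟨circleSet ω (Real.tanh p), isCompact_circleSet _ _⟩,
      circleSet_nonempty _ _ (Real.abs_tanh_lt_one p)⟩,
    ω, Real.tanh p, Real.abs_tanh_lt_one p, rfl⟩

/-- The Möbius-invariant measure `ν` on the space of round circles, that is, the isometry-invariant
measure on the space of totally geodesic planes of `ℍ³`, with its classical density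
`cosh² p dp dω` and Santaló's normalisation. Here `dω` is the area of the unit sphere (total mass
`4π`), and the factor `1/2` is there because `(ω, p)` and `(-ω, -p)` give the same plane. -/
def santaloMeasure : Measure RoundCircle :=
  (2⁻¹ : ℝ≥0∞) • Measure.map (fun z : S2 × ℝ => circleAt z.1 z.2)
    (((volume : Measure E3).toSphere).prod
      ((volume : Measure ℝ).withDensity fun p => ENNReal.ofReal (Real.cosh p ^ 2)))

/-! ### The space `𝒢` of unordered pairs of distinct boundary points -/

/-- Ordered pairs of distinct points of the sphere. -/
abbrev OrdPair : Type := {z : S2 × S2 // z.1 ≠ z.2}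

/-- Identification of `(x, y)` with `(y, x)`. -/
def pairSetoid : Setoid OrdPair where
  r z w := w.1 = z.1 ∨ w.1 = z.1.swap
  iseqv := by
    refine ⟨fun z => Or.inl rfl, ?_, ?_⟩
    · rintro z w (h | h)
      · exact Or.inl h.symm
      · exact Or.inr (by rw [h, Prod.swap_swap])
    · rintro z w v (h | h) (h' | h')
      · exact Or.inl (by rw [h', h])
      · exact Or.inr (by rw [h', h])
      · exact Or.inr (by rw [h', h])
      · exact Or.inl (by rw [h', h, Prod.swap_swap])

/-- The space `𝒢 = (S² × S² - diagonal)/∼`, with the quotient topology. -/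
def GeodEnds : Type := Quotient pairSetoid

instance : TopologicalSpace GeodEnds := inferInstanceAs (TopologicalSpace (Quotient pairSetoid))

instance : MeasurableSpace GeodEnds := borel GeodEnds

instance : BorelSpace GeodEnds := ⟨rfl⟩

/-- The unordered pair `{x, y}`. -/
def GeodEnds.mk (x y : S2) (h : x ≠ y) : GeodEnds := Quotient.mk pairSetoid ⟨(x, y), h⟩

/-- The diagonal action of isometries on unordered pairs. -/
instance : MulAction IsomPlus GeodEnds where
  smul g := Quotient.map
    (fun z : OrdPair => ⟨(g • z.1.1, g • z.1.2), fun h => z.2 (MulAction.injective g h)⟩) (by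
      rintro ⟨⟨x, y⟩, hz⟩ ⟨⟨x', y'⟩, hw⟩ (h | h)
      · simp only [Prod.mk.injEq] at h
        exact Or.inl (by simp [h.1, h.2])
      · simp only [Prod.swap_prod_mk, Prod.mk.injEq] at h
        exact Or.inr (by simp [h.1, h.2]))
  one_smul u := by
    induction u using Quotient.inductionOn with
    | h z =>
      refine congrArg (Quotient.mk pairSetoid) (Subtype.ext ?_)
      simp
  mul_smul g h u := by
    induction u using Quotient.inductionOn with
    | h z =>
      refine congrArg (Quotient.mk pairSetoid) (Subtype.ext ?_)
      simp [mul_smul]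

theorem GeodEnds.smul_mk (g : IsomPlus) (x y : S2) (h : x ≠ y) :
    g • GeodEnds.mk x y h = GeodEnds.mk (g • x) (g • y) (fun e => h (MulAction.injective g e)) := rfl

/-! ### Linking and the space `X` -/

/-- `lk(σ, {x, y}) = 1`: the points `x, y` belong to different connected components of `S² - σ`. -/
def Linked (σ : RoundCircle) (u : GeodEnds) : Prop :=
  ∃ (x y : S2) (h : x ≠ y), u = GeodEnds.mk x y h ∧ x ∉ σ.pts ∧ y ∉ σ.pts ∧
    connectedComponentIn σ.ptsᶜ x ≠ connectedComponentIn σ.ptsᶜ y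

theorem Linked.smul {σ : RoundCircle} {u : GeodEnds} (h : Linked σ u) (g : IsomPlus) :
    Linked (g • σ) (g • u) := by
  obtain ⟨x, y, hxy, rfl, hx, hy, hc⟩ := h
  have hinj : Function.Injective fun ξ : S2 => g • ξ := MulAction.injective g
  have hcompl : (g • σ).ptsᶜ = (Homeomorph.smul g : S2 ≃ₜ S2) '' σ.ptsᶜ := by
    rw [RoundCircle.pts_smul, ← Set.image_compl_eq (MulAction.bijective g)]
    rfl
  refine ⟨g • x, g • y, fun e => hxy (hinj e), rfl, ?_, ?_, ?_⟩
  · rintro ⟨z, hz, e⟩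
    exact hx (hinj e ▸ hz)
  · rintro ⟨z, hz, e⟩
    exact hy (hinj e ▸ hz)
  · rw [hcompl]
    have ex := (Homeomorph.smul g : S2 ≃ₜ S2).image_connectedComponentIn (s := σ.ptsᶜ) hx
    have ey := (Homeomorph.smul g : S2 ≃ₜ S2).image_connectedComponentIn (s := σ.ptsᶜ) hy
    change connectedComponentIn _ ((Homeomorph.smul g : S2 ≃ₜ S2) x)
      ≠ connectedComponentIn _ ((Homeomorph.smul g : S2 ≃ₜ S2) y)
    rw [← ex, ← ey]
    exact fun e => hc ((Homeomorph.smul g : S2 ≃ₜ S2).injective.image_injective e)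

/-- The space `X` of linked pairs, a subspace of the product of the space of round circles
and `𝒢`. -/
abbrev LinkedPairs : Type := {z : RoundCircle × GeodEnds // Linked z.1 z.2}

/-- The diagonal action on `X`. -/
instance : MulAction IsomPlus LinkedPairs where
  smul g z := ⟨(g • z.1.1, g • z.1.2), z.2.smul g⟩
  one_smul z := Subtype.ext (by
    change ((1 : IsomPlus) • z.1.1, (1 : IsomPlus) • z.1.2) = z.1
    simp)
  mul_smul g h z := Subtype.ext (by
    change ((g * h) • z.1.1, (g * h) • z.1.2) = (g • h • z.1.1, g • h • z.1.2)
    simp [mul_smul])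

/-! ### The intersection form -/

section Intersection

variable (Γ : Subgroup IsomPlus)

/-- The quotient `X/Γ`. -/
def LinkedQuot : Type := MulAction.orbitRel.Quotient Γ LinkedPairs

instance : TopologicalSpace (LinkedQuot Γ) :=
  inferInstanceAs (TopologicalSpace (MulAction.orbitRel.Quotient Γ LinkedPairs))

instance : MeasurableSpace (LinkedQuot Γ) := borel (LinkedQuot Γ)

instance : BorelSpace (LinkedQuot Γ) := ⟨rfl⟩

/-- The function `f̃` on `X/Γ` whose pull-back to `X` is `x ↦ ∑_{φ ∈ Γ} f (φ x)`. -/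
def descend (f : LinkedPairs → ℝ) : LinkedQuot Γ → ℝ :=
  Quotient.lift (fun x : LinkedPairs => ∑' φ : Γ, f (φ • x)) (by
    rintro x y ⟨ψ, rfl⟩
    change ∑' φ : Γ, f (φ • ψ • y) = ∑' φ : Γ, f (φ • y)
    simp only [smul_smul]
    exact (Equiv.mulRight ψ).tsum_eq fun φ : Γ => f (φ • y))

/-- The restriction of the product measure `μ × lam` to `X`. -/
def linkedMeasure (μ : Measure RoundCircle) (lam : Measure GeodEnds) : Measure LinkedPairs :=
  (μ.prod lam).comap Subtype.val

/-- `m` is a Radon measure on `X/Γ` such that `m(f̃) = (μ × lam)(f)` for all `f ∈ C_c(X)`. -/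
def IsQuotientMeasure (μ : Measure RoundCircle) (lam : Measure GeodEnds)
    (m : Measure (LinkedQuot Γ)) : Prop :=
  m.Regular ∧ ∀ f : LinkedPairs → ℝ, Continuous f → HasCompactSupport f →
    ∫ z, descend Γ f z ∂m = ∫ x, f x ∂(linkedMeasure μ lam)

open Classical in
/-- The intersection form `I(μ, lam) = [μ × lam](X/Γ)`, where `[μ × lam]` is the unique Radon measure
on `X/Γ` which is induced by `μ × lam` (with the value `0` if there is no such measure). -/
def intersectionForm (μ : Measure RoundCircle) (lam : Measure GeodEnds) : ℝ≥0∞ :=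
  if h : ∃! m : Measure (LinkedQuot Γ), IsQuotientMeasure Γ μ lam m then h.choose Set.univ else 0

end Intersection

/-! ### The closed hyperbolic manifold, homotopy classes and lengths -/

section Manifold

variable (Γ : Subgroup IsomPlus)

/-- The quotient `M = ℍ³/Γ`. -/
def HypQuot : Type := MulAction.orbitRel.Quotient Γ Hyp3

instance : TopologicalSpace (HypQuot Γ) :=
  inferInstanceAs (TopologicalSpace (MulAction.orbitRel.Quotient Γ Hyp3))

/-- The projection `ℍ³ → M`. -/
def proj (x : Hyp3) : HypQuot Γ := Quotient.mk (MulAction.orbitRel Γ Hyp3) x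

/-- `Γ` is a discrete group of isometries such that `ℍ³/Γ` is a closed manifold: the action on `ℍ³`
is properly discontinuous, free and cocompact. -/
structure IsClosedManifoldGroup : Prop where
  properlyDiscontinuous : ProperlyDiscontinuousSMul Γ Hyp3
  free : ∀ (g : Γ) (x : Hyp3), g • x = x → g = 1
  compact : CompactSpace (HypQuot Γ)

/-- Homotopy classes of continuous maps `S¹ → M` (free homotopy), with `S¹ = ℝ/ℤ`. -/
def FreeHomotopyClass : Type :=
  Quotient (⟨ContinuousMap.Homotopic, ContinuousMap.Homotopic.equivalence⟩ :
    Setoid C(UnitAddCircle, HypQuot Γ))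

variable {Γ}

/-- The homotopy class of a closed curve. -/
def homotopyClass (c : C(UnitAddCircle, HypQuot Γ)) : FreeHomotopyClass Γ := Quotient.mk _ c

/-- The class is not the class of a constant curve. -/
def FreeHomotopyClass.Nontrivial (κ : FreeHomotopyClass Γ) : Prop :=
  ∀ x : HypQuot Γ, κ ≠ homotopyClass (ContinuousMap.const _ x)

/-- The hyperbolic length of a continuous path in `ℍ³`: the supremum of the lengths of inscribed
geodesic polygons. -/
def pathLength (β : C(unitInterval, Hyp3)) : ℝ≥0∞ :=
  ⨆ (n : ℕ) (t : ℕ → unitInterval) (_ : Monotone t),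
    ∑ i ∈ Finset.range n, ENNReal.ofReal (hdist (β (t i)) (β (t (i + 1))))

/-- The hyperbolic length of a closed curve in `M`: the length of its lifts to `ℍ³`
(all of which have the same length). -/
def curveLength (c : C(UnitAddCircle, HypQuot Γ)) : ℝ≥0∞ :=
  ⨅ (β : C(unitInterval, Hyp3)) (_ : ∀ t : unitInterval, proj Γ (β t) = c ((t : ℝ) : UnitAddCircle)),
    pathLength β

/-- The length of a homotopy class: the least hyperbolic length of the curves in it. -/
def classLength (κ : FreeHomotopyClass Γ) : ℝ≥0∞ :=
  ⨅ (c : C(UnitAddCircle, HypQuot Γ)) (_ : homotopyClass c = κ), curveLength c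

/-- A complete geodesic of `ℍ³`, parametrised by arc length. -/
def IsGeodesicLine (a : ℝ → Hyp3) : Prop :=
  ∃ x v : Mink, form x v = 0 ∧ form v v = 1 ∧ ∀ t, (a t : Mink) = Real.cosh t • x + Real.sinh t • v

/-- The point `a t` of `ℍ³` converges to the point `p` of the sphere at infinity along the filter
`l`; the points of `ℍ³` are seen in the projective ball model. -/
def TendstoBdry (a : ℝ → Hyp3) (l : Filter ℝ) (p : S2) : Prop :=
  Tendsto (fun t => ((a t : Mink).1)⁻¹ • (a t : Mink).2) l (𝓝 (p : E3))

/-- A closed geodesic `α` of `M` in the homotopy class `κ`, together with a lift to a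
geodesic `line` of `ℍ³` with end points `p, q` at infinity. The generator `h` of the group `H` of
deck transformations with `α = line / H` translates `line` by the length of `α`. -/
structure ClosedGeodesic (κ : FreeHomotopyClass Γ) where
  curve : C(UnitAddCircle, HypQuot Γ)
  mem_class : homotopyClass curve = κ
  line : ℝ → Hyp3
  isGeodesicLine : IsGeodesicLine line
  len : ℝ
  len_pos : 0 < len
  h : Γ
  translate : ∀ t, h • line t = line (t + len)
  curve_eq : ∀ t : ℝ, curve (t : UnitAddCircle) = proj Γ (line (t * len))
  p : S2
  q : S2
  tendsto_p : TendstoBdry line atBot p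
  tendsto_q : TendstoBdry line atTop q
  p_ne_q : p ≠ q

/-- The measure `∑ δ_{φ{p,q}}`, the sum being over representatives `φ` of the cosets `Γ/H`, where
`H` is the (infinite cyclic) group generated by `h`. -/
def ClosedGeodesic.current {κ : FreeHomotopyClass Γ} (α : ClosedGeodesic κ) : Measure GeodEnds :=
  Measure.sum fun φ : Γ ⧸ Subgroup.zpowers α.h =>
    Measure.dirac (φ.out • GeodEnds.mk α.p α.q α.p_ne_q)

open Classical in
/-- The geodesic current `δ_κ` of a nontrivial homotopy class `κ`; it does not depend on the choice
of the closed geodesic in the class and its lift (`0` if there is no closed geodesic). -/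
def classCurrent (κ : FreeHomotopyClass Γ) : Measure GeodEnds :=
  if h : Nonempty (ClosedGeodesic κ) then h.some.current else 0

end Manifold

end HypCurrents

end

noncomputable section

namespace HypCurrents

/-! ### Algebra of the Minkowski form -/

/-! The intersection number unfolds to a Crofton formula. A nontrivial class has a holonomy `h ∈ Γ`,
and its closed geodesic lifts to a line `a` which `h` translates by the length `L` of the class. The
current is a sum of point masses over `Γ/H`, so integrating over linked pairs modulo `Γ` amounts to
integrating over the planes linked with the ends of `a`, modulo `H`. Such a plane meets `a` in
exactly one point, and `H` shifts this point by multiples of `L`. Hence the planes that meet `a ''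
[0, L)` form a fundamental domain (`IsFrame.isFundamentalDomain`), and the intersection number is
the `ν`-measure of this set, which is `π L`.

To compute that measure, a plane is described by its normal `n`, a spacelike vector unique up to
scaling. Integration in polar coordinates shows that `ν(B)` is twice the Lebesgue volume of the
normals of planes in `B` with square in `(0, 1)` (`santaloMeasure_apply`). As Lorentz maps preserve
the form and the volume, `ν` is invariant, and the segment may be moved to the first coordinate
axis. There Fubini reduces the volume to an integral over ellipsoids, which contributes `π / 2` per
unit of length (`volume_stdCrossing`).

For the length of the class, cocompactness makes `h` attain its minimal displacement
(`exists_minimal_displacement`), and the minimum lies on a line translated by `h`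
(`exists_translated_line`). Conversely, an isometry which translates a line by `L` moves every point
by at least `L`, and freely homotopic loops have lifts with a common holonomy, so no curve of the
class is shorter than `L` (`ClosedGeodesic.classLength_eq`).

The measure in the definition of the intersection form must also exist and be unique. Existence is
the push-forward of `ν` from the fundamental domain, checked by unfolding. Uniqueness holds because
every function in `C_c(X/Γ)` is an orbit sum of a function in `C_c(X)`; this needs a properly
discontinuous action on `X`, obtained from the continuous equivariant map to `ℍ³` which sends a
linked pair to its intersection point. -/

theorem form_comm (v w : Mink) : form v w = form w v := by
  simp only [form, real_inner_comm, mul_comm]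

@[simp] theorem form_add_left (u v w : Mink) : form (u + v) w = form u w + form v w := by
  simp only [form, Prod.snd_add, Prod.fst_add, inner_add_left]; ring

@[simp] theorem form_add_right (u v w : Mink) : form u (v + w) = form u v + form u w := by
  simp only [form, Prod.snd_add, Prod.fst_add, inner_add_right]; ring

@[simp] theorem form_sub_left (u v w : Mink) : form (u - v) w = form u w - form v w := by
  simp only [form, Prod.snd_sub, Prod.fst_sub, inner_sub_left]; ring

@[simp] theorem form_sub_right (u v w : Mink) : form u (v - w) = form u v - form u w := by
  simp only [form, Prod.snd_sub, Prod.fst_sub, inner_sub_right]; ring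

@[simp] theorem form_smul_left (r : ℝ) (v w : Mink) : form (r • v) w = r * form v w := by
  simp only [form, Prod.smul_snd, Prod.smul_fst, real_inner_smul_left, smul_eq_mul]; ring

@[simp] theorem form_smul_right (r : ℝ) (v w : Mink) : form v (r • w) = r * form v w := by
  simp only [form, Prod.smul_snd, Prod.smul_fst, real_inner_smul_right, smul_eq_mul]; ring

@[simp] theorem form_neg_left (v w : Mink) : form (-v) w = -form v w := by
  simp only [form, Prod.snd_neg, Prod.fst_neg, inner_neg_left]; ring

@[simp] theorem form_neg_right (v w : Mink) : form v (-w) = -form v w := by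
  simp only [form, Prod.snd_neg, Prod.fst_neg, inner_neg_right]; ring

@[simp] theorem form_zero_right (w : Mink) : form w 0 = 0 := by simp [form]

@[fun_prop]
theorem continuous_form {X : Type*} [TopologicalSpace X] {f g : X → Mink} (hf : Continuous f)
    (hg : Continuous g) : Continuous fun x => form (f x) (g x) := by
  unfold HypCurrents.form
  fun_prop

theorem form_self_eq (v : Mink) : form v v = ‖v.2‖ ^ 2 - v.1 ^ 2 := by
  simp only [form, real_inner_self_eq_norm_sq]; ring

/-- A vector orthogonal to a timelike vector is spacelike or zero. -/
theorem form_self_nonneg_of_orth {x w : Mink} (hx : form x x < 0) (h : form x w = 0) :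
    0 ≤ form w w ∧ (form w w = 0 → w = 0) := by
  obtain ⟨s, a⟩ := x
  obtain ⟨t, b⟩ := w
  rw [form_self_eq] at hx
  rw [form_self_eq]
  simp only [form] at h hx ⊢
  have hc : |inner ℝ a b| ≤ ‖a‖ * ‖b‖ := abs_real_inner_le_norm a b
  have hst : inner ℝ a b = s * t := by linarith
  have h1 : (s * t) ^ 2 ≤ (‖a‖ * ‖b‖) ^ 2 := by
    rw [← hst, ← sq_abs]
    exact pow_le_pow_left₀ (abs_nonneg _) hc 2
  have hs : 0 < s ^ 2 := by nlinarith [sq_nonneg ‖a‖]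
  have h2 : 0 ≤ (s ^ 2 - ‖a‖ ^ 2) * ‖b‖ ^ 2 := mul_nonneg (by linarith) (sq_nonneg _)
  have h3 : (s ^ 2 - ‖a‖ ^ 2) * ‖b‖ ^ 2 ≤ s ^ 2 * (‖b‖ ^ 2 - t ^ 2) := by nlinarith
  refine ⟨?_, fun h0 => ?_⟩
  · by_contra hneg
    push Not at hneg
    nlinarith
  · rw [h0, mul_zero] at h3
    have hb : ‖b‖ ^ 2 = 0 := by
      have := le_antisymm h3 h2
      rcases mul_eq_zero.1 this with h' | h'
      · linarith
      · exact h'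
    have ht : t ^ 2 = 0 := by linarith
    have hb' : b = 0 := by simpa using hb
    have ht' : t = 0 := by simpa using ht
    simp [hb', ht']

/-- The Cauchy–Schwarz inequality on the orthogonal complement of a timelike vector. -/
theorem form_sq_le_of_orth {x w w' : Mink} (hx : form x x < 0) (h : form x w = 0)
    (h' : form x w' = 0) : form w w' ^ 2 ≤ form w w * form w' w' := by
  obtain ⟨hc, hc0⟩ := form_self_nonneg_of_orth hx h'
  rcases hc.eq_or_lt with hc | hc
  · rw [hc0 hc.symm]; simp
  -- The component of `w` orthogonal to `w'`, cleared of its denominator; its square is nonnegative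
  -- and carries an extra factor `form w' w'`.
  · have h1 := (form_self_nonneg_of_orth (w := form w' w' • w - form w w' • w') hx
      (by simp [h, h'])).1
    simp only [form_sub_left, form_sub_right, form_smul_left, form_smul_right,
      form_comm w' w] at h1
    have : 0 ≤ form w' w' * (form w w * form w' w' - form w w' ^ 2) := by nlinarith
    nlinarith [nonneg_of_mul_nonneg_right this hc]

theorem norm_snd_lt {x : Mink} (hx : x ∈ hyperboloid) : ‖x.2‖ < x.1 := by
  obtain ⟨h, h0⟩ := hx
  rw [form_self_eq] at h
  nlinarith [norm_nonneg x.2]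

theorem form_hyp_neg {x y : Mink} (hx : x ∈ hyperboloid) (hy : y ∈ hyperboloid) :
    form x y < 0 := by
  have h1 := norm_snd_lt hx
  have h2 := norm_snd_lt hy
  have h3 := real_inner_le_norm x.2 y.2
  have h4 : ‖x.2‖ * ‖y.2‖ < x.1 * y.1 :=
    mul_lt_mul'' h1 h2 (norm_nonneg _) (norm_nonneg _)
  unfold form
  linarith

/-- The projection `y + form x y • x` of `y` to the complement of `x` has square `form x y ^ 2 - 1 ≥
0`, and the sign of `form x y` is known. -/
theorem form_hyp_le {x y : Mink} (hx : x ∈ hyperboloid) (hy : y ∈ hyperboloid) :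
    form x y ≤ -1 := by
  have h1 := (form_self_nonneg_of_orth (x := x) (w := y + form x y • x) (by rw [hx.1]; norm_num)
    (by simp [hx.1])).1
  simp only [form_add_left, form_add_right, form_smul_left, form_smul_right, hx.1, hy.1,
    form_comm y x] at h1
  nlinarith [form_hyp_neg hx hy]

theorem eq_of_form_hyp_eq {x y : Mink} (hx : x ∈ hyperboloid) (hy : y ∈ hyperboloid)
    (h : form x y = -1) : x = y := by
  have h1 := (form_self_nonneg_of_orth (x := x) (w := y - x) (by rw [hx.1]; norm_num)
    (by simp [hx.1, h])).2
  have h2 := h1 (by simp [hx.1, hy.1, h, form_comm y x])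
  exact (sub_eq_zero.1 h2).symm

/-- A vector with timelike square and positive pairing with the cone lies, after normalisation,
on the hyperboloid. -/
theorem smul_mem_hyperboloid {v : Mink} (hv : form v v < 0) (h0 : 0 < v.1) :
    (Real.sqrt (-form v v))⁻¹ • v ∈ hyperboloid := by
  have hp : 0 < Real.sqrt (-form v v) := Real.sqrt_pos.2 (by linarith)
  refine ⟨?_, mul_pos (inv_pos.2 hp) h0⟩
  rw [form_smul_left, form_smul_right, ← mul_assoc, ← mul_inv, Real.mul_self_sqrt (by linarith)]
  field_simp
  ring_nf
  rw [mul_inv_cancel₀ hv.ne]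

/-! ### Reflections -/

/-- The reflection in the hyperplane orthogonal to `u`. -/
def formReflection (u : Mink) : Mink →ₗ[ℝ] Mink where
  toFun v := v - (2 * form u v / form u u) • u
  map_add' v w := by
    rw [form_add_right, mul_add, add_div, add_smul]; abel
  map_smul' r v := by
    rw [form_smul_right, RingHom.id_apply, smul_sub, smul_smul]
    congr 2
    ring

theorem formReflection_apply (u v : Mink) :
    formReflection u v = v - (2 * form u v / form u u) • u := rfl

theorem formReflection_self_apply {u : Mink} (hu : form u u ≠ 0) (v : Mink) :
    formReflection u (formReflection u v) = v := by
  simp only [formReflection_apply, form_sub_right, form_smul_right]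
  have : 2 * (form u v - 2 * form u v / form u u * form u u) / form u u
      = - (2 * form u v / form u u) := by
    field_simp; ring
  rw [this, neg_smul]
  abel

theorem form_formReflection {u : Mink} (hu : form u u ≠ 0) (v w : Mink) :
    form (formReflection u v) (formReflection u w) = form v w := by
  simp only [formReflection_apply, form_sub_right, form_sub_left, form_smul_left, form_smul_right,
    form_comm v u]
  field_simp
  ring

/-- An involution has determinant of square one. The sign is irrelevant, as only the effect on
volumes matters. -/
theorem abs_det_formReflection {u : Mink} (hu : form u u ≠ 0) :
    |LinearMap.det (formReflection u)| = 1 := by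
  have h : formReflection u ∘ₗ formReflection u = LinearMap.id :=
    LinearMap.ext fun v => formReflection_self_apply hu v
  have h2 : LinearMap.det (formReflection u) * LinearMap.det (formReflection u) = 1 := by
    rw [← LinearMap.det_comp, h, LinearMap.det_id]
  rw [← abs_mul_self, abs_mul] at h2
  nlinarith [abs_nonneg (LinearMap.det (formReflection u))]

theorem formReflection_sub {x y : Mink} (hxy : form x x = form y y)
    (hu : form (x - y) (x - y) ≠ 0) : formReflection (x - y) x = y := by
  rw [formReflection_apply]
  have : 2 * form (x - y) x / form (x - y) (x - y) = 1 := by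
    rw [div_eq_one_iff_eq hu]
    simp only [form_sub_left, form_sub_right, form_comm y x]
    linarith
  rw [this, one_smul, sub_sub_cancel]

/-- Form-preserving linear maps with determinant `±1`. -/
def IsLorentz (A : Mink →ₗ[ℝ] Mink) : Prop :=
  (∀ v w, form (A v) (A w) = form v w) ∧ |LinearMap.det A| = 1

theorem IsLorentz.comp {A B : Mink →ₗ[ℝ] Mink} (hA : IsLorentz A) (hB : IsLorentz B) :
    IsLorentz (A ∘ₗ B) :=
  ⟨fun v w => by rw [LinearMap.comp_apply, LinearMap.comp_apply, hA.1, hB.1], by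
    rw [LinearMap.det_comp, abs_mul, hA.2, hB.2, one_mul]⟩

theorem isLorentz_id : IsLorentz LinearMap.id := ⟨fun _ _ => rfl, by simp⟩

theorem isLorentz_formReflection {u : Mink} (hu : form u u ≠ 0) : IsLorentz (formReflection u) :=
  ⟨form_formReflection hu, abs_det_formReflection hu⟩

theorem isLorentz_isomPlus (g : IsomPlus) : IsLorentz (g.1 : Mink →ₗ[ℝ] Mink) := by
  refine ⟨form_map g, ?_⟩
  have h : LinearEquiv.det g.1 = 1 := g.2.2.2
  have h2 : LinearMap.det (g.1 : Mink →ₗ[ℝ] Mink) = 1 := by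
    rw [← LinearEquiv.coe_det, h]; rfl
  rw [h2, abs_one]

/-- Frames consisting of a point of the hyperboloid and a unit tangent vector are equivalent under
form-preserving maps. -/
theorem exists_isLorentz_frame {x v : Mink} (hx : x ∈ hyperboloid) (hxv : form x v = 0)
    (hv : form v v = 1) (e : E3) (he : ‖e‖ = 1) :
    ∃ A : Mink →ₗ[ℝ] Mink, IsLorentz A ∧ A x = (1, 0) ∧ A v = (0, e) := by
  obtain ⟨A, hA, hAx⟩ : ∃ A : Mink →ₗ[ℝ] Mink, IsLorentz A ∧ A x = (1, 0) := by
    by_cases h : x = (1, 0)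
    · exact ⟨LinearMap.id, isLorentz_id, h⟩
    · have hb : ((1, 0) : Mink) ∈ hyperboloid := basePoint.2
      have hu : form (x - (1, 0)) (x - (1, 0)) ≠ 0 := by
        intro h0
        apply h
        apply eq_of_form_hyp_eq hx hb
        simp only [form_sub_left, form_sub_right, hx.1, hb.1, form_comm (1, 0) x] at h0
        linarith
      exact ⟨_, isLorentz_formReflection hu, formReflection_sub (hx.1.trans hb.1.symm) hu⟩
  have h1 : form (A x) (A v) = 0 := by rw [hA.1, hxv]
  have h2 : form (A v) (A v) = 1 := by rw [hA.1, hv]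
  obtain ⟨f, hf⟩ : ∃ f : E3, A v = (0, f) := by
    refine ⟨(A v).2, Prod.ext ?_ rfl⟩
    rw [hAx] at h1
    simpa [form] using h1
  have hfn : ‖f‖ ^ 2 = 1 := by
    rw [hf, form_self_eq] at h2
    simpa using h2
  by_cases h : f = e
  · exact ⟨A, hA, hAx, by rw [hf, h]⟩
  · have hu : form ((0, f) - (0, e) : Mink) ((0, f) - (0, e)) ≠ 0 := by
      rw [form_self_eq]
      simpa [sub_eq_zero] using h
    -- The vector `(0, f - e)` is orthogonal to `(1, 0)`, so the second reflection does not undo the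
    -- first.
    refine ⟨formReflection ((0, f) - (0, e)) ∘ₗ A, (isLorentz_formReflection hu).comp hA, ?_, ?_⟩
    · rw [LinearMap.comp_apply, hAx, formReflection_apply]
      simp [form]
    · rw [LinearMap.comp_apply, hf]
      refine formReflection_sub ?_ hu
      rw [form_self_eq, form_self_eq]
      simp [hfn, he]

/-! ### Topology of hyperbolic space -/

theorem isClosed_hyperboloid : IsClosed hyperboloid := by
  have : hyperboloid = {v : Mink | form v v = -1} ∩ {v | 0 ≤ v.1} := by
    ext v
    refine ⟨fun h => ⟨h.1, h.2.le⟩, fun h => ⟨h.1, lt_of_le_of_ne h.2 fun h0 => ?_⟩⟩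
    have h1 : form v v = -1 := h.1
    rw [form_self_eq, ← h0] at h1
    nlinarith [sq_nonneg ‖v.2‖]
  rw [this]
  exact (isClosed_eq (by fun_prop) continuous_const).inter
    (isClosed_le continuous_const continuous_fst)

instance : LocallyCompactSpace Hyp3 := isClosed_hyperboloid.isClosedEmbedding_subtypeVal.locallyCompactSpace

theorem coe_smul_hyp (g : IsomPlus) (x : Hyp3) : ((g • x : Hyp3) : Mink) = g.1 x := rfl

theorem continuous_isomPlus (g : IsomPlus) : Continuous fun v : Mink => g.1 v :=
  LinearMap.continuous_of_finiteDimensional (g.1 : Mink →ₗ[ℝ] Mink)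

instance : ContinuousConstSMul IsomPlus Hyp3 :=
  ⟨fun g => ((continuous_isomPlus g).comp continuous_subtype_val).subtype_mk _⟩

instance (Γ : Subgroup IsomPlus) : ContinuousConstSMul Γ Hyp3 :=
  ⟨fun g => continuous_const_smul (g : IsomPlus)⟩

theorem fst_pos_of_form_neg {x y : Mink} (hx : x ∈ hyperboloid) (hy : form y y ≤ 0)
    (h : form x y < 0) : 0 < y.1 := by
  by_contra hc
  push Not at hc
  have h1 := norm_snd_lt hx
  have h2 := abs_le.1 (abs_real_inner_le_norm x.2 y.2)
  have h3 : ‖y.2‖ ≤ -y.1 := by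
    rw [form_self_eq] at hy
    exact abs_le_of_sq_le_sq' (by linarith [neg_sq y.1]) (by linarith) |>.2
  have h4 : ‖x.2‖ * ‖y.2‖ ≤ x.1 * (-y.1) :=
    mul_le_mul h1.le h3 (norm_nonneg _) hx.2.le
  unfold form at h
  linarith

theorem geodesic_mem_hyperboloid {x v : Mink} (hx : x ∈ hyperboloid) (hxv : form x v = 0)
    (hv : form v v = 1) (t : ℝ) : Real.cosh t • x + Real.sinh t • v ∈ hyperboloid := by
  have h1 : form (Real.cosh t • x + Real.sinh t • v) (Real.cosh t • x + Real.sinh t • v) = -1 := by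
    simp only [form_add_left, form_add_right, form_smul_left, form_smul_right, hx.1, hxv, hv,
      form_comm v x]
    linarith [Real.cosh_sq t]
  refine ⟨h1, fst_pos_of_form_neg hx (by rw [h1]; norm_num) ?_⟩
  simp only [form_add_right, form_smul_right, hx.1, hxv]
  linarith [Real.cosh_pos t]

/-! ### Displacement -/

/-- At a point of minimal displacement, the orbit lies on a geodesic. -/
theorem apply_apply_of_minimal {h : IsomPlus} {x : Hyp3}
    (hmin : ∀ y : Hyp3, form y (h • y : Hyp3) ≤ form x (h • x : Hyp3)) :
    h.1 (h.1 x.1) = (-2 * form x (h • x : Hyp3)) • h.1 x.1 - x.1 := by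
  set y : Mink := h.1 x.1 with hy
  set z : Mink := h.1 y with hz
  have hxy : form x.1 (h • x : Hyp3) = form x.1 y := rfl
  rw [hxy]
  have hyy : form y y = -1 := by rw [hy, form_map, x.2.1]
  have hzz : form z z = -1 := by rw [hz, form_map, hyy]
  have hyz : form y z = form x.1 y := by rw [hz, hy, form_map]
  have hneg : form x.1 y ≤ -1 := form_hyp_le x.2 (h • x).2
  have hsum : form (x.1 + y) (x.1 + y) = -2 + 2 * form x.1 y := by
    simp only [form_add_left, form_add_right, x.2.1, hyy, form_comm y x.1]; ring
  -- Minimality is tested at the midpoint of `x` and `h • x`, the normalised sum.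
  have hm := smul_mem_hyperboloid (v := x.1 + y) (by rw [hsum]; linarith)
    (add_pos x.2.2 (h • x).2.2)
  have h1 := hmin ⟨_, hm⟩
  have h2 : form ((Real.sqrt (-form (x.1 + y) (x.1 + y)))⁻¹ • (x.1 + y))
      (h.1 ((Real.sqrt (-form (x.1 + y) (x.1 + y)))⁻¹ • (x.1 + y)))
      = (2 - 2 * form x.1 y)⁻¹ * (2 * form x.1 y + form x.1 z - 1) := by
    rw [map_smul, form_smul_left, form_smul_right, ← mul_assoc, ← mul_inv,
      Real.mul_self_sqrt (by rw [hsum]; linarith), hsum, map_add, ← hy, ← hz]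
    simp only [form_add_left, form_add_right, hyy, hyz]
    ring
  have h3 : (2 - 2 * form x.1 y)⁻¹ * (2 * form x.1 y + form x.1 z - 1) ≤ form x.1 y := by
    rw [← h2]; exact h1
  rw [inv_mul_le_iff₀ (by linarith)] at h3
  -- This vector is orthogonal to the timelike `y`, so its square is nonnegative; the midpoint
  -- inequality `h3` makes the square nonpositive. Hence it vanishes, which is the claimed relation.
  have he := (form_self_nonneg_of_orth (x := y) (w := x.1 + z + (2 * form x.1 y) • y)
    (by rw [hyy]; norm_num)
    (by simp only [form_add_right, form_smul_right, hyy, hyz, form_comm y x.1]; ring))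
  have hee : form (x.1 + z + (2 * form x.1 y) • y) (x.1 + z + (2 * form x.1 y) • y)
      = -2 + 2 * form x.1 z + 4 * form x.1 y ^ 2 := by
    simp only [form_add_left, form_add_right, form_smul_right, form_smul_left, hyy, hyz, hzz,
      form_comm y x.1, form_comm z x.1, form_comm z y, x.2.1]
    ring
  have h0 := he.2 (le_antisymm (by rw [hee]; nlinarith) he.1)
  have h4 : z = -x.1 - (2 * form x.1 y) • y := by
    rw [add_right_comm, add_eq_zero_iff_eq_neg'] at h0
    rw [h0]; abel
  rw [h4, neg_mul, neg_smul]
  abel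

/-- An isometry without fixed points which attains its minimal displacement translates a
geodesic. -/
theorem exists_translated_line {h : IsomPlus} {x : Hyp3} (hne : h • x ≠ x)
    (hmin : ∀ y : Hyp3, form y (h • y : Hyp3) ≤ form x (h • x : Hyp3)) :
    ∃ (a : ℝ → Hyp3) (l : ℝ), 0 < l ∧ IsGeodesicLine a ∧ ∀ t, h • a t = a (t + l) := by
  have h2 := apply_apply_of_minimal hmin
  set y : Mink := h.1 x.1 with hy
  have hxy : form x.1 (h • x : Hyp3) = form x.1 y := rfl
  rw [hxy] at h2
  have hyy : form y y = -1 := by rw [hy, form_map, x.2.1]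
  have hle : form x.1 y ≤ -1 := form_hyp_le x.2 (h • x).2
  have hlt : 1 < -form x.1 y := by
    rcases hle.lt_or_eq with h' | h'
    · linarith
    · exact absurd (Subtype.ext (eq_of_form_hyp_eq x.2 (h • x).2 h').symm) hne
  set c := -form x.1 y with hc
  have hxy' : form x.1 y = -c := by rw [hc, neg_neg]
  have hl := Real.arcosh_pos hlt
  set l := Real.arcosh c with hl'
  have hcl : Real.cosh l = c := Real.cosh_arcosh hlt.le
  have hsl : 0 < Real.sinh l := Real.sinh_pos_iff.2 hl
  have hsq : Real.sinh l ^ 2 = c ^ 2 - 1 := by rw [Real.sinh_sq, hcl]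
  -- The unit tangent vector at `x` pointing to `h • x`, which lies at distance `l`.
  set v : Mink := (Real.sinh l)⁻¹ • (y - c • x.1) with hv
  have hyv : y = Real.cosh l • x.1 + Real.sinh l • v := by
    rw [hv, smul_smul, mul_inv_cancel₀ hsl.ne', one_smul, hcl]; abel
  have hxv : form x.1 v = 0 := by
    simp only [hv, form_smul_right, form_sub_right, x.2.1, hxy']; ring
  have hvv : form v v = 1 := by
    have : form (y - c • x.1) (y - c • x.1) = Real.sinh l ^ 2 := by
      simp only [form_smul_right, form_smul_left, form_sub_right, form_sub_left, x.2.1, hxy',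
        form_comm y x.1, hyy, hsq]
      ring
    simp only [hv, form_smul_right, form_smul_left, this]
    field_simp
  -- The recursion `h² x = 2c • h x - x` determines `h` on the plane spanned by `x` and `v`: it is
  -- the hyperbolic rotation by `l`.
  have hhv : h.1 v = Real.sinh l • x.1 + Real.cosh l • v := by
    have e1 : h.1 v = (Real.sinh l)⁻¹ • ((2 * c) • y - x.1 - c • y) := by
      rw [hv, map_smul, map_sub, map_smul, h2, ← hy, hc]
      congr 4
      ring
    rw [e1, hyv, hcl]
    have : (2 * c) • (c • x.1 + Real.sinh l • v) - x.1 - c • (c • x.1 + Real.sinh l • v)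
        = Real.sinh l • (Real.sinh l • x.1 + c • v) := by
      have e2 : Real.sinh l • Real.sinh l • x.1 = (c ^ 2 - 1) • x.1 := by
        rw [smul_smul, ← sq, hsq]
      rw [smul_add (Real.sinh l), e2]
      module
    rw [this, smul_smul, inv_mul_cancel₀ hsl.ne', one_smul]
  refine ⟨fun t => ⟨_, geodesic_mem_hyperboloid x.2 hxv hvv t⟩, l, hl,
    ⟨x.1, v, hxv, hvv, fun t => rfl⟩, fun t => Subtype.ext ?_⟩
  change h.1 (Real.cosh t • x.1 + Real.sinh t • v) = _
  change _ = Real.cosh (t + l) • x.1 + Real.sinh (t + l) • v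
  rw [map_add, map_smul, map_smul, ← hy, hhv, hyv, Real.cosh_add, Real.sinh_add]
  module

/-- Time `0` gives the image of `x`; time `1` then gives that of `v`, because `sinh 1 ≠ 0`. -/
theorem apply_frame_of_translate {h : IsomPlus} {a : ℝ → Hyp3} {l : ℝ} {x v : Mink}
    (ha : ∀ t, (a t : Mink) = Real.cosh t • x + Real.sinh t • v)
    (hh : ∀ t, h • a t = a (t + l)) :
    h.1 x = Real.cosh l • x + Real.sinh l • v ∧ h.1 v = Real.sinh l • x + Real.cosh l • v := by
  have h1 : ∀ t, h.1 (Real.cosh t • x + Real.sinh t • v)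
      = Real.cosh (t + l) • x + Real.sinh (t + l) • v := fun t => by
    rw [← ha, ← ha, ← hh]; rfl
  have h0 : h.1 x = Real.cosh l • x + Real.sinh l • v := by simpa using h1 0
  refine ⟨h0, ?_⟩
  have h2 := h1 1
  rw [map_add, map_smul, map_smul, h0, Real.cosh_add, Real.sinh_add] at h2
  have hs : Real.sinh 1 ≠ 0 := (Real.sinh_pos_iff.2 one_pos).ne'
  apply smul_right_injective _ hs
  change Real.sinh 1 • h.1 v = Real.sinh 1 • _
  rw [← sub_eq_zero] at h2 ⊢
  rw [← h2]
  module

/-- An isometry translating a geodesic by `l` moves every point at least by `l`. -/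
theorem form_smul_le_of_translate {h : IsomPlus} {a : ℝ → Hyp3} {l : ℝ} (hg : IsGeodesicLine a)
    (hh : ∀ t, h • a t = a (t + l)) (y : Hyp3) : form y (h • y : Hyp3) ≤ -Real.cosh l := by
  obtain ⟨x, v, hxv, hvv, ha⟩ := hg
  obtain ⟨hx', hv'⟩ := apply_frame_of_translate ha hh
  have hxx : form x x = -1 := by
    have := (a 0).2.1
    rw [ha] at this
    simpa using this
  set α := -form x y with hα
  set β := form v y with hβ
  -- The component of `y` orthogonal to the plane that contains the line.
  set w : Mink := y.1 - (α • x + β • v) with hw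
  have hyw : y.1 = α • x + β • v + w := by rw [hw]; abel
  have hxw : form x w = 0 := by
    simp only [hw, form_sub_right, form_add_right, form_smul_right, hxx, hxv, hα]; ring
  have hvw : form v w = 0 := by
    simp only [hw, form_sub_right, form_add_right, form_smul_right, hvv, form_comm v x, hxv, hβ]
    ring
  have hc2 := Real.cosh_sq l
  have e1 : form (h.1 x) (h.1 w) = 0 := by rw [form_map, hxw]
  have e2 : form (h.1 v) (h.1 w) = 0 := by rw [form_map, hvw]
  rw [hx'] at e1
  rw [hv'] at e2
  simp only [form_add_left, form_smul_left] at e1 e2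
  -- `e1` and `e2` say that `h w` is orthogonal to `h x` and `h v`; the hyperbolic rotation has
  -- determinant `cosh² - sinh² = 1`, so `h w` is orthogonal to `x` and `v`.
  have hxhw : form x (h.1 w) = 0 := by
    have : (Real.cosh l ^ 2 - Real.sinh l ^ 2) * form x (h.1 w) = 0 := by
      linear_combination Real.cosh l * e1 - Real.sinh l * e2
    rw [hc2] at this
    linarith
  have hvhw : form v (h.1 w) = 0 := by
    have : (Real.cosh l ^ 2 - Real.sinh l ^ 2) * form v (h.1 w) = 0 := by
      linear_combination Real.cosh l * e2 - Real.sinh l * e1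
    rw [hc2] at this
    linarith
  have hx0 : form x x < 0 := by rw [hxx]; norm_num
  have hww := (form_self_nonneg_of_orth hx0 hxw).1
  have hcs := form_sq_le_of_orth hx0 hxw hxhw
  rw [form_map] at hcs
  have hcs' : form w (h.1 w) ≤ form w w := by
    exact (abs_le.1 (abs_le_of_sq_le_sq (by rw [sq (form w w)]; exact hcs) hww)).2
  have hyy := y.2.1
  rw [hyw] at hyy
  simp only [form_add_left, form_add_right, form_smul_left, form_smul_right, hxx, hvv, hxv, hxw,
    hvw, form_comm v x, form_comm w x, form_comm w v] at hyy
  have e3 : form x (h.1 y.1) = form x (h.1 y.1) := rfl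
  -- Here `α² - β² = 1 + form w w` by `hyy`, and `form w (h w) ≤ form w w` by Cauchy–Schwarz, so the
  -- excess over the line is `form w w * (1 - cosh l) ≤ 0`.
  have key : form y.1 (h.1 y.1) = -(α ^ 2 - β ^ 2) * Real.cosh l + form w (h.1 w) := by
    conv_lhs => rw [hyw]
    rw [map_add, map_add, map_smul, map_smul, hx', hv']
    simp only [form_add_left, form_add_right, form_smul_left, form_smul_right, hxx, hvv, hxv, hxw,
      hvw, form_comm v x, form_comm w x, form_comm w v, hxhw, hvhw]
    ring
  change form y.1 (h.1 y.1) ≤ _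
  rw [key]
  have := Real.one_le_cosh l
  nlinarith

theorem hdist_le_of_translate {h : IsomPlus} {a : ℝ → Hyp3} {l : ℝ} (hl : 0 ≤ l)
    (hg : IsGeodesicLine a)
    (hh : ∀ t, h • a t = a (t + l)) (y : Hyp3) : l ≤ hdist y (h • y) := by
  have h1 := form_smul_le_of_translate hg hh y
  have hc := Real.cosh_pos l
  rw [hdist, ← Real.arcosh_cosh hl, Real.arcosh_le_arcosh hc (by linarith)]
  linarith

theorem IsGeodesicLine.hdist_eq {a : ℝ → Hyp3} (hg : IsGeodesicLine a) {s t : ℝ} (hst : s ≤ t) :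
    hdist (a s) (a t) = t - s := by
  obtain ⟨x, v, hxv, hvv, ha⟩ := hg
  have hxx : form x x = -1 := by
    have := (a 0).2.1
    rw [ha] at this
    simpa using this
  have : -form (a s) (a t) = Real.cosh (t - s) := by
    rw [ha, ha, Real.cosh_sub]
    simp only [form_add_left, form_add_right, form_smul_left, form_smul_right, hxx, hvv, hxv,
      form_comm v x]
    ring
  rw [hdist, this, Real.arcosh_cosh (sub_nonneg.2 hst)]

theorem IsGeodesicLine.continuous {a : ℝ → Hyp3} (hg : IsGeodesicLine a) : Continuous a := by
  obtain ⟨x, v, -, -, ha⟩ := hg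
  refine continuous_induced_rng.2 ?_
  have : (Subtype.val ∘ a) = fun t => Real.cosh t • x + Real.sinh t • v := funext ha
  rw [this]
  have := Real.continuous_cosh
  have := Real.continuous_sinh
  fun_prop

/-! ### Cocompact groups -/

/-- Cauchy–Schwarz bounds `z.1 * (y.1 - ‖y.2‖)` by `c`, and the factor is the inverse of `y.1 +
‖y.2‖ ≤ 2r`. So points at bounded distance from a bounded set stay in a compact set. -/
theorem norm_le_of_form_le {y z : Hyp3} {r c : ℝ} (hy : ‖(y : Mink)‖ ≤ r)
    (h : -form y z ≤ c) : ‖(z : Mink)‖ ≤ 2 * r * c := by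
  have h1 := norm_snd_lt y.2
  have h2 := norm_snd_lt z.2
  have h3 := real_inner_le_norm y.1.2 z.1.2
  have h4 : form y.1 y.1 = -1 := y.2.1
  rw [form_self_eq] at h4
  have hz0 := z.2.2
  have hy0 := y.2.2
  have hyr : y.1.1 ≤ r := by
    have := norm_fst_le y.1
    rw [Real.norm_eq_abs] at this
    exact (le_abs_self _).trans (this.trans hy)
  have hzn : ‖z.1‖ = z.1.1 := by
    rw [Prod.norm_def, Real.norm_eq_abs, abs_of_pos hz0, max_eq_left h2.le]
  have h5 : z.1.1 * (y.1.1 - ‖y.1.2‖) ≤ c := by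
    have : ‖y.1.2‖ * ‖z.1.2‖ ≤ ‖y.1.2‖ * z.1.1 := by gcongr
    unfold form at h
    nlinarith
  have hfac : (y.1.1 - ‖y.1.2‖) * (y.1.1 + ‖y.1.2‖) = 1 := by linarith
  have hp : 0 < y.1.1 + ‖y.1.2‖ := by positivity
  have h6 : z.1.1 ≤ c * (y.1.1 + ‖y.1.2‖) := by
    calc z.1.1 = z.1.1 * (y.1.1 - ‖y.1.2‖) * (y.1.1 + ‖y.1.2‖) := by
          rw [mul_assoc, hfac, mul_one]
      _ ≤ _ := by gcongr
  have hc : 0 ≤ c := (mul_pos hz0 (by linarith)).le.trans h5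
  rw [hzn]
  nlinarith [mul_le_mul_of_nonneg_left (show y.1.1 + ‖y.1.2‖ ≤ 2 * r by linarith) hc]

theorem isCompact_hyp_norm_le (r : ℝ) : IsCompact {x : Hyp3 | ‖(x : Mink)‖ ≤ r} := by
  have : {x : Hyp3 | ‖(x : Mink)‖ ≤ r} = Subtype.val ⁻¹' Metric.closedBall (0 : Mink) r := by
    ext x; simp
  rw [this]
  exact isClosed_hyperboloid.isClosedEmbedding_subtypeVal.isCompact_preimage
    (isCompact_closedBall _ _)

theorem isOpenQuotientMap_proj (Γ : Subgroup IsomPlus) : IsOpenQuotientMap (proj Γ) :=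
  MulAction.isOpenQuotientMap_quotientMk

theorem proj_eq_iff {Γ : Subgroup IsomPlus} {x y : Hyp3} :
    proj Γ x = proj Γ y ↔ ∃ g : Γ, g • y = x := Quotient.eq''

theorem proj_smul {Γ : Subgroup IsomPlus} (g : Γ) (x : Hyp3) : proj Γ (g • x) = proj Γ x :=
  proj_eq_iff.2 ⟨g, rfl⟩

/-- The images of the open balls about the origin are an increasing open cover of the compact
quotient, so one ball meets every orbit. -/
theorem exists_norm_le_translates {Γ : Subgroup IsomPlus} (hΓ : IsClosedManifoldGroup Γ) :
    ∃ r : ℝ, ∀ x : Hyp3, ∃ g : Γ, ‖((g • x : Hyp3) : Mink)‖ ≤ r := by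
  have := hΓ.compact
  obtain ⟨s, hs⟩ := isCompact_univ.elim_finite_subcover
    (fun n : ℕ => proj Γ '' {x : Hyp3 | ‖(x : Mink)‖ < n})
    (fun n => (isOpenQuotientMap_proj Γ).isOpenMap _
      (isOpen_lt (continuous_subtype_val.norm) continuous_const))
    (by
      rintro z -
      obtain ⟨x, rfl⟩ := (isOpenQuotientMap_proj Γ).surjective z
      obtain ⟨n, hn⟩ := exists_nat_gt ‖(x : Mink)‖
      exact Set.mem_iUnion.2 ⟨n, x, hn, rfl⟩)
  refine ⟨(s.sup id : ℕ), fun x => ?_⟩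
  have hx := hs (Set.mem_univ (proj Γ x))
  simp only [Set.mem_iUnion] at hx
  obtain ⟨n, hn, y, hy, hxy⟩ := hx
  obtain ⟨g, rfl⟩ := proj_eq_iff.1 hxy
  refine ⟨g, (le_of_lt hy).trans ?_⟩
  exact_mod_cast Finset.le_sup (f := id) hn

/-- The minimal displacement of a deck transformation is attained. -/
theorem exists_minimal_displacement {Γ : Subgroup IsomPlus} (hΓ : IsClosedManifoldGroup Γ)
    (h : Γ) : ∃ x : Hyp3, ∀ y : Hyp3, form y (h • y : Hyp3) ≤ form x (h • x : Hyp3) := by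
  have := hΓ.properlyDiscontinuous
  obtain ⟨r, hr⟩ := exists_norm_le_translates hΓ
  -- Moving a point by `g` replaces `h` by a conjugate without changing the displacement, so points
  -- may be brought into the compact set `K`.
  have conj : ∀ (g : Γ) (y : Hyp3), form y (h • y : Hyp3)
      = form (g • y : Hyp3) ((g * h * g⁻¹) • g • y : Hyp3) := by
    intro g y
    rw [smul_smul, inv_mul_cancel_right, mul_smul]
    exact (form_map g.1 _ _).symm
  set c := -form basePoint (h • basePoint : Hyp3) with hc
  set K := {x : Hyp3 | ‖(x : Mink)‖ ≤ r} with hK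
  have hKc : IsCompact K := isCompact_hyp_norm_le r
  -- The conjugates of `h` that move some point of `K` no more than `h` moves the base point. Proper
  -- discontinuity leaves finitely many.
  set D : Set Γ := {k | (∃ g : Γ, k = g * h * g⁻¹) ∧ ∃ y ∈ K, -form y (k • y : Hyp3) ≤ c} with hD
  have hDf : D.Finite := by
    refine (ProperlyDiscontinuousSMul.finite_disjoint_inter_image (Γ := Γ) hKc
      (isCompact_hyp_norm_le (2 * r * c))).subset ?_
    rintro k ⟨-, y, hy, hyc⟩
    have : k • y ∈ ((k • ·) '' K) ∩ {x : Hyp3 | ‖(x : Mink)‖ ≤ 2 * r * c} :=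
      ⟨⟨y, hy, rfl⟩, norm_le_of_form_le hy hyc⟩
    exact ⟨_, this⟩
  have hmem : ∀ y : Hyp3, -form y (h • y : Hyp3) ≤ c →
      ∃ g : Γ, g * h * g⁻¹ ∈ D ∧ g • y ∈ K := by
    intro y hy
    obtain ⟨g, hg⟩ := hr y
    exact ⟨g, ⟨⟨g, rfl⟩, g • y, hg, by rw [← conj]; exact hy⟩, hg⟩
  have hcont : ∀ k : Γ, Continuous fun y : Hyp3 => form y (k • y : Hyp3) := fun k =>
    continuous_form continuous_subtype_val (continuous_subtype_val.comp (continuous_const_smul k))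
  obtain ⟨g₀, hg₀, hg₀K⟩ := hmem basePoint le_rfl
  have hmax : ∀ k : Γ, ∃ x ∈ K, ∀ y ∈ K, form y (k • y : Hyp3) ≤ form x (k • x : Hyp3) := fun k =>
    hKc.exists_isMaxOn ⟨_, hg₀K⟩ (hcont k).continuousOn
  choose m hmK hm using hmax
  -- The optimum is taken first over `K` for each conjugate, then over the finite set `D`.
  obtain ⟨k, hkD, hk⟩ := hDf.exists_maximalFor (fun k => form (m k) (k • m k : Hyp3)) D ⟨_, hg₀⟩
  obtain ⟨⟨g, rfl⟩, -⟩ := hkD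
  have hval : ∀ k ∈ D, form (m k) (k • m k : Hyp3)
      ≤ form (m (g * h * g⁻¹)) ((g * h * g⁻¹) • m (g * h * g⁻¹) : Hyp3) := by
    intro k hkD
    rcases le_total (form (m k) (k • m k : Hyp3))
      (form (m (g * h * g⁻¹)) ((g * h * g⁻¹) • m (g * h * g⁻¹) : Hyp3)) with h' | h'
    · exact h'
    · exact hk hkD h'
  refine ⟨g⁻¹ • m (g * h * g⁻¹), fun y => ?_⟩
  rw [conj g (g⁻¹ • m (g * h * g⁻¹)), smul_inv_smul]
  by_cases hy : -form y (h • y : Hyp3) ≤ c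
  · obtain ⟨g', hg', hgK⟩ := hmem y hy
    rw [conj g']
    exact (hm _ _ hgK).trans (hval _ hg')
  -- Points moved more than the base point cannot be better, since the base point is among the
  -- competitors.
  · push Not at hy
    have e : form basePoint (h • basePoint : Hyp3) = -c := by rw [hc, neg_neg]
    have := (hm _ _ hg₀K).trans (hval _ hg₀)
    rw [← conj, e] at this
    linarith

/-! ### Lifting closed curves -/

section Covering

variable {Γ : Subgroup IsomPlus}

theorem isCoveringMap_proj (hΓ : IsClosedManifoldGroup Γ) : IsCoveringMap (proj Γ) := by
  have := hΓ.properlyDiscontinuous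
  have : IsCancelSMul Γ Hyp3 := isCancelSMul_iff_eq_one_of_smul_eq.2 hΓ.free
  exact (isQuotientCoveringMap_quotientMk_of_properlyDiscontinuousSMul (G := Γ)
    (E := Hyp3)).isCoveringMap

/-- Two lifts of the same map differ by a deck transformation. -/
theorem exists_deck (hΓ : IsClosedManifoldGroup Γ) {A : Type*} [TopologicalSpace A]
    [PreconnectedSpace A] [Nonempty A] {f g : A → Hyp3} (hf : Continuous f) (hg : Continuous g)
    (h : ∀ a, proj Γ (f a) = proj Γ (g a)) : ∃ k : Γ, ∀ a, f a = k • g a := by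
  obtain ⟨a₀⟩ := ‹Nonempty A›
  obtain ⟨k, hk⟩ := proj_eq_iff.1 (h a₀)
  refine ⟨k, fun a => congrFun ((isCoveringMap_proj hΓ).eq_of_comp_eq hf (hg.const_smul k)
    (funext fun b => ?_) a₀ hk.symm) a⟩
  change proj Γ (f b) = proj Γ (k • g b)
  rw [proj_smul, h]

/-- `β` is a lift of the closed curve `c` to `ℝ`, with holonomy `k`. -/
structure IsLoopLift (c : C(UnitAddCircle, HypQuot Γ)) (β : C(ℝ, Hyp3)) (k : Γ) : Prop where
  lifts : ∀ t : ℝ, proj Γ (β t) = c (t : UnitAddCircle)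
  holonomy : ∀ t, β (t + 1) = k • β t

/-- For a lift `β` over `ℝ`, the shifted path `t ↦ β (t + 1)` is a lift of the same map; the deck
transformation between the two is the holonomy. -/
theorem exists_isLoopLift (hΓ : IsClosedManifoldGroup Γ) (c : C(UnitAddCircle, HypQuot Γ)) :
    ∃ β k, IsLoopLift c β k := by
  obtain ⟨x, hx⟩ := (isOpenQuotientMap_proj Γ).surjective (c ((0 : ℝ) : UnitAddCircle))
  let c' : C(ℝ, HypQuot Γ) := c.comp ⟨fun t : ℝ => (t : UnitAddCircle), AddCircle.continuous_mk' 1⟩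
  obtain ⟨β, ⟨-, hβ⟩, -⟩ := (isCoveringMap_proj hΓ).existsUnique_continuousMap_lifts c' 0 x hx
  have hl : ∀ t : ℝ, proj Γ (β t) = c (t : UnitAddCircle) := fun t => congrFun hβ t
  obtain ⟨k, hk⟩ := exists_deck hΓ (f := fun t => β (t + 1)) (g := β)
    (by fun_prop) β.continuous (fun t => by
      rw [hl, hl, AddCircle.coe_add, AddCircle.coe_period, add_zero])
  exact ⟨β, k, hl, hk⟩

/-- The homotopy lifts to the simply connected `ℝ × ℝ`. One deck transformation realises the unit
shift on the whole connected plane, so the holonomy is the same at both ends. -/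
theorem IsLoopLift.of_homotopic (hΓ : IsClosedManifoldGroup Γ)
    {c c' : C(UnitAddCircle, HypQuot Γ)} {β : C(ℝ, Hyp3)} {k : Γ} (hβ : IsLoopLift c β k)
    (h : c.Homotopic c') : ∃ β', IsLoopLift c' β' k := by
  obtain ⟨F⟩ := h
  -- Clamping extends the homotopy parameter from `[0, 1]` to the whole line.
  let p : ℝ → unitInterval := Set.projIcc 0 1 zero_le_one
  have hp : Continuous p := continuous_projIcc
  have hp0 : p 0 = 0 := Set.projIcc_left _
  have hp1 : p 1 = 1 := Set.projIcc_right _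
  let G : C(ℝ × ℝ, HypQuot Γ) :=
    ⟨fun z => F (p z.1, (z.2 : UnitAddCircle)),
      F.continuous.comp ((hp.comp continuous_fst).prodMk ((AddCircle.continuous_mk' 1).comp continuous_snd))⟩
  have hG0 : proj Γ (β 0) = G (0, 0) := by
    rw [hβ.lifts]
    change _ = F (p 0, _)
    rw [hp0]
    exact (F.apply_zero _).symm
  obtain ⟨H, ⟨h0, hH⟩, -⟩ := (isCoveringMap_proj hΓ).existsUnique_continuousMap_lifts G (0, 0)
    (β 0) hG0
  have hl : ∀ z : ℝ × ℝ, proj Γ (H z) = F (p z.1, (z.2 : UnitAddCircle)) :=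
    fun z => congrFun hH z
  obtain ⟨m, hm⟩ := exists_deck hΓ (f := fun z : ℝ × ℝ => H (z.1, z.2 + 1)) (g := H)
    (by fun_prop) H.continuous (fun z => by
      rw [hl, hl, AddCircle.coe_add, AddCircle.coe_period, add_zero])
  have hβH : ∀ t, β t = H (0, t) := by
    intro t
    refine congrFun ((isCoveringMap_proj hΓ).eq_of_comp_eq β.continuous
      (g₂ := fun t => H (0, t)) (by fun_prop) (funext fun b => ?_) 0 h0.symm) t
    change proj Γ (β b) = proj Γ (H (0, b))
    rw [hβ.lifts, hl, hp0, F.apply_zero]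
  -- The two elements agree at one point, and the action is free.
  have hmk : m = k := by
    have h1 : m • β 0 = k • β 0 := by
      rw [← hβ.holonomy, hβH, hβH]
      exact (hm (0, 0)).symm
    rw [← inv_mul_eq_one, ← mul_right_inj (1 : Γ)]
    have := hΓ.free (m⁻¹ * k) (β 0) (by rw [mul_smul, ← h1, inv_smul_smul])
    rw [this]
  refine ⟨⟨fun t => H (1, t), by fun_prop⟩, fun t => ?_, fun t => ?_⟩
  · change proj Γ (H (1, t)) = _
    rw [hl, hp1, F.apply_one]
  · rw [← hmk]
    exact hm (1, t)

/-- The point dividing the segment from `x` to `y`, in the projective model. -/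
def segPoint (s : unitInterval) (x y : Hyp3) : Mink := (1 - (s : ℝ)) • (x : Mink) + (s : ℝ) • (y : Mink)

theorem form_segPoint_neg (s : unitInterval) (x y : Hyp3) :
    form (segPoint s x y) (segPoint s x y) < 0 := by
  have h := form_hyp_le x.2 y.2
  have h0 := s.2.1
  have h1 := s.2.2
  have : form (segPoint s x y) (segPoint s x y)
      = -1 + 2 * ((s : ℝ) * (1 - s)) * (1 + form x y) := by
    simp only [segPoint, form_add_left, form_add_right, form_smul_left, form_smul_right, x.2.1,
      y.2.1, form_comm y.1 x.1]
    ring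
  rw [this]
  nlinarith [mul_nonneg h0 (sub_nonneg.2 h1)]

theorem segPoint_fst_pos (s : unitInterval) (x y : Hyp3) : 0 < (segPoint s x y).1 := by
  have h0 := s.2.1
  have h1 := s.2.2
  have hx := x.2.2
  have hy := y.2.2
  change 0 < (1 - (s : ℝ)) * x.1.1 + s * y.1.1
  rcases h0.eq_or_lt with h | h
  · rw [← h]; simpa using hx
  · have := mul_nonneg (sub_nonneg.2 h1) hx.le
    have := mul_pos h hy
    linarith

/-- The straight homotopy of `ℍ³`. -/
def straight (s : unitInterval) (x y : Hyp3) : Hyp3 :=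
  ⟨_, smul_mem_hyperboloid (form_segPoint_neg s x y) (segPoint_fst_pos s x y)⟩

theorem smul_straight (g : IsomPlus) (s : unitInterval) (x y : Hyp3) :
    g • straight s x y = straight s (g • x) (g • y) := by
  have h : segPoint s (g • x) (g • y) = g.1 (segPoint s x y) := by
    simp only [segPoint, coe_smul_hyp, map_add, map_smul]
  apply Subtype.ext
  change g.1 ((Real.sqrt _)⁻¹ • segPoint s x y) = (Real.sqrt _)⁻¹ • segPoint s (g • x) (g • y)
  rw [h, form_map, map_smul]

theorem straight_zero (x y : Hyp3) : straight 0 x y = x := by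
  apply Subtype.ext
  change (Real.sqrt _)⁻¹ • segPoint 0 x y = x
  have : segPoint 0 x y = x := by simp [segPoint]
  rw [this, x.2.1]
  simp

theorem straight_one (x y : Hyp3) : straight 1 x y = y := by
  apply Subtype.ext
  change (Real.sqrt _)⁻¹ • segPoint 1 x y = y
  have : segPoint 1 x y = y := by simp [segPoint]
  rw [this, y.2.1]
  simp

theorem continuous_straight {A : Type*} [TopologicalSpace A] {s : A → unitInterval}
    {f g : A → Hyp3} (hs : Continuous s) (hf : Continuous f) (hg : Continuous g) :
    Continuous fun a => straight (s a) (f a) (g a) := by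
  have h : Continuous fun a => segPoint (s a) (f a) (g a) := by
    unfold segPoint
    fun_prop
  have h0 : ∀ a, Real.sqrt (-form (segPoint (s a) (f a) (g a)) (segPoint (s a) (f a) (g a))) ≠ 0 :=
    fun a => (Real.sqrt_pos.2 (by linarith [form_segPoint_neg (s a) (f a) (g a)])).ne'
  exact ((((continuous_form h h).neg.sqrt).inv₀ h0).smul h).subtype_mk _

/-- The quotient map `A × ℝ → A × ℝ/ℤ`. -/
theorem isQuotientMap_prod_circle (A : Type*) [TopologicalSpace A] :
    IsQuotientMap (⟨fun z => (z.1, (z.2 : UnitAddCircle)),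
      continuous_fst.prodMk ((AddCircle.continuous_mk' 1).comp continuous_snd)⟩ :
        C(A × ℝ, A × UnitAddCircle)) :=
  (IsOpenQuotientMap.id.prodMap (QuotientAddGroup.isOpenQuotientMap_mk
    (N := AddSubgroup.zmultiples (1 : ℝ)))).isQuotientMap

theorem eq_of_coe_circle_eq {Y : Type*} {f : ℝ → Y} (hf : ∀ t, f (t + 1) = f t) {s t : ℝ}
    (h : (s : UnitAddCircle) = t) : f s = f t := by
  have hp : Function.Periodic f 1 := hf
  rw [← hp.lift_coe s, ← hp.lift_coe t]
  exact congrArg hp.lift h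

/-- The straight homotopy between the lifts commutes with isometries, hence is compatible with the
common holonomy and descends to the circle. -/
theorem IsLoopLift.homotopic {c c' : C(UnitAddCircle, HypQuot Γ)} {β β' : C(ℝ, Hyp3)} {k : Γ}
    (hβ : IsLoopLift c β k) (hβ' : IsLoopLift c' β' k) : c.Homotopic c' := by
  let G : C(unitInterval × ℝ, HypQuot Γ) :=
    ⟨fun z => proj Γ (straight z.1 (β z.2) (β' z.2)),
      (isOpenQuotientMap_proj Γ).continuous.comp
        (continuous_straight continuous_fst (by fun_prop) (by fun_prop))⟩
  have hG : ∀ s t, G (s, t + 1) = G (s, t) := by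
    intro s t
    change proj Γ (straight s (β (t + 1)) (β' (t + 1))) = proj Γ (straight s (β t) (β' t))
    rw [hβ.holonomy, hβ'.holonomy, ← proj_smul k (straight s (β t) (β' t))]
    exact congrArg (proj Γ) (smul_straight k.1 s (β t) (β' t)).symm
  have hq := isQuotientMap_prod_circle unitInterval
  have hcomp : ∀ a b : unitInterval × ℝ,
      (a.1, (a.2 : UnitAddCircle)) = (b.1, (b.2 : UnitAddCircle)) → G a = G b := by
    rintro ⟨s, t⟩ ⟨s', t'⟩ h
    obtain ⟨rfl, h⟩ := Prod.mk.inj h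
    exact eq_of_coe_circle_eq (f := fun t => G (s, t)) (hG s) h
  let F := hq.lift G hcomp
  have hF : ∀ s (t : ℝ), F (s, (t : UnitAddCircle)) = G (s, t) := fun s t =>
    congrArg (fun f : C(unitInterval × ℝ, HypQuot Γ) => f (s, t)) (hq.lift_comp G hcomp)
  refine ⟨⟨F, fun z => ?_, fun z => ?_⟩⟩
  · induction z using QuotientAddGroup.induction_on with
    | H t =>
      refine (hF 0 t).trans ?_
      change proj Γ (straight 0 (β t) (β' t)) = _
      rw [straight_zero, hβ.lifts]
  · induction z using QuotientAddGroup.induction_on with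
    | H t =>
      refine (hF 1 t).trans ?_
      change proj Γ (straight 1 (β t) (β' t)) = _
      rw [straight_one, hβ'.lifts]

end Covering

/-! ### End points of geodesics -/

theorem form_add_sub_frame {x v : Mink} (hx : x ∈ hyperboloid) (hxv : form x v = 0)
    (hv : form v v = 1) : form (x + v) (x - v) = -2 := by
  simp only [form_add_left, form_sub_right, hx.1, hxv, hv, form_comm v x]; norm_num

theorem frame_lightlike {x v : Mink} (hx : x ∈ hyperboloid) (hxv : form x v = 0)
    (hv : form v v = 1) : form (x + v) (x + v) = 0 ∧ 0 < (x + v).1 := by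
  have h : form (x + v) (x + v) = 0 := by
    simp only [form_add_left, form_add_right, hx.1, hxv, hv, form_comm v x]; norm_num
  refine ⟨h, fst_pos_of_form_neg hx h.le ?_⟩
  simp only [form_add_right, hx.1, hxv]
  norm_num

/-- The end point of an isotropic ray. -/
def endOf (w : Mink) (hw : form w w = 0) (h0 : 0 < w.1) : S2 :=
  ⟨w.1⁻¹ • w.2, by
    rw [form_self_eq] at hw
    have : ‖w.2‖ = w.1 := by nlinarith [norm_nonneg w.2]
    rw [mem_sphere_zero_iff_norm, norm_smul, norm_inv, Real.norm_of_nonneg h0.le, this,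
      inv_mul_cancel₀ h0.ne']⟩

theorem lightVec_endOf (w : Mink) (hw : form w w = 0) (h0 : 0 < w.1) :
    lightVec (endOf w hw h0) = w.1⁻¹ • w := by
  ext1
  · change 1 = w.1⁻¹ * w.1
    rw [inv_mul_cancel₀ h0.ne']
  · rfl

theorem lightVec_injective : Function.Injective lightVec := fun _ _ h =>
  Subtype.ext (congrArg Prod.snd h)

theorem tendsto_projective {a b : Mink} (ha : 0 < a.1) {f : ℝ → Mink} {l : Filter ℝ}
    {c d : ℝ → ℝ} (hc : ∀ t, 0 < c t) (hd : Tendsto (fun t => d t / c t) l (𝓝 0))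
    (hf : ∀ t, f t = c t • a + d t • b) :
    Tendsto (fun t => (f t).1⁻¹ • (f t).2) l (𝓝 (a.1⁻¹ • a.2)) := by
  have h1 : ∀ t, (f t).1⁻¹ • (f t).2
      = (a.1 + (d t / c t) * b.1)⁻¹ • (a.2 + (d t / c t) • b.2) := by
    intro t
    have e : f t = c t • (a + (d t / c t) • b) := by
      rw [hf, smul_add, smul_smul, mul_div_cancel₀ _ (hc t).ne']
    rw [e, Prod.smul_fst, Prod.smul_snd, smul_eq_mul, smul_smul, mul_inv, mul_right_comm,
      inv_mul_cancel₀ (hc t).ne', one_mul]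
    rfl
  simp only [h1]
  have h2 : Tendsto (fun t => a.1 + (d t / c t) * b.1) l (𝓝 a.1) := by
    simpa using (hd.mul_const b.1).const_add a.1
  have h3 : Tendsto (fun t => a.2 + (d t / c t) • b.2) l (𝓝 a.2) := by
    simpa using (hd.smul_const b.2).const_add a.2
  exact (h2.inv₀ ha.ne').smul h3

theorem exp_neg_div_exp_tendsto :
    Tendsto (fun t : ℝ => Real.exp (-t) / 2 / (Real.exp t / 2)) atTop (𝓝 0) := by
  have : (fun t : ℝ => Real.exp (-t) / 2 / (Real.exp t / 2)) = fun t => Real.exp (-(2 * t)) := by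
    funext t
    rw [div_div_div_cancel_right₀ two_ne_zero, ← Real.exp_sub]
    congr 1
    ring
  rw [this]
  exact Real.tendsto_exp_neg_atTop_nhds_zero.comp (tendsto_id.const_mul_atTop two_pos)

theorem geodesic_eq_exp (x v : Mink) (t : ℝ) : Real.cosh t • x + Real.sinh t • v
    = (Real.exp t / 2) • (x + v) + (Real.exp (-t) / 2) • (x - v) := by
  rw [Real.cosh_eq, Real.sinh_eq]
  module

theorem tendstoBdry_atTop {a : ℝ → Hyp3} {x v : Mink} (hxv : form x v = 0) (hv : form v v = 1)
    (hx : x ∈ hyperboloid) (ha : ∀ t, (a t : Mink) = Real.cosh t • x + Real.sinh t • v) :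
    TendstoBdry a atTop
      (endOf (x + v) (frame_lightlike hx hxv hv).1 (frame_lightlike hx hxv hv).2) :=
  tendsto_projective (b := x - v) (frame_lightlike hx hxv hv).2
    (fun t => half_pos (Real.exp_pos t)) exp_neg_div_exp_tendsto
    (fun t => by rw [ha, geodesic_eq_exp])

theorem frame_neg {x v : Mink} (hxv : form x v = 0) (hv : form v v = 1) :
    form x (-v) = 0 ∧ form (-v) (-v) = 1 := by
  simp [hxv, hv]

theorem tendstoBdry_atBot {a : ℝ → Hyp3} {x v : Mink} (hxv : form x (-v) = 0)
    (hv : form (-v) (-v) = 1)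
    (hx : x ∈ hyperboloid) (ha : ∀ t, (a t : Mink) = Real.cosh t • x + Real.sinh t • v) :
    TendstoBdry a atBot
      (endOf (x + -v) (frame_lightlike hx hxv hv).1 (frame_lightlike hx hxv hv).2) := by
  have h := tendstoBdry_atTop (a := fun t => a (-t)) hxv hv hx (fun t => by
    rw [ha, Real.cosh_neg, Real.sinh_neg, neg_smul, smul_neg])
  have h2 := h.comp tendsto_neg_atBot_atTop
  simpa [TendstoBdry, Function.comp_def] using h2

/-- The isotropic vectors `x - v` and `x + v` pair to `-2`, while multiples of one isotropic vector
pair to zero. -/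
theorem form_endOf_ne {x v : Mink} (hx : x ∈ hyperboloid) (hxv : form x v = 0)
    (hv : form v v = 1) (hxv' : form x (-v) = 0) (hv' : form (-v) (-v) = 1) :
    endOf (x + -v) (frame_lightlike hx hxv' hv').1 (frame_lightlike hx hxv' hv').2
      ≠ endOf (x + v) (frame_lightlike hx hxv hv).1 (frame_lightlike hx hxv hv).2 := by
  intro h
  have h1 := congrArg lightVec h
  rw [lightVec_endOf, lightVec_endOf] at h1
  have h2 : form ((x + v).1⁻¹ • (x + v)) ((x + -v).1⁻¹ • (x + -v)) = 0 := by
    rw [h1, form_smul_left, form_smul_right, (frame_lightlike hx hxv hv).1]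
    ring
  rw [form_smul_left, form_smul_right, ← sub_eq_add_neg, form_add_sub_frame hx hxv hv] at h2
  have p1 := inv_pos.2 (frame_lightlike hx hxv hv).2
  have p2 := inv_pos.2 (frame_lightlike hx hxv' hv').2
  rw [← sub_eq_add_neg] at p2
  nlinarith [mul_pos p1 p2]

/-! ### Existence of closed geodesics, and their lengths -/

variable {Γ : Subgroup IsomPlus}

/-- A constant curve has a lift with holonomy `1`, and equal holonomies give homotopic curves. -/
theorem IsLoopLift.nontrivial {c : C(UnitAddCircle, HypQuot Γ)}
    {β : C(ℝ, Hyp3)} {k : Γ} (hβ : IsLoopLift c β k) (hc : (homotopyClass c).Nontrivial) :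
    k ≠ 1 := by
  rintro rfl
  refine hc (proj Γ basePoint) (Quotient.sound ?_)
  exact hβ.homotopic (c' := ContinuousMap.const _ (proj Γ basePoint))
    (β' := ContinuousMap.const _ basePoint) ⟨fun t => rfl, fun t => (one_smul _ _).symm⟩

/-- The holonomy of a representative is nontrivial, hence without fixed points, and translates a
line. The projection of that line, run through with unit period, has the same holonomy and so
belongs to the class. -/
theorem exists_closedGeodesic (hΓ : IsClosedManifoldGroup Γ) {κ : FreeHomotopyClass Γ}
    (hκ : κ.Nontrivial) : Nonempty (ClosedGeodesic κ) := by
  obtain ⟨c, rfl⟩ := Quotient.exists_rep κ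
  obtain ⟨β, h, hβ⟩ := exists_isLoopLift hΓ c
  have hne := hβ.nontrivial hκ
  obtain ⟨x₀, hx₀⟩ := exists_minimal_displacement hΓ h
  obtain ⟨a, l, hl, hg, hh⟩ := exists_translated_line (h := h.1) (x := x₀)
    (fun e => hne (hΓ.free h x₀ e)) hx₀
  have hcont := hg.continuous
  let β' : C(ℝ, Hyp3) := ⟨fun t => a (t * l), by fun_prop⟩
  have hhol : ∀ t, β' (t + 1) = h • β' t := fun t => by
    change a ((t + 1) * l) = h.1 • a (t * l)
    rw [hh, add_mul, one_mul]
  have hper : Function.Periodic (fun t => proj Γ (β' t)) 1 := fun t => by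
    change proj Γ (β' (t + 1)) = proj Γ (β' t)
    rw [hhol, proj_smul]
  have hc' : Continuous fun t => proj Γ (β' t) :=
    (isOpenQuotientMap_proj Γ).continuous.comp β'.continuous
  let c' : C(UnitAddCircle, HypQuot Γ) := ⟨hper.lift, continuous_coinduced_dom.2 hc'⟩
  have hβ' : IsLoopLift c' β' h := ⟨fun t => rfl, hhol⟩
  obtain ⟨x, v, hxv, hv, ha⟩ := id hg
  have hx : x ∈ hyperboloid := by
    have := (a 0).2
    rw [ha] at this
    simpa using this
  obtain ⟨hxv', hv'⟩ := frame_neg hxv hv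
  exact ⟨{
    curve := c'
    mem_class := Quotient.sound (hβ'.homotopic hβ)
    line := a
    isGeodesicLine := hg
    len := l
    len_pos := hl
    h := h
    translate := hh
    curve_eq := fun t => rfl
    p := _
    q := _
    tendsto_p := tendstoBdry_atBot hxv' hv' hx ha
    tendsto_q := tendstoBdry_atTop hxv hv hx ha
    p_ne_q := form_endOf_ne hx hxv hv hxv' hv' }⟩

namespace ClosedGeodesic

variable {κ : FreeHomotopyClass Γ} (α : ClosedGeodesic κ)

theorem isLoopLift : IsLoopLift α.curve
    ⟨fun t => α.line (t * α.len), α.isGeodesicLine.continuous.comp (by fun_prop)⟩ α.h :=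
  ⟨fun t => (α.curve_eq t).symm, fun t => by
    change α.line ((t + 1) * α.len) = α.h • α.line (t * α.len)
    rw [α.translate, add_mul, one_mul]⟩

theorem hdist_smul (g : IsomPlus) (x y : Hyp3) : hdist (g • x) (g • y) = hdist x y := by
  unfold hdist
  rw [coe_smul_hyp, coe_smul_hyp, form_map]

/-- Polygons inscribed in the geodesic telescope, which gives the upper bound. Any other curve of
the class has a lift whose ends are related, up to a deck transformation, by `α.h`, and these are at
least `α.len` apart. -/
theorem classLength_eq (hΓ : IsClosedManifoldGroup Γ) :
    classLength κ = ENNReal.ofReal α.len := by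
  apply le_antisymm
  · refine (iInf₂_le α.curve α.mem_class).trans ?_
    let β : C(unitInterval, Hyp3) :=
      ⟨fun t => α.line (t * α.len), α.isGeodesicLine.continuous.comp (by fun_prop)⟩
    refine (iInf₂_le β fun t : unitInterval => (α.curve_eq (t : ℝ)).symm).trans ?_
    refine iSup_le fun n => iSup_le fun t => iSup_le fun ht => ?_
    have h1 : ∀ i, hdist (β (t i)) (β (t (i + 1)))
        = (t (i + 1) : ℝ) * α.len - (t i : ℝ) * α.len := fun i =>
      α.isGeodesicLine.hdist_eq
        (mul_le_mul_of_nonneg_right (ht (Nat.le_succ i)) α.len_pos.le)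
    have h2 : ∀ i ∈ Finset.range n, 0 ≤ hdist (β (t i)) (β (t (i + 1))) := fun i _ => by
      rw [h1]
      exact sub_nonneg.2 (mul_le_mul_of_nonneg_right (ht (Nat.le_succ i)) α.len_pos.le)
    rw [← ENNReal.ofReal_sum_of_nonneg h2]
    apply ENNReal.ofReal_le_ofReal
    simp only [h1]
    rw [Finset.sum_range_sub (fun i => (t i : ℝ) * α.len)]
    have := (t n).2.2
    have := (t 0).2.1
    have := α.len_pos
    nlinarith
  · refine le_iInf₂ fun c hc => le_iInf₂ fun β hβ => ?_
    obtain ⟨β', hβ'⟩ := α.isLoopLift.of_homotopic hΓ (c' := c)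
      (Quotient.exact (α.mem_class.trans hc.symm))
    obtain ⟨k, hk⟩ := exists_deck hΓ (f := β) (g := fun t : unitInterval => β' t)
      β.continuous (by fun_prop) (fun t => by rw [hβ, hβ'.lifts])
    have hd : α.len ≤ hdist (β 0) (β 1) := by
      have e1 : β' ((1 : unitInterval) : ℝ) = α.h • β' ((0 : unitInterval) : ℝ) := by
        rw [← hβ'.holonomy]
        simp
      rw [hk, hk]
      refine (hdist_le_of_translate α.len_pos.le α.isGeodesicLine α.translate
        (β' ((0 : unitInterval) : ℝ))).trans ?_
      rw [e1]
      exact (hdist_smul k.1 _ _).ge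
    -- The inscribed polygon with the single edge from the start to the end of the lift.
    let t : ℕ → unitInterval := fun i => if i = 0 then 0 else 1
    have ht : Monotone t := by
      intro i j hij
      by_cases hi : i = 0
      · simp [t, hi]
      · have hj : j ≠ 0 := by omega
        simp [t, hi, hj]
    refine le_trans ?_ (le_iSup_of_le 1 (le_iSup₂_of_le t ht le_rfl))
    simpa [t] using ENNReal.ofReal_le_ofReal hd

end ClosedGeodesic

/-! ### Round circles and their normal vectors -/

theorem norm_S2 (ξ : S2) : ‖(ξ : E3)‖ = 1 := mem_sphere_zero_iff_norm.1 ξ.2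

theorem inner_S2_self (ξ : S2) : inner ℝ (ξ : E3) ξ = 1 := by
  rw [real_inner_self_eq_norm_sq, norm_S2]; norm_num

/-- The point of the circle `circleSet ω t` in the direction `u`. -/
def circlePoint (ω : S2) (t : ℝ) (u : E3) : E3 := t • (ω : E3) + Real.sqrt (1 - t ^ 2) • u

theorem inner_circlePoint (ω : S2) (t : ℝ) {u : E3} (hu : inner ℝ (ω : E3) u = 0) :
    inner ℝ (ω : E3) (circlePoint ω t u) = t := by
  rw [circlePoint, inner_add_right, inner_smul_right, inner_smul_right, hu, inner_S2_self]
  ring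

theorem norm_circlePoint (ω : S2) {t : ℝ} (ht : |t| ≤ 1) {u : E3}
    (hu : inner ℝ (ω : E3) u = 0) (hu1 : ‖u‖ = 1) : ‖circlePoint ω t u‖ = 1 := by
  have ht2 : 0 ≤ 1 - t ^ 2 := by nlinarith [abs_le.1 ht]
  rw [circlePoint, ← sq_eq_sq₀ (norm_nonneg _) zero_le_one, norm_add_sq_real, inner_smul_left,
    inner_smul_right, hu, norm_smul, norm_smul, norm_S2, hu1]
  simp only [Real.norm_eq_abs, mul_zero, mul_one, sq_abs, Real.sq_sqrt ht2]
  ring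

/-- The linear function defining a circle is determined by the circle up to scaling. -/
theorem eq_smul_of_circleSet_subset {ω : S2} {t : ℝ} (ht : |t| < 1) {n : Mink}
    (h : ∀ ξ ∈ circleSet ω t, form n (lightVec ξ) = 0) :
    n = (inner ℝ n.2 (ω : E3) : ℝ) • ((t, (ω : E3)) : Mink) := by
  have hs : 0 < Real.sqrt (1 - t ^ 2) := Real.sqrt_pos.2 (by nlinarith [abs_lt.1 ht])
  have key : ∀ u : E3, inner ℝ (ω : E3) u = 0 → ‖u‖ = 1 →
      t * inner ℝ n.2 (ω : E3) + Real.sqrt (1 - t ^ 2) * inner ℝ n.2 u = n.1 := by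
    intro u hu hu1
    have h1 := h ⟨circlePoint ω t u, mem_sphere_zero_iff_norm.2 (norm_circlePoint ω ht.le hu hu1)⟩
      (inner_circlePoint ω t hu)
    simp only [form, lightVec, circlePoint, inner_add_right, inner_smul_right] at h1
    linarith
  -- Opposite points `u` and `-u` of the circle separate the two terms of `key`.
  have key2 : ∀ u : E3, inner ℝ (ω : E3) u = 0 → ‖u‖ = 1 →
      inner ℝ n.2 u = 0 ∧ n.1 = t * inner ℝ n.2 (ω : E3) := by
    intro u hu hu1
    have h1 := key u hu hu1
    have h2 := key (-u) (by rw [inner_neg_right, hu, neg_zero]) (by rw [norm_neg, hu1])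
    rw [inner_neg_right] at h2
    have h3 : Real.sqrt (1 - t ^ 2) * inner ℝ n.2 u = 0 := by linarith
    refine ⟨(mul_eq_zero.1 h3).resolve_left hs.ne', by linarith⟩
  have h2 : n.2 = (inner ℝ n.2 (ω : E3) : ℝ) • (ω : E3) := by
    -- The part of `n.2` orthogonal to `ω` is orthogonal to `n.2` by `key2`, hence to itself.
    by_contra hne
    set w := n.2 - (inner ℝ n.2 (ω : E3) : ℝ) • (ω : E3) with hw
    have hw0 : w ≠ 0 := sub_ne_zero.2 hne
    have hωw : inner ℝ (ω : E3) w = 0 := by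
      rw [hw, inner_sub_right, inner_smul_right, inner_S2_self, real_inner_comm]; ring
    have h1 := (key2 (‖w‖⁻¹ • w) (by rw [inner_smul_right, hωw, mul_zero])
      (norm_smul_inv_norm hw0)).1
    rw [inner_smul_right] at h1
    have h3 : inner ℝ n.2 w = 0 :=
      (mul_eq_zero.1 h1).resolve_left (inv_ne_zero (norm_ne_zero_iff.2 hw0))
    have h4 : inner ℝ w w = (0 : ℝ) := by
      conv_lhs => rw [hw]
      rw [inner_sub_left, inner_smul_left, ← hw, h3, hωw]; simp
    exact hw0 (inner_self_eq_zero.1 h4)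
  obtain ⟨ξ, hξ⟩ := circleSet_nonempty ω t ht
  have h1 := h ξ hξ
  have hξ' : inner ℝ (ω : E3) (ξ : E3) = t := hξ
  refine Prod.ext ?_ h2
  change n.1 = inner ℝ n.2 (ω : E3) * t
  simp only [form, lightVec] at h1
  rw [h2, inner_smul_left, hξ'] at h1
  simp only [conj_trivial] at h1
  linarith

/-- The vector `n` is orthogonal to the plane bounded by the circle `σ`. -/
def IsNormal (n : Mink) (σ : RoundCircle) : Prop :=
  n ≠ 0 ∧ ∀ ξ ∈ σ.pts, form n (lightVec ξ) = 0

/-- The standard normal vector of `circleAt`. -/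
def normalVec (z : S2 × ℝ) : Mink := (Real.tanh z.2, (z.1 : E3))

theorem form_normalVec_lightVec (z : S2 × ℝ) (ξ : S2) :
    form (normalVec z) (lightVec ξ) = inner ℝ (z.1 : E3) (ξ : E3) - Real.tanh z.2 := by
  simp [form, normalVec, lightVec]

theorem normalVec_ne_zero (z : S2 × ℝ) : normalVec z ≠ 0 := fun h => by
  have h1 : (z.1 : E3) = 0 := congrArg Prod.snd h
  have h2 := norm_S2 z.1
  rw [h1, norm_zero] at h2
  exact zero_ne_one h2

theorem mem_pts_circleAt {z : S2 × ℝ} {ξ : S2} :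
    ξ ∈ (circleAt z.1 z.2).pts ↔ form (normalVec z) (lightVec ξ) = 0 := by
  rw [form_normalVec_lightVec, sub_eq_zero]; rfl

theorem isNormal_normalVec (z : S2 × ℝ) : IsNormal (normalVec z) (circleAt z.1 z.2) :=
  ⟨normalVec_ne_zero z, fun _ h => mem_pts_circleAt.1 h⟩

theorem isNormal_circleAt_iff {z : S2 × ℝ} {n : Mink} :
    IsNormal n (circleAt z.1 z.2) ↔ ∃ c : ℝ, c ≠ 0 ∧ n = c • normalVec z := by
  constructor
  · rintro ⟨h0, h⟩
    have h1 := eq_smul_of_circleSet_subset (Real.abs_tanh_lt_one z.2) h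
    refine ⟨_, fun hc => h0 ?_, h1⟩
    rw [h1, hc, zero_smul]
  · rintro ⟨c, hc, rfl⟩
    refine ⟨smul_ne_zero hc (normalVec_ne_zero z), fun ξ hξ => ?_⟩
    rw [form_smul_left, mem_pts_circleAt.1 hξ, mul_zero]

theorem RoundCircle.ext_pts {σ τ : RoundCircle} (h : σ.pts = τ.pts) : σ = τ :=
  Subtype.ext (SetLike.coe_injective h)

theorem circleAt_surjective : Function.Surjective fun z : S2 × ℝ => circleAt z.1 z.2 := by
  rintro σ
  obtain ⟨ω, t, ht, h⟩ := σ.2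
  refine ⟨(ω, Real.artanh t), RoundCircle.ext_pts ?_⟩
  change circleSet ω (Real.tanh (Real.artanh t)) = σ.1
  rw [Real.tanh_artanh (abs_lt.1 ht), h]

theorem IsNormal.mem_pts_iff {n : Mink} {σ : RoundCircle} (h : IsNormal n σ) {ξ : S2} :
    ξ ∈ σ.pts ↔ form n (lightVec ξ) = 0 := by
  obtain ⟨z, rfl⟩ := circleAt_surjective σ
  obtain ⟨c, hc, rfl⟩ := isNormal_circleAt_iff.1 h
  rw [form_smul_left, mul_eq_zero, or_iff_right hc, mem_pts_circleAt]

theorem IsNormal.eq_of_isNormal {n : Mink} {σ τ : RoundCircle} (h : IsNormal n σ)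
    (h' : IsNormal n τ) : σ = τ :=
  RoundCircle.ext_pts (Set.ext fun _ => h.mem_pts_iff.trans h'.mem_pts_iff.symm)

theorem IsNormal.exists_smul {n n' : Mink} {σ : RoundCircle} (h : IsNormal n σ)
    (h' : IsNormal n' σ) : ∃ c : ℝ, c ≠ 0 ∧ n' = c • n := by
  obtain ⟨z, rfl⟩ := circleAt_surjective σ
  obtain ⟨c, hc, rfl⟩ := isNormal_circleAt_iff.1 h
  obtain ⟨d, hd, rfl⟩ := isNormal_circleAt_iff.1 h'
  exact ⟨d / c, div_ne_zero hd hc, by rw [smul_smul, div_mul_cancel₀ _ hc]⟩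

theorem IsNormal.const_smul {n : Mink} {σ : RoundCircle} (h : IsNormal n σ) {c : ℝ} (hc : c ≠ 0) :
    IsNormal (c • n) σ :=
  ⟨smul_ne_zero hc h.1, fun ξ hξ => by rw [form_smul_left, h.2 ξ hξ, mul_zero]⟩

theorem exists_isNormal (σ : RoundCircle) : ∃ n, IsNormal n σ := by
  obtain ⟨z, rfl⟩ := circleAt_surjective σ
  exact ⟨_, isNormal_normalVec z⟩

theorem map_lightVec (g : IsomPlus) (ξ : S2) :
    g.1 (lightVec ξ) = (g.1 (lightVec ξ)).1 • lightVec (g • ξ) := by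
  rw [lightVec_smul, smul_smul, mul_inv_cancel₀ (fst_map_lightVec_pos g ξ).ne', one_smul]

theorem IsNormal.smul {n : Mink} {σ : RoundCircle} (h : IsNormal n σ) (g : IsomPlus) :
    IsNormal (g.1 n) (g • σ) := by
  refine ⟨fun h0 => h.1 ((LinearEquiv.map_eq_zero_iff _).1 h0), ?_⟩
  rw [RoundCircle.pts_smul]
  rintro _ ⟨ξ, hξ, rfl⟩
  change form (g.1 n) (lightVec (g • ξ)) = 0
  rw [lightVec_smul, form_smul_right, form_map, h.2 ξ hξ, mul_zero]

/-! ### Topology of the space of circles -/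

theorem continuous_tanh : Continuous Real.tanh := by
  have : Real.tanh = fun x => Real.sinh x / Real.cosh x := funext Real.tanh_eq_sinh_div_cosh
  rw [this]
  exact Real.continuous_sinh.div Real.continuous_cosh fun x => (Real.cosh_pos x).ne'

theorem continuousOn_artanh : ContinuousOn Real.artanh (Set.Ioo (-1) 1) := by
  have h : ContinuousOn (fun x : ℝ => Real.log (Real.sqrt ((1 + x) / (1 - x)))) (Set.Ioo (-1) 1) := by
    refine ContinuousOn.log (ContinuousOn.sqrt (ContinuousOn.div (by fun_prop) (by fun_prop) ?_)) ?_
    · intro x hx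
      linarith [hx.2]
    · intro x hx
      exact (Real.sqrt_pos.2 (div_pos (by linarith [hx.1]) (by linarith [hx.2]))).ne'
  exact h

/-- Upper semicontinuity of the circle: the complement is the projection of a closed incidence set
along the compact sphere. -/
theorem isOpen_circleSet_subset {U : Set S2} (hU : IsOpen U) :
    IsOpen {z : S2 × ℝ | circleSet z.1 (Real.tanh z.2) ⊆ U} := by
  have hc : IsClosed {w : (S2 × ℝ) × S2 |
      inner ℝ (w.1.1 : E3) (w.2 : E3) = Real.tanh w.1.2 ∧ w.2 ∉ U} := by
    refine IsClosed.inter (isClosed_eq ?_ ?_) (hU.isClosed_compl.preimage continuous_snd)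
    · fun_prop
    · exact continuous_tanh.comp (by fun_prop)
  have h2 := (isClosedMap_fst_of_compactSpace _ hc).isOpen_compl
  convert h2 using 1
  ext z
  simp only [Set.mem_ofPred_eq, Set.mem_compl_iff, Set.mem_image, Prod.exists, exists_and_right,
    exists_eq_right, not_exists, not_and, not_not]
  rfl

/-- Lower semicontinuity: a point `ξ` of one circle is carried to nearby circles by keeping the
direction of its component orthogonal to the new axis and adjusting the height. This direction is
defined because that component is nonzero at the start. -/
theorem isOpen_circleSet_inter {V : Set S2} (hV : IsOpen V) :
    IsOpen {z : S2 × ℝ | (circleSet z.1 (Real.tanh z.2) ∩ V).Nonempty} := by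
  rw [isOpen_iff_mem_nhds]
  rintro ⟨ω₀, p₀⟩ ⟨ξ, hξ, hξV⟩
  obtain ⟨W, hW, rfl⟩ := isOpen_induced_iff.1 hV
  have hξ' : inner ℝ (ω₀ : E3) (ξ : E3) = Real.tanh p₀ := hξ
  let u : S2 × ℝ → E3 := fun z => (ξ : E3) - (inner ℝ (z.1 : E3) (ξ : E3) : ℝ) • (z.1 : E3)
  have hu : Continuous u := by fun_prop
  have hort : ∀ z, inner ℝ (z.1 : E3) (u z) = 0 := fun z => by
    change inner ℝ (z.1 : E3) ((ξ : E3) - (inner ℝ (z.1 : E3) (ξ : E3) : ℝ) • (z.1 : E3)) = 0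
    rw [inner_sub_right, inner_smul_right, inner_S2_self]
    ring
  have hn : ‖u (ω₀, p₀)‖ = Real.sqrt (1 - Real.tanh p₀ ^ 2) := by
    rw [← Real.sqrt_sq (norm_nonneg _)]
    congr 1
    change ‖(ξ : E3) - (inner ℝ (ω₀ : E3) (ξ : E3) : ℝ) • (ω₀ : E3)‖ ^ 2 = _
    rw [hξ', norm_sub_sq_real, inner_smul_right, real_inner_comm, hξ', norm_smul, norm_S2, norm_S2,
      Real.norm_eq_abs, mul_one, sq_abs]
    ring
  have ht : 0 < 1 - Real.tanh p₀ ^ 2 := by nlinarith [abs_lt.1 (Real.abs_tanh_lt_one p₀)]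
  have hn0 : ‖u (ω₀, p₀)‖ ≠ 0 := by
    rw [hn]; exact (Real.sqrt_pos.2 ht).ne'
  let e : S2 × ℝ → E3 := fun z => circlePoint z.1 (Real.tanh z.2) (‖u z‖⁻¹ • u z)
  have he : ContinuousAt e (ω₀, p₀) := by
    have h1 : Continuous fun z : S2 × ℝ => Real.tanh z.2 := continuous_tanh.comp continuous_snd
    have h2 : ContinuousAt (fun z => ‖u z‖⁻¹ • u z) (ω₀, p₀) :=
      (hu.norm.continuousAt.inv₀ hn0).smul hu.continuousAt
    have h3 : Continuous fun z : S2 × ℝ => Real.sqrt (1 - Real.tanh z.2 ^ 2) := by fun_prop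
    exact ContinuousAt.add (Continuous.continuousAt (by fun_prop)) (h3.continuousAt.smul h2)
  have he0 : e (ω₀, p₀) = ξ := by
    change Real.tanh p₀ • (ω₀ : E3) + Real.sqrt (1 - Real.tanh p₀ ^ 2) •
      (‖u (ω₀, p₀)‖⁻¹ • u (ω₀, p₀)) = ξ
    rw [smul_smul, ← hn, mul_inv_cancel₀ hn0, one_smul]
    change Real.tanh p₀ • (ω₀ : E3) + ((ξ : E3) - (inner ℝ (ω₀ : E3) (ξ : E3) : ℝ) • (ω₀ : E3)) = _
    rw [hξ']
    abel
  have hev : ∀ᶠ z in 𝓝 (ω₀, p₀), e z ∈ W :=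
    he.eventually (by rw [he0]; exact hW.mem_nhds hξV)
  have hev2 : ∀ᶠ z in 𝓝 (ω₀, p₀), ‖u z‖ ≠ 0 := hu.norm.continuousAt.eventually_ne hn0
  filter_upwards [hev, hev2] with z hz hz2
  have hz3 : inner ℝ (z.1 : E3) (‖u z‖⁻¹ • u z) = 0 := by
    rw [inner_smul_right, hort, mul_zero]
  exact ⟨⟨e z, mem_sphere_zero_iff_norm.2 (norm_circlePoint z.1 (Real.abs_tanh_lt_one z.2).le hz3
    (norm_smul_inv_norm (norm_ne_zero_iff.1 hz2)))⟩, inner_circlePoint _ _ hz3, hz⟩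

/-- The Hausdorff distance induces the Vietoris topology, for which continuity is upper plus lower
semicontinuity. -/
theorem continuous_circleAt : Continuous fun z : S2 × ℝ => circleAt z.1 z.2 := by
  refine continuous_induced_rng.2 ?_
  let := TopologicalSpace.vietoris S2
  refine TopologicalSpace.NonemptyCompacts.isEmbedding_coe.isInducing.continuous_iff.2 ?_
  refine TopologicalSpace.vietoris.continuous_iff.2
    ⟨fun U hU => isOpen_circleSet_subset hU, fun F hF => ?_⟩
  have h := (isOpen_circleSet_inter hF.isOpen_compl).isClosed_compl
  convert h using 1
  ext z
  simp only [Set.mem_preimage, Set.mem_powerset_iff, Set.mem_compl_iff, Set.mem_ofPred_eq,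
    Set.not_nonempty_iff_eq_empty, ← Set.sdiff_eq, Set.sdiff_eq_empty]
  rfl

/-- The heights range over the closed interval so that the parameter space is compact and
projections along it are closed. -/
theorem isClosed_incidence : IsClosed {w : RoundCircle × (S2 × Set.Icc (-1 : ℝ) 1) |
    ∀ ξ ∈ w.1.pts, inner ℝ (w.2.1 : E3) (ξ : E3) = (w.2.2 : ℝ)} := by
  rw [← isOpen_compl_iff, isOpen_iff_mem_nhds]
  rintro ⟨σ, z⟩ h
  simp only [Set.mem_compl_iff, Set.mem_ofPred_eq, not_forall] at h
  obtain ⟨ξ, hξ, hne⟩ := h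
  have ho : IsOpen {w : (S2 × Set.Icc (-1 : ℝ) 1) × S2 |
      inner ℝ (w.1.1 : E3) (w.2 : E3) ≠ (w.1.2 : ℝ)} :=
    isOpen_ne_fun (by fun_prop) (by fun_prop)
  obtain ⟨A, hA, V, hV, hAV⟩ := mem_nhds_prod_iff.1 (ho.mem_nhds (x := (z, ξ)) hne)
  obtain ⟨V', hV'V, hV', hξV'⟩ := mem_nhds_iff.1 hV
  have hB : IsOpen {τ : RoundCircle | (τ.pts ∩ V').Nonempty} :=
    (TopologicalSpace.NonemptyCompacts.isOpen_inter_nonempty_of_isOpen hV').preimage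
      continuous_subtype_val
  filter_upwards [prod_mem_nhds (hB.mem_nhds (x := σ) ⟨ξ, hξ, hξV'⟩) hA] with w hw hall
  obtain ⟨⟨η, hη, hηV⟩, hwA⟩ := hw
  exact hAV (a := (w.2, η)) ⟨hwA, hV'V hηV⟩ (hall η hη)

theorem circleAt_neg (ω : S2) (p : ℝ) : circleAt (-ω) (-p) = circleAt ω p := by
  have h : normalVec (-ω, -p) = (-1 : ℝ) • normalVec (ω, p) := by
    simp [normalVec, Real.tanh_neg]
  have h1 := isNormal_normalVec (-ω, -p)
  rw [h] at h1
  exact h1.eq_of_isNormal ((isNormal_normalVec (ω, p)).const_smul (by norm_num))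

/-- A circle has two descriptions, `(ω, t)` and `(-ω, -t)`, which is why both `f` and `f'` occur.
The complement of the image of `U` consists of the circles with an incident `(ω, t)` neither of
whose two readings lies in `U`, and this is the projection of a closed set along a compact space. -/
theorem isOpenMap_circleAt : IsOpenMap fun z : S2 × ℝ => circleAt z.1 z.2 := by
  intro U hU
  let f : S2 × Set.Icc (-1 : ℝ) 1 → S2 × ℝ := fun z => (z.1, Real.artanh z.2)
  let f' : S2 × Set.Icc (-1 : ℝ) 1 → S2 × ℝ := fun z => (-z.1, -Real.artanh z.2)
  let D : Set (S2 × Set.Icc (-1 : ℝ) 1) := {z | (z.2 : ℝ) ∈ Set.Ioo (-1 : ℝ) 1}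
  have hD : IsOpen D := isOpen_Ioo.preimage (by fun_prop)
  have ha : ContinuousOn (fun z : S2 × Set.Icc (-1 : ℝ) 1 => Real.artanh z.2) D :=
    continuousOn_artanh.comp (Continuous.continuousOn (by fun_prop)) fun z hz => hz
  have hf : ContinuousOn f D := continuousOn_fst.prodMk ha
  have hf' : ContinuousOn f' D := continuousOn_fst.neg.prodMk ha.neg
  have hO : IsOpen ((D ∩ f ⁻¹' U) ∪ (D ∩ f' ⁻¹' U)) :=
    (hf.isOpen_inter_preimage hD hU).union (hf'.isOpen_inter_preimage hD hU)
  have hcl := isClosedMap_fst_of_compactSpace _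
    (isClosed_incidence.inter (hO.isClosed_compl.preimage continuous_snd))
  rw [← isClosed_compl_iff]
  convert hcl using 1
  ext σ
  constructor
  · intro hσ
    obtain ⟨z, rfl⟩ := circleAt_surjective σ
    have hlt := abs_lt.1 (Real.abs_tanh_lt_one z.2)
    refine ⟨(circleAt z.1 z.2, (z.1, ⟨Real.tanh z.2, hlt.1.le, hlt.2.le⟩)),
      ⟨fun ξ hξ => (show inner ℝ (z.1 : E3) (ξ : E3) = Real.tanh z.2 from hξ), ?_⟩, rfl⟩
    rintro (⟨-, h⟩ | ⟨-, h⟩)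
    · have h' : (z.1, Real.artanh (Real.tanh z.2)) ∈ U := h
      rw [Real.artanh_tanh] at h'
      exact hσ ⟨_, h', rfl⟩
    · have h' : (-z.1, -Real.artanh (Real.tanh z.2)) ∈ U := h
      rw [Real.artanh_tanh] at h'
      exact hσ ⟨_, h', circleAt_neg _ _⟩
  · rintro ⟨⟨τ, ω, t⟩, ⟨h1, h2⟩, rfl⟩ ⟨z, hz, hτ⟩
    apply h2
    change circleAt z.1 z.2 = τ at hτ
    subst hτ
    have hn : IsNormal ((t : ℝ), (ω : E3)) (circleAt z.1 z.2) := by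
      refine ⟨fun h0 => ?_, fun ξ hξ => ?_⟩
      · have h3 : (ω : E3) = 0 := congrArg Prod.snd h0
        have h4 := norm_S2 ω
        rw [h3, norm_zero] at h4
        exact zero_ne_one h4
      · have := h1 ξ hξ
        simp only [form, lightVec]
        simp only at this
        rw [this]
        ring
    obtain ⟨c, hc, h⟩ := isNormal_circleAt_iff.1 hn
    have e1 : (t : ℝ) = c * Real.tanh z.2 := congrArg Prod.fst h
    have e2 : (ω : E3) = c • (z.1 : E3) := congrArg Prod.snd h
    have e3 : |c| = 1 := by
      have := congrArg norm e2
      rw [norm_S2, norm_smul, norm_S2, mul_one, Real.norm_eq_abs] at this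
      exact this.symm
    have hlt := abs_lt.1 (Real.abs_tanh_lt_one z.2)
    rcases (abs_eq zero_le_one).1 e3 with rfl | rfl
    · left
      rw [one_mul] at e1
      rw [one_smul] at e2
      refine ⟨show (t : ℝ) ∈ Set.Ioo (-1 : ℝ) 1 by rw [e1]; exact hlt, ?_⟩
      change (ω, Real.artanh t) ∈ U
      rw [e1, Real.artanh_tanh, Subtype.ext e2]
      exact hz
    · right
      rw [neg_one_mul] at e1
      rw [neg_one_smul] at e2
      refine ⟨show (t : ℝ) ∈ Set.Ioo (-1 : ℝ) 1 by
        rw [e1]; exact ⟨by linarith [hlt.2], by linarith [hlt.1]⟩, ?_⟩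
      change (-ω, -Real.artanh t) ∈ U
      have e4 : ω = -z.1 := Subtype.ext e2
      rw [e1, ← Real.tanh_neg, Real.artanh_tanh, e4, neg_neg, neg_neg]
      exact hz

theorem isOpenQuotientMap_circleAt : IsOpenQuotientMap fun z : S2 × ℝ => circleAt z.1 z.2 :=
  ⟨circleAt_surjective, continuous_circleAt, isOpenMap_circleAt⟩

instance : SecondCountableTopology RoundCircle :=
  inferInstanceAs (SecondCountableTopology
    {K : TopologicalSpace.NonemptyCompacts S2 // IsRound K})

instance : LocallyCompactSpace S2 := inferInstance

instance : LocallyCompactSpace RoundCircle := isOpenQuotientMap_circleAt.locallyCompactSpace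

instance : ContinuousConstSMul IsomPlus RoundCircle :=
  ⟨fun g => ((continuous_smul_S2 g).nonemptyCompacts_map.comp
    continuous_subtype_val).subtype_mk _⟩

/-! ### Linking in terms of normal vectors -/

/-- An open cap of the sphere is connected. -/
theorem isPreconnected_cap (ω : S2) {t : ℝ} (ht : |t| < 1) :
    IsPreconnected {ξ : S2 | t < inner ℝ (ω : E3) (ξ : E3)} := by
  have ht' := abs_lt.1 ht
  refine isPreconnected_of_forall ω fun ξ hξ => ?_
  set c : ℝ := inner ℝ (ω : E3) (ξ : E3) with hc
  have hξ' : t < c := hξ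
  have hc1 : c ≤ 1 := by
    have := real_inner_le_norm (ω : E3) (ξ : E3)
    rwa [norm_S2, norm_S2, one_mul] at this
  rcases hc1.eq_or_lt with h1 | h1
  · have : (ω : E3) = ξ := (inner_eq_one_iff_of_norm_eq_one (norm_S2 ω) (norm_S2 ξ)).1 h1
    refine ⟨{ω}, ?_, rfl, ?_, isPreconnected_singleton⟩
    · rw [Set.singleton_subset_iff]
      change t < inner ℝ (ω : E3) (ω : E3)
      rw [inner_S2_self]
      exact ht'.2
    · exact (Subtype.ext this).symm
  · set u : E3 := (ξ : E3) - c • (ω : E3) with hu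
    have hωu : inner ℝ (ω : E3) u = 0 := by
      rw [hu, inner_sub_right, inner_smul_right, inner_S2_self, ← hc]; ring
    have hun : ‖u‖ = Real.sqrt (1 - c ^ 2) := by
      rw [← Real.sqrt_sq (norm_nonneg u)]
      congr 1
      rw [hu, norm_sub_sq_real, inner_smul_right, real_inner_comm, ← hc, norm_smul, norm_S2,
        norm_S2, Real.norm_eq_abs, mul_one, sq_abs]
      ring
    have hpos : 0 < 1 - c ^ 2 := by nlinarith
    have hu0 : ‖u‖ ≠ 0 := by rw [hun]; exact (Real.sqrt_pos.2 hpos).ne'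
    have hωw : inner ℝ (ω : E3) (‖u‖⁻¹ • u) = 0 := by rw [inner_smul_right, hωu, mul_zero]
    have hw1 : ‖‖u‖⁻¹ • u‖ = 1 := norm_smul_inv_norm (norm_ne_zero_iff.1 hu0)
    -- The meridian arc from `ξ` to the centre `ω` of the cap, parametrised by height.
    let f : Set.Icc c 1 → S2 := fun s => ⟨circlePoint ω s (‖u‖⁻¹ • u),
      mem_sphere_zero_iff_norm.2 (norm_circlePoint ω
        (abs_le.2 ⟨by linarith [s.2.1], s.2.2⟩) hωw hw1)⟩
    have hf : Continuous f := by
      refine Continuous.subtype_mk ?_ _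
      unfold circlePoint
      fun_prop
    have hconn : PreconnectedSpace (Set.Icc c 1) :=
      Subtype.preconnectedSpace isPreconnected_Icc
    refine ⟨Set.range f, ?_, ⟨⟨1, hc1, le_rfl⟩, Subtype.ext ?_⟩, ⟨⟨c, le_rfl, hc1⟩, Subtype.ext ?_⟩,
      isPreconnected_range hf⟩
    · rintro _ ⟨s, rfl⟩
      change t < inner ℝ (ω : E3) (circlePoint ω s (‖u‖⁻¹ • u))
      rw [inner_circlePoint ω _ hωw]
      exact hξ'.trans_le s.2.1
    · simp [f, circlePoint]
    · change c • (ω : E3) + Real.sqrt (1 - c ^ 2) • (‖u‖⁻¹ • u) = ξ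
      rw [smul_smul, ← hun, mul_inv_cancel₀ hu0, one_smul, hu]
      abel

theorem GeodEnds.mk_eq_mk_iff {x y x' y' : S2} {h : x ≠ y} {h' : x' ≠ y'} :
    GeodEnds.mk x y h = GeodEnds.mk x' y' h' ↔ (x' = x ∧ y' = y) ∨ (x' = y ∧ y' = x) := by
  refine (Quotient.eq (r := pairSetoid)).trans ?_
  change ((x', y') = (x, y) ∨ (x', y') = Prod.swap (x, y)) ↔ _
  simp [Prod.ext_iff]

theorem sameComponent_of_pos {z : S2 × ℝ} {x y : S2}
    (hx : 0 < form (normalVec z) (lightVec x)) (hy : 0 < form (normalVec z) (lightVec y)) :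
    connectedComponentIn (circleAt z.1 z.2).ptsᶜ x
      = connectedComponentIn (circleAt z.1 z.2).ptsᶜ y := by
  rw [form_normalVec_lightVec, sub_pos] at hx hy
  have h1 := isPreconnected_cap z.1 (Real.abs_tanh_lt_one z.2)
  have h2 : {ξ : S2 | Real.tanh z.2 < inner ℝ (z.1 : E3) (ξ : E3)} ⊆ (circleAt z.1 z.2).ptsᶜ := by
    intro ξ hξ h
    rw [mem_pts_circleAt, form_normalVec_lightVec, sub_eq_zero] at h
    have hξ' : Real.tanh z.2 < inner ℝ (z.1 : E3) (ξ : E3) := hξ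
    rw [h] at hξ'
    exact lt_irrefl _ hξ'
  exact connectedComponentIn_eq (h1.subset_connectedComponentIn hx h2 hy)

theorem IsNormal.sameComponent {n : Mink} {σ : RoundCircle} (hn : IsNormal n σ) {x y : S2}
    (h : 0 < form n (lightVec x) * form n (lightVec y)) :
    connectedComponentIn σ.ptsᶜ x = connectedComponentIn σ.ptsᶜ y := by
  obtain ⟨z, rfl⟩ := circleAt_surjective σ
  obtain ⟨c, hc, rfl⟩ := isNormal_circleAt_iff.1 hn
  rw [form_smul_left, form_smul_left, mul_mul_mul_comm] at h
  have h' := pos_of_mul_pos_right h (mul_self_nonneg c)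
  rcases mul_pos_iff.1 h' with ⟨h1, h2⟩ | ⟨h1, h2⟩
  · exact sameComponent_of_pos h1 h2
  -- When both values are negative, the opposite description of the circle makes them positive.
  · have e : normalVec (-z.1, -z.2) = -normalVec z := by
      simp [normalVec, Real.tanh_neg]
    have := sameComponent_of_pos (z := (-z.1, -z.2)) (x := x) (y := y)
      (by rw [e, form_neg_left]; linarith) (by rw [e, form_neg_left]; linarith)
    rwa [circleAt_neg] at this

theorem continuous_lightVec : Continuous lightVec :=
  continuous_const.prodMk continuous_subtype_val

/-- Equal signs put both points in one cap, which is connected; for opposite signs, a connected set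
containing both would meet the circle by the intermediate value theorem. -/
theorem IsNormal.linked_iff {n : Mink} {σ : RoundCircle} (hn : IsNormal n σ) {x y : S2}
    (hxy : x ≠ y) :
    Linked σ (GeodEnds.mk x y hxy) ↔ form n (lightVec x) * form n (lightVec y) < 0 := by
  have key : ∀ x y : S2, x ∉ σ.pts → y ∉ σ.pts →
      connectedComponentIn σ.ptsᶜ x ≠ connectedComponentIn σ.ptsᶜ y →
      form n (lightVec x) * form n (lightVec y) < 0 := by
    intro x y hx hy h
    rw [hn.mem_pts_iff] at hx hy
    by_contra hc
    push Not at hc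
    exact h (hn.sameComponent (lt_of_le_of_ne hc (mul_ne_zero hx hy).symm))
  constructor
  · rintro ⟨x', y', h', e, hx, hy, hc⟩
    have := key x' y' hx hy hc
    rcases GeodEnds.mk_eq_mk_iff.1 e with ⟨rfl, rfl⟩ | ⟨rfl, rfl⟩
    · exact this
    · rwa [mul_comm]
  · intro h
    have hx : x ∉ σ.pts := fun h' => by
      rw [hn.mem_pts_iff.1 h', zero_mul] at h; exact lt_irrefl _ h
    have hy : y ∉ σ.pts := fun h' => by
      rw [hn.mem_pts_iff.1 h', mul_zero] at h; exact lt_irrefl _ h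
    refine ⟨x, y, hxy, rfl, hx, hy, fun hc => ?_⟩
    have h1 : x ∈ connectedComponentIn σ.ptsᶜ x := mem_connectedComponentIn hx
    have h2 : y ∈ connectedComponentIn σ.ptsᶜ x := by
      rw [hc]; exact mem_connectedComponentIn hy
    have hcont : ContinuousOn (fun ξ => form n (lightVec ξ)) (connectedComponentIn σ.ptsᶜ x) :=
      (continuous_form continuous_const continuous_lightVec).continuousOn
    have hpc : IsPreconnected (connectedComponentIn σ.ptsᶜ x) := isPreconnected_connectedComponentIn
    have hz : (0 : ℝ) ∈ (fun ξ => form n (lightVec ξ)) '' connectedComponentIn σ.ptsᶜ x := by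
      rcases mul_neg_iff.1 h with ⟨h3, h4⟩ | ⟨h3, h4⟩
      · exact hpc.intermediate_value h2 h1 hcont ⟨h4.le, h3.le⟩
      · exact hpc.intermediate_value h1 h2 hcont ⟨h3.le, h4.le⟩
    obtain ⟨ξ, hξ, h0⟩ := hz
    exact connectedComponentIn_subset _ _ hξ (hn.mem_pts_iff.2 h0)

/-! ### Topology of the space of geodesics -/

/-- The projection from ordered to unordered pairs. -/
def geodMk (z : OrdPair) : GeodEnds := GeodEnds.mk z.1.1 z.1.2 z.2

theorem geodMk_eq_iff {z w : OrdPair} : geodMk z = geodMk w ↔ w.1 = z.1 ∨ w.1 = z.1.swap :=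
  Quotient.eq (r := pairSetoid)

theorem isOpenQuotientMap_geodEnds : IsOpenQuotientMap geodMk := by
  have hq : IsQuotientMap geodMk := isQuotientMap_quotient_mk'
  refine ⟨hq.surjective, hq.continuous, fun U hU => ?_⟩
  rw [← hq.isOpen_preimage]
  let s : OrdPair → OrdPair := fun z => ⟨z.1.swap, fun h => z.2 h.symm⟩
  have hs : Continuous s := (continuous_swap.comp continuous_subtype_val).subtype_mk _
  -- The saturation of `U` adds only its image under the swap.
  have : geodMk ⁻¹' (geodMk '' U) = U ∪ s ⁻¹' U := by
    ext w
    constructor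
    · rintro ⟨z, hz, e⟩
      rcases geodMk_eq_iff.1 e with h | h
      · left
        rwa [Subtype.ext h]
      · right
        have : s w = z := Subtype.ext (by
          change w.1.swap = z.1
          rw [h, Prod.swap_swap])
        change s w ∈ U
        rwa [this]
    · rintro (h | h)
      · exact ⟨w, h, rfl⟩
      · exact ⟨s w, h, geodMk_eq_iff.2 (Or.inr (Prod.swap_swap w.1).symm)⟩
  rw [this]
  exact hU.union (hU.preimage hs)

instance : T2Space GeodEnds := by
  rw [t2Space_iff_of_isOpenQuotientMap isOpenQuotientMap_geodEnds]
  have : {q : OrdPair × OrdPair | geodMk q.1 = geodMk q.2}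
      = {q | q.2.1 = q.1.1} ∪ {q | q.2.1 = q.1.1.swap} := by
    ext q
    exact geodMk_eq_iff
  rw [this]
  exact (isClosed_eq (by fun_prop) (by fun_prop)).union
    (isClosed_eq (by fun_prop) (continuous_swap.comp (by fun_prop)))

instance : SecondCountableTopology GeodEnds :=
  isOpenQuotientMap_geodEnds.isQuotientMap.secondCountableTopology
    isOpenQuotientMap_geodEnds.isOpenMap

instance : LocallyCompactSpace OrdPair :=
  IsOpen.locallyCompactSpace (s := {z : S2 × S2 | z.1 ≠ z.2})
    (isOpen_ne_fun continuous_fst continuous_snd)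

instance : LocallyCompactSpace GeodEnds := isOpenQuotientMap_geodEnds.locallyCompactSpace

instance : ContinuousConstSMul IsomPlus GeodEnds := by
  refine ⟨fun g => (isOpenQuotientMap_geodEnds.continuous_comp_iff).1 ?_⟩
  have h : Continuous fun z : OrdPair =>
      (⟨(g • z.1.1, g • z.1.2), fun h => z.2 (MulAction.injective g h)⟩ : OrdPair) :=
    Continuous.subtype_mk (by fun_prop) _
  exact isOpenQuotientMap_geodEnds.continuous.comp h

/-! ### The space of linked pairs -/

/-- Parameters for pairs of a circle and a geodesic. -/
abbrev PairParam : Type := (S2 × ℝ) × OrdPair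

/-- The parametrisation of pairs of a circle and a geodesic. -/
def pairMap (w : PairParam) : RoundCircle × GeodEnds :=
  (circleAt w.1.1 w.1.2, geodMk w.2)

theorem isOpenQuotientMap_pairMap : IsOpenQuotientMap pairMap :=
  isOpenQuotientMap_circleAt.prodMap isOpenQuotientMap_geodEnds

theorem linked_pairMap_iff (w : PairParam) : Linked (pairMap w).1 (pairMap w).2 ↔
    form (normalVec w.1) (lightVec w.2.1.1) * form (normalVec w.1) (lightVec w.2.1.2) < 0 :=
  (isNormal_normalVec w.1).linked_iff w.2.2

theorem continuous_normalVec : Continuous normalVec :=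
  (continuous_tanh.comp continuous_snd).prodMk (continuous_subtype_val.comp continuous_fst)

theorem isOpen_linked : IsOpen {z : RoundCircle × GeodEnds | Linked z.1 z.2} := by
  rw [← isOpenQuotientMap_pairMap.isQuotientMap.isOpen_preimage]
  have : pairMap ⁻¹' {z : RoundCircle × GeodEnds | Linked z.1 z.2} = {w | form (normalVec w.1)
      (lightVec w.2.1.1) * form (normalVec w.1) (lightVec w.2.1.2) < 0} :=
    Set.ext linked_pairMap_iff
  rw [this]
  have h1 : Continuous fun w : PairParam => normalVec w.1 := continuous_normalVec.comp continuous_fst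
  have h2 : Continuous fun w : PairParam => lightVec w.2.1.1 := continuous_lightVec.comp (by fun_prop)
  have h3 : Continuous fun w : PairParam => lightVec w.2.1.2 := continuous_lightVec.comp (by fun_prop)
  exact isOpen_lt ((continuous_form h1 h2).mul (continuous_form h1 h3)) continuous_const

instance : LocallyCompactSpace LinkedPairs := isOpen_linked.locallyCompactSpace

instance : ContinuousConstSMul IsomPlus LinkedPairs :=
  ⟨fun g => Continuous.subtype_mk
    (((continuous_const_smul g).comp (continuous_fst.comp continuous_subtype_val)).prodMk
      ((continuous_const_smul g).comp (continuous_snd.comp continuous_subtype_val))) _⟩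

instance (Γ : Subgroup IsomPlus) : ContinuousConstSMul Γ LinkedPairs :=
  ⟨fun g => continuous_const_smul (g : IsomPlus)⟩

/-! ### The intersection point -/

/-- A vector spanning the intersection of the hyperplane orthogonal to `n` with the plane spanned
by the isotropic rays of `x` and `y`. -/
def crossVec (n : Mink) (x y : S2) : Mink :=
  |form n (lightVec y)| • lightVec x + |form n (lightVec x)| • lightVec y

theorem form_lightVec_lt {x y : S2} (h : x ≠ y) : form (lightVec x) (lightVec y) < 0 := by
  have h1 := inner_lt_one_iff_real_of_norm_eq_one (norm_S2 x) (norm_S2 y) |>.2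
    (fun e => h (Subtype.ext e))
  simp only [form, lightVec]
  linarith

theorem form_crossVec_neg {n : Mink} {x y : S2}
    (h : form n (lightVec x) * form n (lightVec y) < 0) :
    form (crossVec n x y) (crossVec n x y) < 0 := by
  have hxy : x ≠ y := by
    rintro rfl
    nlinarith [mul_self_nonneg (form n (lightVec x))]
  have h1 := form_lightVec_lt hxy
  have h2 : 0 < |form n (lightVec x)| * |form n (lightVec y)| := by
    rw [← abs_mul]; exact abs_pos.2 h.ne
  have : form (crossVec n x y) (crossVec n x y)
      = 2 * (|form n (lightVec x)| * |form n (lightVec y)|) * form (lightVec x) (lightVec y) := by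
    simp only [crossVec, form_add_left, form_add_right, form_smul_left, form_smul_right,
      form_lightVec_self, form_comm (lightVec y) (lightVec x)]
    ring
  rw [this]
  nlinarith

theorem crossVec_fst_pos {n : Mink} {x y : S2}
    (h : form n (lightVec x) * form n (lightVec y) < 0) : 0 < (crossVec n x y).1 := by
  have h1 : form n (lightVec x) ≠ 0 := left_ne_zero_of_mul h.ne
  have h2 : form n (lightVec y) ≠ 0 := right_ne_zero_of_mul h.ne
  change 0 < |form n (lightVec y)| * 1 + |form n (lightVec x)| * 1
  have := abs_pos.2 h1
  have := abs_pos.2 h2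
  linarith

theorem form_crossVec {n : Mink} {x y : S2}
    (h : form n (lightVec x) * form n (lightVec y) < 0) : form n (crossVec n x y) = 0 := by
  simp only [crossVec, form_add_right, form_smul_right]
  rcases mul_neg_iff.1 h with ⟨h1, h2⟩ | ⟨h1, h2⟩
  · rw [abs_of_neg h2, abs_of_pos h1]; ring
  · rw [abs_of_pos h2, abs_of_neg h1]; ring

/-- The plane bounded by `σ` meets the geodesic with end points `u` in the point `y`. -/
def Meets (σ : RoundCircle) (u : GeodEnds) (y : Hyp3) : Prop :=
  ∃ (n : Mink) (ξ η : S2) (h : ξ ≠ η) (a b : ℝ), IsNormal n σ ∧ u = GeodEnds.mk ξ η h ∧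
    0 < a ∧ 0 < b ∧ (y : Mink) = a • lightVec ξ + b • lightVec η ∧ form n y = 0

theorem Meets.smul {σ : RoundCircle} {u : GeodEnds} {y : Hyp3} (h : Meets σ u y) (g : IsomPlus) :
    Meets (g • σ) (g • u) (g • y) := by
  obtain ⟨n, ξ, η, hne, a, b, hn, rfl, ha, hb, hy, h0⟩ := h
  refine ⟨g.1 n, g • ξ, g • η, fun e => hne (MulAction.injective g e),
    a * (g.1 (lightVec ξ)).1, b * (g.1 (lightVec η)).1, hn.smul g, rfl,
    mul_pos ha (fst_map_lightVec_pos g ξ), mul_pos hb (fst_map_lightVec_pos g η), ?_, ?_⟩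
  · rw [mul_smul, mul_smul, ← map_lightVec, ← map_lightVec, coe_smul_hyp, hy, map_add, map_smul,
      map_smul]
  · rw [coe_smul_hyp, form_map, h0]

theorem eq_of_smul_eq_hyp {x y : Hyp3} {c : ℝ} (hc : 0 < c) (h : (x : Mink) = c • (y : Mink)) :
    x = y := by
  have h1 := x.2.1
  rw [h, form_smul_left, form_smul_right, y.2.1] at h1
  have h2 : c = 1 := by nlinarith
  rw [h2, one_smul] at h
  exact Subtype.ext h

/-- As `form n` does not vanish at the end `η`, the positive combinations of the two end rays
orthogonal to `n` form one ray, and a ray meets the hyperboloid at most once. -/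
theorem Meets.unique {σ : RoundCircle} {u : GeodEnds} {y y' : Hyp3} (hl : Linked σ u)
    (h : Meets σ u y) (h' : Meets σ u y') : y = y' := by
  obtain ⟨n, ξ, η, hne, a, b, hn, rfl, ha, hb, hy, h0⟩ := h
  obtain ⟨n', ξ', η', hne', a', b', hn', e, ha', hb', hy', h0'⟩ := h'
  rw [hn.linked_iff] at hl
  have e0 : form n y' = 0 := by
    obtain ⟨c, hc, rfl⟩ := hn'.exists_smul hn
    rw [form_smul_left, h0', mul_zero]
  obtain ⟨a'', b'', ha'', hb'', hy''⟩ : ∃ a'' b'' : ℝ, 0 < a'' ∧ 0 < b'' ∧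
      (y' : Mink) = a'' • lightVec ξ + b'' • lightVec η := by
    rcases GeodEnds.mk_eq_mk_iff.1 e with ⟨rfl, rfl⟩ | ⟨rfl, rfl⟩
    · exact ⟨a', b', ha', hb', hy'⟩
    · exact ⟨b', a', hb', ha', by rw [hy', add_comm]⟩
  have hη : form n (lightVec η) ≠ 0 := right_ne_zero_of_mul hl.ne
  rw [hy, form_add_right, form_smul_right, form_smul_right] at h0
  rw [hy'', form_add_right, form_smul_right, form_smul_right] at e0
  have e1 : b = (a / a'') * b'' := by
    have : form n (lightVec η) * (a'' * b - a * b'') = 0 := by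
      linear_combination a'' * h0 - a * e0
    have := (mul_eq_zero.1 this).resolve_left hη
    field_simp
    linarith
  refine eq_of_smul_eq_hyp (div_pos ha ha'') ?_
  rw [hy, hy'', smul_add, smul_smul, smul_smul, ← e1, div_mul_cancel₀ _ ha''.ne']

/-- The normalised vector `crossVec`. -/
def crossHyp (n : Mink) (x y : S2) (h : form n (lightVec x) * form n (lightVec y) < 0) : Hyp3 :=
  ⟨_, smul_mem_hyperboloid (form_crossVec_neg h) (crossVec_fst_pos h)⟩

theorem meets_crossHyp {n : Mink} {σ : RoundCircle} (hn : IsNormal n σ) {x y : S2} (hxy : x ≠ y)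
    (h : form n (lightVec x) * form n (lightVec y) < 0) :
    Meets σ (GeodEnds.mk x y hxy) (crossHyp n x y h) := by
  have hp := inv_pos.2 (Real.sqrt_pos.2 (neg_pos.2 (form_crossVec_neg h)))
  refine ⟨n, x, y, hxy, _, _, hn, rfl,
    mul_pos hp (abs_pos.2 (right_ne_zero_of_mul h.ne)),
    mul_pos hp (abs_pos.2 (left_ne_zero_of_mul h.ne)), ?_, ?_⟩
  · rw [mul_smul, mul_smul, ← smul_add]
    rfl
  · change form n ((Real.sqrt _)⁻¹ • crossVec n x y) = 0
    rw [form_smul_right, form_crossVec h, mul_zero]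

theorem exists_meets {σ : RoundCircle} {u : GeodEnds} (h : Linked σ u) : ∃ y, Meets σ u y := by
  obtain ⟨n, hn⟩ := exists_isNormal σ
  obtain ⟨x, y, hxy, rfl, -⟩ := id h
  exact ⟨_, meets_crossHyp hn hxy ((hn.linked_iff hxy).1 h)⟩

/-- The intersection point of a plane and a geodesic. -/
def crossPoint (z : LinkedPairs) : Hyp3 := (exists_meets z.2).choose

theorem meets_crossPoint (z : LinkedPairs) : Meets z.1.1 z.1.2 (crossPoint z) :=
  (exists_meets z.2).choose_spec

theorem crossPoint_eq {z : LinkedPairs} {y : Hyp3} (h : Meets z.1.1 z.1.2 y) : crossPoint z = y :=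
  (meets_crossPoint z).unique z.2 h

theorem crossPoint_smul (g : IsomPlus) (z : LinkedPairs) : crossPoint (g • z) = g • crossPoint z :=
  crossPoint_eq ((meets_crossPoint z).smul g)

/-- On the ordered parameters the point is given by the explicit formula `crossHyp`; continuity then
descends along the open quotient map. -/
theorem continuous_crossPoint : Continuous crossPoint := by
  have hq := isOpenQuotientMap_pairMap.restrictPreimage
    {z : RoundCircle × GeodEnds | Linked z.1 z.2}
  refine hq.continuous_comp_iff.1 ?_
  let P := pairMap ⁻¹' {z : RoundCircle × GeodEnds | Linked z.1 z.2}
  have h1 : Continuous fun w : P => normalVec w.1.1 := continuous_normalVec.comp (by fun_prop)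
  have h2 : Continuous fun w : P => lightVec w.1.2.1.1 := continuous_lightVec.comp (by fun_prop)
  have h3 : Continuous fun w : P => lightVec w.1.2.1.2 := continuous_lightVec.comp (by fun_prop)
  have h12 := (continuous_form h1 h2).abs
  have h13 := (continuous_form h1 h3).abs
  have hlt : ∀ w : P, form (normalVec w.1.1) (lightVec w.1.2.1.1) *
      form (normalVec w.1.1) (lightVec w.1.2.1.2) < 0 := fun w => (linked_pairMap_iff w.1).1 w.2
  have hc : Continuous fun w : P => crossVec (normalVec w.1.1) w.1.2.1.1 w.1.2.1.2 :=
    (h13.smul h2).add (h12.smul h3)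
  have hs : Continuous fun w : P => crossHyp (normalVec w.1.1) w.1.2.1.1 w.1.2.1.2 (hlt w) := by
    refine Continuous.subtype_mk ?_ _
    exact ((continuous_form hc hc).neg.sqrt.inv₀ fun w =>
      (Real.sqrt_pos.2 (neg_pos.2 (form_crossVec_neg (hlt w)))).ne').smul hc
  convert hs using 1
  funext w
  exact crossPoint_eq (meets_crossHyp (isNormal_normalVec w.1.1) w.1.2.2 (hlt w))

/-- Proper discontinuity pulls back along a continuous equivariant map, here `crossPoint`. -/
theorem properlyDiscontinuousSMul_linkedPairs {Γ : Subgroup IsomPlus}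
    (hΓ : ProperlyDiscontinuousSMul Γ Hyp3) : ProperlyDiscontinuousSMul Γ LinkedPairs := by
  refine ⟨fun {K L} hK hL => ?_⟩
  refine (hΓ.finite_disjoint_inter_image (hK.image continuous_crossPoint)
    (hL.image continuous_crossPoint)).subset ?_
  rintro g ⟨_, ⟨z, hz, rfl⟩, hL'⟩
  exact ⟨g • crossPoint z, ⟨crossPoint z, ⟨z, hz, rfl⟩, rfl⟩, g • z, hL', crossPoint_smul g z⟩

/-! ### Measures on quotients by properly discontinuous actions -/

section QuotientMeasure

variable {G T Q : Type*} [Group G] [TopologicalSpace T] [MulAction G T] [ContinuousConstSMul G T]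
  [ProperlyDiscontinuousSMul G T] [LocallyCompactSpace T] [T2Space T]

omit [ContinuousConstSMul G T] [LocallyCompactSpace T] [T2Space T] in
theorem finite_support_orbit {f : T → ℝ} (hfc : HasCompactSupport f) (x : T) :
    (Function.support fun g : G => f (g • x)).Finite := by
  refine (ProperlyDiscontinuousSMul.finite_disjoint_inter_image (Γ := G)
    (isCompact_singleton (x := x)) hfc).subset fun g hg => ?_
  exact ⟨g • x, ⟨x, rfl, rfl⟩, subset_tsupport f hg⟩

-- Over a compact neighbourhood only finitely many group elements contribute.
omit [T2Space T] in
theorem continuous_orbit_tsum {f : T → ℝ} (hf : Continuous f) (hfc : HasCompactSupport f) :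
    Continuous fun x => ∑' g : G, f (g • x) := by
  have h : (fun x => ∑' g : G, f (g • x)) = fun x => ∑ᶠ g : G, f (g • x) :=
    funext fun x => tsum_eq_finsum (finite_support_orbit hfc x)
  rw [h]
  refine continuous_finsum (fun g => hf.comp (continuous_const_smul g)) fun x => ?_
  obtain ⟨K, hK, hKx⟩ := exists_compact_mem_nhds x
  refine ⟨K, hKx, (ProperlyDiscontinuousSMul.finite_disjoint_inter_image (Γ := G) hK hfc).subset ?_⟩
  rintro g ⟨y, hy, hyK⟩
  exact ⟨g • y, ⟨y, hyK, rfl⟩, subset_tsupport f hy⟩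

omit [TopologicalSpace T] [ContinuousConstSMul G T] [ProperlyDiscontinuousSMul G T]
  [LocallyCompactSpace T] [T2Space T] in
theorem orbit_tsum_smul {R : Type*} [AddCommMonoid R] [TopologicalSpace R] (f : T → R) (k : G)
    (x : T) : ∑' g : G, f (g • k • x) = ∑' g : G, f (g • x) := by
  simp only [smul_smul]
  exact (Equiv.mulRight k).tsum_eq fun g : G => f (g • x)

variable [TopologicalSpace Q] {π : T → Q} (hπ : IsOpenQuotientMap π)
  (horb : ∀ x y, π x = π y ↔ ∃ g : G, g • y = x)

omit [ContinuousConstSMul G T] [ProperlyDiscontinuousSMul G T] [LocallyCompactSpace T]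
  [T2Space T] in
include hπ horb in
theorem exists_descend {R : Type*} [AddCommMonoid R] [TopologicalSpace R] (f : T → R) :
    ∃ F : Q → R, ∀ x, F (π x) = ∑' g : G, f (g • x) := by
  refine ⟨fun q => ∑' g : G, f (g • Function.surjInv hπ.surjective q), fun x => ?_⟩
  obtain ⟨k, hk⟩ := (horb _ _).1 (Function.surjInv_eq hπ.surjective (π x))
  change ∑' g : G, f (g • Function.surjInv hπ.surjective (π x)) = _
  rw [← hk, orbit_tsum_smul]

include hπ in
omit [T2Space T] in
theorem continuous_descend {f : T → ℝ} (hf : Continuous f) (hfc : HasCompactSupport f) {F : Q → ℝ}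
    (hF : ∀ x, F (π x) = ∑' g : G, f (g • x)) : Continuous F := by
  refine hπ.continuous_comp_iff.1 ?_
  rw [show F ∘ π = fun x => ∑' g : G, f (g • x) from funext hF]
  exact continuous_orbit_tsum hf hfc

omit [ContinuousConstSMul G T] [ProperlyDiscontinuousSMul G T] [LocallyCompactSpace T]
  [T2Space T] in
include hπ horb in
theorem hasCompactSupport_descend [T2Space Q] {f : T → ℝ} (hfc : HasCompactSupport f) {F : Q → ℝ}
    (hF : ∀ x, F (π x) = ∑' g : G, f (g • x)) : HasCompactSupport F := by
  refine HasCompactSupport.intro (hfc.image hπ.continuous) fun q hq => ?_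
  obtain ⟨x, rfl⟩ := hπ.surjective q
  rw [hF]
  have : ∀ g : G, f (g • x) = 0 := fun g => by
    by_contra h
    exact hq ⟨g • x, subset_tsupport f h, (horb _ _).2 ⟨g, rfl⟩⟩
  simp [this]

omit [MulAction G T] [ContinuousConstSMul G T] [ProperlyDiscontinuousSMul G T] [T2Space T] in
include hπ in
theorem exists_compact_lift {C : Set Q} (hC : IsCompact C) : ∃ K : Set T, IsCompact K ∧ C ⊆ π '' K := by
  choose K hK hKn using fun x : T => exists_compact_mem_nhds x
  obtain ⟨s, hs⟩ := hC.elim_finite_subcover (fun x => π '' interior (K x))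
    (fun x => hπ.isOpenMap _ isOpen_interior) (by
      intro q _
      obtain ⟨x, rfl⟩ := hπ.surjective q
      exact Set.mem_iUnion.2 ⟨x, x, mem_interior_iff_mem_nhds.2 (hKn x), rfl⟩)
  refine ⟨⋃ x ∈ s, K x, s.isCompact_biUnion fun x _ => hK x, fun q hq => ?_⟩
  have := hs hq
  simp only [Set.mem_iUnion] at this
  obtain ⟨x, hx, y, hy, rfl⟩ := this
  exact ⟨y, Set.mem_biUnion hx (interior_subset hy), rfl⟩

include hπ horb in
/-- Every continuous function with compact support on the quotient is obtained by summation over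
orbits. -/
theorem exists_orbit_tsum_eq {g : Q → ℝ} (hg : Continuous g) (hgc : HasCompactSupport g) :
    ∃ f : T → ℝ, Continuous f ∧ HasCompactSupport f ∧ ∀ x, g (π x) = ∑' k : G, f (k • x) := by
  obtain ⟨K, hK, hKg⟩ := exists_compact_lift hπ hgc
  obtain ⟨φ, hφ1, -, hφc, hφ⟩ := exists_continuous_one_zero_of_isCompact hK isClosed_empty
    (Set.disjoint_empty K)
  let Φ : T → ℝ := fun x => ∑' k : G, φ (k • x)
  have hΦ : Continuous Φ := continuous_orbit_tsum φ.continuous hφc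
  have hΦ1 : ∀ x, g (π x) ≠ 0 → 1 ≤ Φ x := by
    intro x hx
    obtain ⟨y, hy, hyx⟩ := hKg (subset_tsupport g hx)
    obtain ⟨k, rfl⟩ := (horb _ _).1 hyx
    have h1 : φ (k • x) = 1 := hφ1 hy
    rw [← h1]
    exact (summable_of_hasFiniteSupport (finite_support_orbit hφc x)).le_tsum k
      fun j _ => (hφ _).1
  -- Dividing the cutoff `φ` by its orbit sum `Φ` makes the orbit sum equal to one. Where `g ∘ π` is
  -- nonzero, `Φ ≥ 1`, so the maximum with `1` changes nothing there and keeps the quotient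
  -- continuous elsewhere.
  refine ⟨fun x => φ x * (g (π x) / max (Φ x) 1), ?_, hφc.mul_right, fun x => ?_⟩
  · refine φ.continuous.mul ((hg.comp hπ.continuous).div (hΦ.max continuous_const) fun x => ?_)
    exact (zero_lt_one.trans_le (le_max_right _ _)).ne'
  · have h1 : ∀ k : G, π (k • x) = π x := fun k => (horb _ _).2 ⟨k, rfl⟩
    have h2 : ∀ k : G, Φ (k • x) = Φ x := fun k => orbit_tsum_smul (fun y => φ y) k x
    simp only [h1, h2]
    rw [tsum_mul_right]
    change _ = Φ x * _
    by_cases h0 : g (π x) = 0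
    · simp [h0]
    · rw [max_eq_left (hΦ1 x h0), mul_div_cancel₀]
      exact (zero_lt_one.trans_le (hΦ1 x h0)).ne'

-- Orbit sums exhaust the compactly supported continuous functions, and these determine a regular
-- measure.
include hπ horb in
theorem regular_measure_ext [T2Space Q] [LocallyCompactSpace Q] [MeasurableSpace Q] [BorelSpace Q]
    {m m' : Measure Q} [m.Regular] [m'.Regular]
    (h : ∀ (f : T → ℝ) (F : Q → ℝ), Continuous f → HasCompactSupport f →
      (∀ x, F (π x) = ∑' g : G, f (g • x)) → ∫ q, F q ∂m = ∫ q, F q ∂m') : m = m' := by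
  refine Measure.ext_of_integral_eq_on_compactlySupported fun g => ?_
  obtain ⟨f, hf, hfc, hfg⟩ := exists_orbit_tsum_eq hπ horb g.continuous g.hasCompactSupport
  exact h f g hf hfc hfg

variable [T2Space Q] [MeasurableSpace Q] [BorelSpace Q] [MeasurableSpace T] [OpensMeasurableSpace T]
  {m : Measure Q} [IsFiniteMeasureOnCompacts m] {ρ : Measure T}
  (hm : ∀ (f : T → ℝ≥0∞) (F : Q → ℝ≥0∞), Measurable f → Measurable F →
      (∀ x, F (π x) = ∑' g : G, f (g • x)) → ∫⁻ q, F q ∂m = ∫⁻ x, f x ∂ρ)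

-- The unfolding identity `hm` for nonnegative functions also transfers integrability: `F` is
-- integrable because it is continuous with compact support, and `f` then has the same finite
-- integral.
include hπ horb hm in
omit [T2Space T] in
theorem integral_descend_of_nonneg {f : T → ℝ} (hf : Continuous f) (hfc : HasCompactSupport f)
    (h0 : ∀ x, 0 ≤ f x) {F : Q → ℝ} (hF : ∀ x, F (π x) = ∑' g : G, f (g • x)) :
    ∫ q, F q ∂m = ∫ x, f x ∂ρ ∧ Integrable F m ∧ Integrable f ρ := by
  have hFc : Continuous F := continuous_descend hπ hf hfc hF
  have hFi : Integrable F m :=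
    hFc.integrable_of_hasCompactSupport (hasCompactSupport_descend hπ horb hfc hF)
  have hF0 : ∀ q, 0 ≤ F q := fun q => by
    obtain ⟨x, rfl⟩ := hπ.surjective q
    rw [hF]
    exact tsum_nonneg fun g => h0 _
  have h1 : ∫⁻ q, ENNReal.ofReal (F q) ∂m = ∫⁻ x, ENNReal.ofReal (f x) ∂ρ := by
    refine hm _ _ hf.measurable.ennreal_ofReal hFc.measurable.ennreal_ofReal fun x => ?_
    rw [hF, ENNReal.ofReal_tsum_of_nonneg (fun g => h0 _)
      (summable_of_hasFiniteSupport (finite_support_orbit hfc x))]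
  have hfm : AEStronglyMeasurable f ρ := hf.measurable.aestronglyMeasurable
  refine ⟨?_, hFi, hfm, ?_⟩
  · rw [integral_eq_lintegral_of_nonneg_ae (Eventually.of_forall hF0) hFi.1,
      integral_eq_lintegral_of_nonneg_ae (Eventually.of_forall h0) hfm, h1]
  · rw [hasFiniteIntegral_iff_ofReal (Eventually.of_forall h0), ← h1,
      ← hasFiniteIntegral_iff_ofReal (Eventually.of_forall hF0)]
    exact hFi.2

include hπ horb hm in
omit [T2Space T] in
theorem integral_descend {f : T → ℝ} (hf : Continuous f) (hfc : HasCompactSupport f) {F : Q → ℝ}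
    (hF : ∀ x, F (π x) = ∑' g : G, f (g • x)) : ∫ q, F q ∂m = ∫ x, f x ∂ρ := by
  -- Positive and negative parts stay continuous with compact support, so the nonnegative case
  -- applies to each.
  let p : T → ℝ := fun x => max (f x) 0
  let n : T → ℝ := fun x => max (-f x) 0
  have hp : Continuous p := hf.max continuous_const
  have hn : Continuous n := hf.neg.max continuous_const
  have hpc : HasCompactSupport p := hfc.mono fun x hx h => hx (by
    change max (f x) 0 = 0
    rw [h, max_self])
  have hnc : HasCompactSupport n := hfc.mono fun x hx h => hx (by
    change max (-f x) 0 = 0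
    rw [h, neg_zero, max_self])
  have hpn : ∀ x, f x = p x - n x := fun x => by
    rcases le_total 0 (f x) with h | h
    · simp only [p, n, max_eq_left h, max_eq_right (neg_nonpos.2 h), sub_zero]
    · simp only [p, n, max_eq_right h, max_eq_left (neg_nonneg.2 h)]
      ring
  obtain ⟨P, hP⟩ := exists_descend hπ horb p
  obtain ⟨N, hN⟩ := exists_descend hπ horb n
  obtain ⟨e1, i1, i1'⟩ := integral_descend_of_nonneg hπ horb hm hp hpc (fun x => le_max_right _ _) hP
  obtain ⟨e2, i2, i2'⟩ := integral_descend_of_nonneg hπ horb hm hn hnc (fun x => le_max_right _ _) hN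
  have hFPN : F = fun q => P q - N q := by
    funext q
    obtain ⟨x, rfl⟩ := hπ.surjective q
    rw [hF, hP, hN, ← (summable_of_hasFiniteSupport (finite_support_orbit hpc x)).tsum_sub
      (summable_of_hasFiniteSupport (finite_support_orbit hnc x))]
    exact tsum_congr fun g => hpn _
  rw [hFPN, integral_sub i1 i2, e1, e2, ← integral_sub i1' i2']
  exact integral_congr_ae (Eventually.of_forall fun x => (hpn x).symm)

end QuotientMeasure

/-! ### The invariant measure as a cone measure -/

theorem lintegral_polar {f : E3 → ℝ≥0∞} (hf : Measurable f) :
    ∫⁻ w, f w = ∫⁻ ω : S2, (∫⁻ ρ in Set.Ioi (0 : ℝ), ENNReal.ofReal (ρ ^ 2) * f (ρ • (ω : E3)))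
      ∂(volume : Measure E3).toSphere := by
  let g : S2 × Set.Ioi (0 : ℝ) → ℝ≥0∞ := fun z => f ((z.2 : ℝ) • (z.1 : E3))
  have hg : Measurable g := hf.comp (by fun_prop)
  have h1 : ∀ x : ({0}ᶜ : Set E3), f x = g (homeomorphUnitSphereProd E3 x) := fun x => by
    have := homeomorphUnitSphereProd_symm_apply_coe E3 (homeomorphUnitSphereProd E3 x)
    rw [Homeomorph.symm_apply_apply] at this
    rw [this]
  have hd : Module.finrank ℝ E3 - 1 = 2 := by simp
  calc ∫⁻ w, f w = ∫⁻ w in ({0}ᶜ : Set E3), f w := by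
        rw [restrict_compl_singleton]
    _ = ∫⁻ x : ({0}ᶜ : Set E3), f x ∂((volume : Measure E3).comap Subtype.val) :=
        (lintegral_subtype_comap (measurableSet_singleton _).compl f).symm
    _ = ∫⁻ z, g z ∂((volume : Measure E3).toSphere.prod (Measure.volumeIoiPow 2)) := by
        have hmp := (volume : Measure E3).measurePreserving_homeomorphUnitSphereProd
        rw [hd] at hmp
        rw [← hmp.lintegral_comp hg]
        exact lintegral_congr h1
    _ = _ := by
        rw [lintegral_prod _ hg.aemeasurable]
        refine lintegral_congr fun ω => ?_
        have hgω : Measurable fun r : Set.Ioi (0 : ℝ) => g (ω, r) := by fun_prop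
        rw [Measure.volumeIoiPow, lintegral_withDensity_eq_lintegral_mul _ (by fun_prop) hgω]
        exact lintegral_subtype_comap measurableSet_Ioi
          (fun ρ => ENNReal.ofReal (ρ ^ 2) * f (ρ • (ω : E3)))

theorem one_sub_tanh_sq (p : ℝ) : 1 - Real.tanh p ^ 2 = (Real.cosh p ^ 2)⁻¹ := by
  have := Real.cosh_pos p
  rw [Real.tanh_eq_sinh_div_cosh, div_pow, Real.sinh_sq]
  field_simp
  ring

theorem hasDerivAt_tanh (p : ℝ) : HasDerivAt Real.tanh ((Real.cosh p ^ 2)⁻¹) p := by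
  have h := (Real.hasDerivAt_sinh p).div (Real.hasDerivAt_cosh p) (Real.cosh_pos p).ne'
  have e : Real.tanh = fun x => Real.sinh x / Real.cosh x := funext Real.tanh_eq_sinh_div_cosh
  rw [e]
  refine h.congr_deriv ?_
  have := Real.cosh_sq p
  have := Real.cosh_pos p
  field_simp
  nlinarith

theorem tanh_injective : Function.Injective Real.tanh := fun x y h => by
  rw [← Real.artanh_tanh x, h, Real.artanh_tanh]

theorem volume_image_mul_tanh {ρ : ℝ} (hρ : 0 < ρ) {A : Set ℝ} (hA : MeasurableSet A) :
    volume ((fun p => ρ * Real.tanh p) '' A)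
      = ∫⁻ p in A, ENNReal.ofReal (ρ * (Real.cosh p ^ 2)⁻¹) := by
  have h := lintegral_image_eq_lintegral_abs_deriv_mul hA
    (fun p _ => ((hasDerivAt_tanh p).const_mul ρ).hasDerivWithinAt)
    (fun x _ y _ hxy => tanh_injective (mul_left_cancel₀ hρ.ne' hxy)) (fun _ => 1)
  simp only [lintegral_const, Measure.restrict_apply MeasurableSet.univ, Set.univ_inter, one_mul,
    mul_one] at h
  rw [h]
  refine lintegral_congr fun p => ?_
  rw [abs_of_nonneg]
  have := Real.cosh_pos p
  positivity

/-- The vectors orthogonal to a plane belonging to `B`, of square between `0` and `1`. -/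
def coneOver (B : Set RoundCircle) : Set Mink :=
  {n | 0 < form n n ∧ form n n < 1 ∧ ∃ σ ∈ B, IsNormal n σ}

open Classical in
/-- The unit vector in the direction of `w`. -/
def dirOf (w : E3) : S2 :=
  -- The value at `0` is an arbitrary unit vector.
  ⟨if w = 0 then EuclideanSpace.single 0 1 else ‖w‖⁻¹ • w, by
    split_ifs with h
    · simp
    · exact mem_sphere_zero_iff_norm.2 (norm_smul_inv_norm h)⟩

theorem measurable_dirOf : Measurable dirOf :=
  Measurable.subtype_mk
    (Measurable.ite (measurableSet_singleton 0) measurable_const (by fun_prop))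

theorem dirOf_smul {ρ : ℝ} (hρ : 0 < ρ) (ω : S2) : dirOf (ρ • (ω : E3)) = ω := by
  have hn : ‖ρ • (ω : E3)‖ = ρ := by
    rw [norm_smul, norm_S2, mul_one, Real.norm_of_nonneg hρ.le]
  have h : ρ • (ω : E3) ≠ 0 := fun h => by
    rw [h, norm_zero] at hn
    exact hρ.ne hn
  apply Subtype.ext
  change (if ρ • (ω : E3) = 0 then _ else ‖ρ • (ω : E3)‖⁻¹ • ρ • (ω : E3)) = (ω : E3)
  rw [if_neg h, hn, smul_smul, inv_mul_cancel₀ hρ.ne', one_smul]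

theorem exists_dir {w : E3} (hw : w ≠ 0) : ∃ (ρ : ℝ) (ω : S2), 0 < ρ ∧ w = ρ • (ω : E3) :=
  ⟨‖w‖, ⟨‖w‖⁻¹ • w, mem_sphere_zero_iff_norm.2 (norm_smul_inv_norm hw)⟩, norm_pos_iff.2 hw, by
    rw [smul_smul, mul_inv_cancel₀ (norm_ne_zero_iff.2 hw), one_smul]⟩

theorem measurable_artanh : Measurable Real.artanh := by
  unfold Real.artanh
  fun_prop

theorem mem_coneOver_iff {B : Set RoundCircle} {ρ : ℝ} (hρ : 0 < ρ) (ω : S2) (s : ℝ) :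
    ((s, ρ • (ω : E3)) : Mink) ∈ coneOver B ↔
      s ^ 2 < ρ ^ 2 ∧ ρ ^ 2 - s ^ 2 < 1 ∧ circleAt ω (Real.artanh (s / ρ)) ∈ B := by
  have hf : form ((s, ρ • (ω : E3)) : Mink) (s, ρ • (ω : E3)) = ρ ^ 2 - s ^ 2 := by
    rw [form_self_eq, norm_smul, norm_S2, mul_one, Real.norm_eq_abs, sq_abs]
  unfold coneOver
  rw [Set.mem_ofPred_eq, hf, sub_pos]
  refine and_congr_right fun h1 => and_congr_right fun _ => ?_
  have h2 := abs_lt.1 (abs_lt_of_sq_lt_sq h1 hρ.le)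
  have h3 : s / ρ ∈ Set.Ioo (-1 : ℝ) 1 :=
    ⟨by rw [lt_div_iff₀ hρ]; linarith [h2.1], by rw [div_lt_one hρ]; exact h2.2⟩
  have hn : IsNormal ((s, ρ • (ω : E3)) : Mink) (circleAt ω (Real.artanh (s / ρ))) := by
    have e : ((s, ρ • (ω : E3)) : Mink) = ρ • normalVec (ω, Real.artanh (s / ρ)) := by
      refine Prod.ext ?_ rfl
      change s = ρ * Real.tanh (Real.artanh (s / ρ))
      rw [Real.tanh_artanh h3, mul_div_cancel₀ _ hρ.ne']
    rw [e]
    exact (isNormal_normalVec (ω, Real.artanh (s / ρ))).const_smul hρ.ne'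
  constructor
  · rintro ⟨σ, hσ, h⟩
    rwa [hn.eq_of_isNormal h]
  · exact fun h => ⟨_, h, hn⟩

/-- The plane orthogonal to a spacelike vector. -/
def planeOf (n : Mink) : RoundCircle := circleAt (dirOf n.2) (Real.artanh (n.1 / ‖n.2‖))

theorem measurable_circleAt_div {d : E3 → S2} (hd : Measurable d) :
    Measurable fun n : Mink => circleAt (d n.2) (Real.artanh (n.1 / ‖n.2‖)) :=
  continuous_circleAt.measurable.comp ((hd.comp measurable_snd).prodMk
    (measurable_artanh.comp (measurable_fst.div measurable_snd.norm)))

theorem measurable_planeOf : Measurable planeOf := by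
  have h : planeOf = fun n => circleAt (dirOf n.2) (Real.artanh (n.1 / ‖n.2‖)) := rfl
  rw [h]
  exact measurable_circleAt_div measurable_dirOf

/-- The existential over circles becomes a preimage under `planeOf`, which shows measurability. A
vector with zero spatial part is never spacelike. -/
theorem coneOver_eq (B : Set RoundCircle) :
    coneOver B = {n : Mink | 0 < form n n} ∩ ({n | form n n < 1} ∩ planeOf ⁻¹' B) := by
  ext ⟨s, w⟩
  by_cases hw : w = 0
  · have h0 : ¬ 0 < form ((s, w) : Mink) (s, w) := by
      rw [form_self_eq]
      simp only [hw, norm_zero]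
      nlinarith [sq_nonneg s]
    exact ⟨fun h => absurd h.1 h0, fun h => absurd h.1 h0⟩
  · obtain ⟨ρ, ω, hρ, rfl⟩ := exists_dir hw
    have hn : ‖ρ • (ω : E3)‖ = ρ := by
      rw [norm_smul, norm_S2, mul_one, Real.norm_of_nonneg hρ.le]
    have hf : form ((s, ρ • (ω : E3)) : Mink) (s, ρ • (ω : E3)) = ρ ^ 2 - s ^ 2 := by
      rw [form_self_eq, hn]
    have hcv : planeOf (s, ρ • (ω : E3)) = circleAt ω (Real.artanh (s / ρ)) := by
      rw [planeOf, dirOf_smul hρ, hn]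
    rw [mem_coneOver_iff hρ, Set.mem_inter_iff, Set.mem_inter_iff, Set.mem_ofPred_eq,
      Set.mem_ofPred_eq, Set.mem_preimage, hf, hcv, sub_pos]

theorem measurableSet_coneOver {B : Set RoundCircle} (hB : MeasurableSet B) :
    MeasurableSet (coneOver B) := by
  have hq : Measurable fun n : Mink => form n n :=
    (continuous_form continuous_id continuous_id).measurable
  rw [coneOver_eq]
  exact (measurableSet_lt measurable_const hq).inter
    ((measurableSet_lt hq measurable_const).inter (measurable_planeOf hB))

/-- Substituting `s = ρ tanh p` turns the square `ρ² - s²` into `(ρ / cosh p)²`, so the bound by `1`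
becomes `ρ < cosh p`. -/
theorem coneOver_slice {B : Set RoundCircle} {ρ : ℝ} (hρ : 0 < ρ) (ω : S2) :
    (fun s : ℝ => ((s, ρ • (ω : E3)) : Mink)) ⁻¹' coneOver B
      = (fun p => ρ * Real.tanh p) '' {p | ρ < Real.cosh p ∧ circleAt ω p ∈ B} := by
  have key : ∀ p, ρ ^ 2 - (ρ * Real.tanh p) ^ 2 = (ρ / Real.cosh p) ^ 2 := fun p => by
    have := one_sub_tanh_sq p
    rw [div_pow, div_eq_mul_inv, ← this]
    ring
  ext s
  rw [Set.mem_preimage, mem_coneOver_iff hρ]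
  constructor
  · rintro ⟨h1, h2, h3⟩
    have h4 := abs_lt.1 (abs_lt_of_sq_lt_sq h1 hρ.le)
    have h5 : s / ρ ∈ Set.Ioo (-1 : ℝ) 1 :=
      ⟨by rw [lt_div_iff₀ hρ]; linarith [h4.1], by rw [div_lt_one hρ]; exact h4.2⟩
    have h6 : ρ * Real.tanh (Real.artanh (s / ρ)) = s := by
      rw [Real.tanh_artanh h5, mul_div_cancel₀ _ hρ.ne']
    refine ⟨_, ⟨?_, h3⟩, h6⟩
    rw [← h6, key] at h2
    have h7 := Real.cosh_pos (Real.artanh (s / ρ))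
    have h8 : ρ / Real.cosh (Real.artanh (s / ρ)) < 1 := by
      by_contra hc
      push Not at hc
      nlinarith
    rwa [div_lt_one h7] at h8
  · rintro ⟨p, ⟨h1, h2⟩, rfl⟩
    have h7 := Real.cosh_pos p
    have h8 : 0 < ρ / Real.cosh p := div_pos hρ h7
    have h9 : ρ / Real.cosh p < 1 := (div_lt_one h7).2 h1
    refine ⟨?_, ?_, ?_⟩
    · have := key p
      have := pow_pos h8 2
      linarith
    · rw [key]
      nlinarith
    · rwa [mul_div_cancel_left₀ _ hρ.ne', Real.artanh_tanh]

theorem lintegral_ofReal_Ioo {f : ℝ → ℝ} (hf : Continuous f) {a b : ℝ} (hab : a ≤ b)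
    (h0 : ∀ x ∈ Set.Ioc a b, 0 ≤ f x) :
    ∫⁻ x in Set.Ioo a b, ENNReal.ofReal (f x) = ENNReal.ofReal (∫ x in a..b, f x) := by
  rw [Measure.restrict_congr_set Ioo_ae_eq_Ioc, intervalIntegral.integral_of_le hab,
    ofReal_integral_eq_lintegral_ofReal (hf.integrableOn_Icc.mono_set Set.Ioc_subset_Icc_self)]
  filter_upwards [ae_restrict_mem measurableSet_Ioc] with x hx using h0 x hx

/-- In polar coordinates `w = ρ ω`, with `s = ρ tanh p`, the volume element is `ρ³ / cosh² p dρ dp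
dω` on `ρ < cosh p`. Integrating out `ρ` leaves `cosh² p / 4`, and `ν` carries the factor `1 / 2`;
whence the constant `2`. -/
theorem santaloMeasure_apply {B : Set RoundCircle} (hB : MeasurableSet B) :
    santaloMeasure B = 2 * volume (coneOver B) := by
  let A : Set (S2 × ℝ) := {z | circleAt z.1 z.2 ∈ B}
  have hA : MeasurableSet A := continuous_circleAt.measurable hB
  have hAω : ∀ ω : S2, MeasurableSet {p | circleAt ω p ∈ B} := fun ω =>
    hA.preimage (f := fun p : ℝ => (ω, p)) (by fun_prop)
  have hcosh : Measurable Real.cosh := Real.continuous_cosh.measurable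
  have hdens : Measurable fun p => ENNReal.ofReal (Real.cosh p ^ 2) := by fun_prop
  have h1 : santaloMeasure B = 2⁻¹ * ∫⁻ ω : S2, (∫⁻ p in {p | circleAt ω p ∈ B},
      ENNReal.ofReal (Real.cosh p ^ 2)) ∂(volume : Measure E3).toSphere := by
    rw [santaloMeasure, Measure.smul_apply, smul_eq_mul,
      Measure.map_apply continuous_circleAt.measurable hB]
    congr 1
    refine (Measure.prod_apply hA).trans ?_
    refine lintegral_congr fun ω => ?_
    exact withDensity_apply _ (hAω ω)
  have h2 : volume (coneOver B) = ∫⁻ ω : S2, (∫⁻ ρ in Set.Ioi (0 : ℝ), ENNReal.ofReal (ρ ^ 2) *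
      ∫⁻ p in {p | ρ < Real.cosh p ∧ circleAt ω p ∈ B},
        ENNReal.ofReal (ρ * (Real.cosh p ^ 2)⁻¹)) ∂(volume : Measure E3).toSphere := by
    have hC := measurableSet_coneOver hB
    rw [Measure.volume_eq_prod, Measure.prod_apply_symm hC,
      lintegral_polar (measurable_measure_prodMk_right hC)]
    refine lintegral_congr fun ω => setLIntegral_congr_fun measurableSet_Ioi fun ρ hρ => ?_
    have hm : MeasurableSet {p | ρ < Real.cosh p ∧ circleAt ω p ∈ B} :=
      (measurableSet_lt measurable_const hcosh).inter (hAω ω)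
    change _ * volume ((fun s : ℝ => ((s, ρ • (ω : E3)) : Mink)) ⁻¹' coneOver B) = _
    rw [coneOver_slice hρ, volume_image_mul_tanh hρ hm]
  -- Exchange of the two integrations, then `∫ ρ³ dρ = cosh⁴ p / 4` over `0 < ρ < cosh p`.
  have h3 : ∀ ω : S2, ∫⁻ ρ in Set.Ioi (0 : ℝ), ENNReal.ofReal (ρ ^ 2) *
      ∫⁻ p in {p | ρ < Real.cosh p ∧ circleAt ω p ∈ B}, ENNReal.ofReal (ρ * (Real.cosh p ^ 2)⁻¹)
      = ∫⁻ p in {p | circleAt ω p ∈ B}, ENNReal.ofReal (Real.cosh p ^ 2) * 4⁻¹ := by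
    intro ω
    have e1 : ∀ ρ ∈ Set.Ioi (0 : ℝ), ENNReal.ofReal (ρ ^ 2) *
        ∫⁻ p in {p | ρ < Real.cosh p ∧ circleAt ω p ∈ B}, ENNReal.ofReal (ρ * (Real.cosh p ^ 2)⁻¹)
        = ∫⁻ p in {p | circleAt ω p ∈ B}, {z : ℝ × ℝ | z.1 < Real.cosh z.2}.indicator
          (fun z => ENNReal.ofReal (z.1 ^ 3 * (Real.cosh z.2 ^ 2)⁻¹)) (ρ, p) := by
      intro ρ hρ
      have hm : MeasurableSet {p | ρ < Real.cosh p} := measurableSet_lt measurable_const hcosh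
      have hset : {p | ρ < Real.cosh p ∧ circleAt ω p ∈ B}
          = {p | ρ < Real.cosh p} ∩ {p | circleAt ω p ∈ B} := rfl
      rw [← lintegral_const_mul _ (by fun_prop), hset, ← Measure.restrict_restrict hm,
        ← lintegral_indicator hm]
      refine lintegral_congr fun p => ?_
      by_cases hp : ρ < Real.cosh p
      · rw [Set.indicator_of_mem (show p ∈ {p | ρ < Real.cosh p} from hp),
          Set.indicator_of_mem (show (ρ, p) ∈ {z : ℝ × ℝ | z.1 < Real.cosh z.2} from hp),
          ← ENNReal.ofReal_mul (sq_nonneg _)]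
        congr 1
        ring
      · rw [Set.indicator_of_notMem (show p ∉ {p | ρ < Real.cosh p} from hp),
          Set.indicator_of_notMem (show (ρ, p) ∉ {z : ℝ × ℝ | z.1 < Real.cosh z.2} from hp)]
    have hms : MeasurableSet {z : ℝ × ℝ | z.1 < Real.cosh z.2} :=
      measurableSet_lt measurable_fst (hcosh.comp measurable_snd)
    have hF : Measurable ({z : ℝ × ℝ | z.1 < Real.cosh z.2}.indicator
        (fun z => ENNReal.ofReal (z.1 ^ 3 * (Real.cosh z.2 ^ 2)⁻¹))) :=
      Measurable.indicator (by fun_prop) hms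
    rw [setLIntegral_congr_fun measurableSet_Ioi e1, lintegral_lintegral_swap
      (f := fun ρ p => {z : ℝ × ℝ | z.1 < Real.cosh z.2}.indicator
        (fun z => ENNReal.ofReal (z.1 ^ 3 * (Real.cosh z.2 ^ 2)⁻¹)) (ρ, p)) hF.aemeasurable]
    refine lintegral_congr fun p => ?_
    have hp := Real.cosh_pos p
    have e2 : ∀ ρ ∈ Set.Ioi (0 : ℝ), {z : ℝ × ℝ | z.1 < Real.cosh z.2}.indicator
        (fun z => ENNReal.ofReal (z.1 ^ 3 * (Real.cosh z.2 ^ 2)⁻¹)) (ρ, p)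
        = (Set.Iio (Real.cosh p)).indicator
          (fun ρ => ENNReal.ofReal (ρ ^ 3 * (Real.cosh p ^ 2)⁻¹)) ρ := fun ρ _ => rfl
    rw [setLIntegral_congr_fun measurableSet_Ioi e2, lintegral_indicator measurableSet_Iio,
      Measure.restrict_restrict measurableSet_Iio, Set.Iio_inter_Ioi,
      lintegral_ofReal_Ioo (f := fun ρ => ρ ^ 3 * (Real.cosh p ^ 2)⁻¹) (by fun_prop) hp.le
        (fun ρ hρ => mul_nonneg (pow_nonneg hρ.1.le 3) (by positivity)),
      intervalIntegral.integral_mul_const, integral_pow]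
    have e3 : (4⁻¹ : ℝ≥0∞) = ENNReal.ofReal 4⁻¹ := by
      rw [ENNReal.ofReal_inv_of_pos (by norm_num)]; norm_num
    rw [e3, ← ENNReal.ofReal_mul (sq_nonneg _)]
    congr 1
    norm_num
    field_simp
  have h4 : volume (coneOver B) = (∫⁻ ω : S2, (∫⁻ p in {p | circleAt ω p ∈ B},
      ENNReal.ofReal (Real.cosh p ^ 2)) ∂(volume : Measure E3).toSphere) * 4⁻¹ := by
    rw [h2]
    simp only [h3]
    simp only [lintegral_mul_const _ hdens]
    rw [lintegral_mul_const']
    exact ENNReal.inv_ne_top.2 (by norm_num)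
  rw [h1, h4, mul_comm, mul_left_comm]
  congr 1
  rw [show (4 : ℝ≥0∞) = 2 * 2 by norm_num, ENNReal.mul_inv (by simp) (by simp), ← mul_assoc,
    ENNReal.mul_inv_cancel (by simp) (by simp), one_mul]

/-! ### Invariance -/

theorem volume_preimage_isLorentz {A : Mink →ₗ[ℝ] Mink} (hA : IsLorentz A) (s : Set Mink) :
    volume (A ⁻¹' s) = volume s := by
  have hd : LinearMap.det A ≠ 0 := fun h => by
    have := hA.2
    rw [h, abs_zero] at this
    exact zero_ne_one this
  have : (volume : Measure Mink).IsAddHaarMeasure :=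
    inferInstanceAs ((volume : Measure ℝ).prod (volume : Measure E3)).IsAddHaarMeasure
  rw [Measure.addHaar_preimage_linearMap _ hd, abs_inv, hA.2]
  simp

theorem coneOver_preimage (g : IsomPlus) (B : Set RoundCircle) :
    coneOver ((g • ·) ⁻¹' B) = (g.1 : Mink →ₗ[ℝ] Mink) ⁻¹' coneOver B := by
  ext n
  change (_ ∧ _ ∧ ∃ σ, g • σ ∈ B ∧ IsNormal n σ) ↔
    (0 < form (g.1 n) (g.1 n) ∧ form (g.1 n) (g.1 n) < 1 ∧ ∃ σ ∈ B, IsNormal (g.1 n) σ)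
  rw [form_map]
  refine and_congr_right fun _ => and_congr_right fun _ => ⟨?_, ?_⟩
  · rintro ⟨σ, hσ, h⟩
    exact ⟨g • σ, hσ, h.smul g⟩
  · rintro ⟨σ, hσ, h⟩
    refine ⟨g⁻¹ • σ, by rwa [smul_inv_smul], ?_⟩
    have := h.smul g⁻¹
    rwa [inv_apply_self] at this

/-- The measure `ν` is invariant under isometries. -/
theorem measurePreserving_smul_santalo (g : IsomPlus) :
    MeasurePreserving (fun σ : RoundCircle => g • σ) santaloMeasure santaloMeasure := by
  have hg : Measurable fun σ : RoundCircle => g • σ := (continuous_const_smul g).measurable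
  refine ⟨hg, Measure.ext fun B hB => ?_⟩
  -- On cones of normals the isometry is a linear map of determinant `±1`.
  rw [Measure.map_apply hg hB, santaloMeasure_apply (hg hB), santaloMeasure_apply hB,
    coneOver_preimage, volume_preimage_isLorentz (isLorentz_isomPlus g)]

/-! ### The planes which cross a segment of a geodesic -/

/-- Both sides vanish for `a ≤ 0`, so the formula may be integrated over all slices of an ellipsoid
without restricting the range. -/
theorem volume_sq_norm_lt (a : ℝ) :
    volume {z : Fin 2 → ℝ | z 0 ^ 2 + z 1 ^ 2 < a} = ENNReal.ofReal a * ENNReal.ofReal Real.pi := by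
  have hm : MeasurableSet {z : Fin 2 → ℝ | z 0 ^ 2 + z 1 ^ 2 < a} :=
    measurableSet_lt (by fun_prop) measurable_const
  rw [← (PiLp.volume_preserving_ofLp (Fin 2)).measure_preimage hm.nullMeasurableSet]
  have h : (WithLp.ofLp : EuclideanSpace ℝ (Fin 2) → Fin 2 → ℝ) ⁻¹'
      {z : Fin 2 → ℝ | z 0 ^ 2 + z 1 ^ 2 < a} = Metric.ball 0 (Real.sqrt a) := by
    ext z
    rw [mem_ball_zero_iff, Real.lt_sqrt (norm_nonneg z), EuclideanSpace.real_norm_sq_eq,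
      Fin.sum_univ_two]
    rfl
  rw [h, EuclideanSpace.volume_ball_fin_two, ← ENNReal.ofReal_pow (Real.sqrt_nonneg a)]
  rcases le_total 0 a with ha | ha
  · rw [Real.sq_sqrt ha]
  · rw [Real.sqrt_eq_zero_of_nonpos ha, ENNReal.ofReal_of_nonpos ha]
    simp

theorem integral_abs_mul_one_sub {c : ℝ} (hc : 0 < c) :
    ∫ r in (-c)..c, |r| * (1 - (r / c) ^ 2) = c ^ 2 / 2 := by
  have hi : ∀ a b : ℝ, IntervalIntegrable (fun r => |r| * (1 - (r / c) ^ 2)) volume a b :=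
    fun a b => Continuous.intervalIntegrable (by fun_prop) a b
  have hpos : ∫ r in (0 : ℝ)..c, |r| * (1 - (r / c) ^ 2) = c ^ 2 / 4 := by
    have h : ∫ r in (0 : ℝ)..c, |r| * (1 - (r / c) ^ 2)
        = ∫ r in (0 : ℝ)..c, (r - r ^ 3 * (c ^ 2)⁻¹) := by
      refine intervalIntegral.integral_congr fun r hr => ?_
      rw [Set.uIcc_of_le hc.le] at hr
      simp only [abs_of_nonneg hr.1]
      ring
    rw [h, intervalIntegral.integral_sub (Continuous.intervalIntegrable (by fun_prop) _ _)
      (Continuous.intervalIntegrable (by fun_prop) _ _), intervalIntegral.integral_mul_const,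
      integral_pow, integral_id]
    norm_num
    field_simp
    ring
  have hneg : ∫ r in (-c)..0, |r| * (1 - (r / c) ^ 2) = c ^ 2 / 4 := by
    rw [← hpos]
    have h := intervalIntegral.integral_comp_neg (a := 0) (b := c)
      (fun r => |r| * (1 - (r / c) ^ 2))
    rw [neg_zero] at h
    rw [← h]
    refine intervalIntegral.integral_congr fun r _ => ?_
    simp only [abs_neg, neg_div, neg_sq]
  rw [← intervalIntegral.integral_add_adjacent_intervals (hi _ 0) (hi 0 _), hneg, hpos]
  ring

theorem lintegral_abs_mul_one_sub {c : ℝ} (hc : 0 < c) :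
    ∫⁻ r : ℝ, ENNReal.ofReal |r| * ENNReal.ofReal (1 - (r / c) ^ 2)
      = ENNReal.ofReal (c ^ 2 / 2) := by
  have hsq : ∀ r : ℝ, (r / c) ^ 2 < 1 ↔ r ∈ Set.Ioo (-c) c := fun r => by
    rw [div_pow, div_lt_one (by positivity), Set.mem_Ioo, ← abs_lt, sq_lt_sq, abs_of_pos hc]
  have h : ∀ r : ℝ, ENNReal.ofReal |r| * ENNReal.ofReal (1 - (r / c) ^ 2)
      = (Set.Ioo (-c) c).indicator (fun r => ENNReal.ofReal (|r| * (1 - (r / c) ^ 2))) r := by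
    intro r
    by_cases hr : r ∈ Set.Ioo (-c) c
    · rw [Set.indicator_of_mem hr, ENNReal.ofReal_mul (abs_nonneg r)]
    · rw [Set.indicator_of_notMem hr, ENNReal.ofReal_of_nonpos (p := 1 - (r / c) ^ 2), mul_zero]
      rw [← hsq, not_lt] at hr
      linarith
  simp only [h]
  rw [lintegral_indicator measurableSet_Ioo,
    lintegral_ofReal_Ioo (f := fun r => |r| * (1 - (r / c) ^ 2)) (by fun_prop) (by linarith),
    integral_abs_mul_one_sub hc]
  intro r hr
  refine mul_nonneg (abs_nonneg r) ?_
  have : r ^ 2 ≤ c ^ 2 := sq_le_sq' hr.1.le hr.2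
  rw [div_pow, sub_nonneg, div_le_one (by positivity)]
  exact this

/-- The slice `w 0 = r` is a disc of area `π (1 - r² / c²)`, zero when this is negative. -/
theorem lintegral_abs_ellipsoid {c : ℝ} (hc : 0 < c) :
    ∫⁻ w : E3, {w : E3 | w 1 ^ 2 + w 2 ^ 2 < 1 - (w 0 / c) ^ 2}.indicator
      (fun w => ENNReal.ofReal |w 0|) w = ENNReal.ofReal (c ^ 2 / 2) * ENNReal.ofReal Real.pi := by
  let F : ℝ × (Fin 2 → ℝ) → ℝ≥0∞ := {z | z.2 0 ^ 2 + z.2 1 ^ 2 < 1 - (z.1 / c) ^ 2}.indicator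
    (fun z => ENNReal.ofReal |z.1|)
  have hF : Measurable F := Measurable.indicator (by fun_prop)
    (measurableSet_lt (by fun_prop) (by fun_prop))
  have h1 := (volume_preserving_piFinSuccAbove (fun _ : Fin 3 => ℝ) 0).comp
    (PiLp.volume_preserving_ofLp (Fin 3))
  calc _ = ∫⁻ w : E3, F ((MeasurableEquiv.piFinSuccAbove (fun _ : Fin 3 => ℝ) 0 ∘
        WithLp.ofLp) w) := rfl
    _ = ∫⁻ z, F z := h1.lintegral_comp hF
    _ = ∫⁻ r : ℝ, ∫⁻ z : Fin 2 → ℝ, F (r, z) := by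
        rw [Measure.volume_eq_prod, lintegral_prod _ hF.aemeasurable]
    _ = ∫⁻ r : ℝ, ENNReal.ofReal |r| * ENNReal.ofReal (1 - (r / c) ^ 2) * ENNReal.ofReal Real.pi := by
        refine lintegral_congr fun r => ?_
        have hm : MeasurableSet {z : Fin 2 → ℝ | z 0 ^ 2 + z 1 ^ 2 < 1 - (r / c) ^ 2} :=
          measurableSet_lt (by fun_prop) measurable_const
        have : ∀ z, F (r, z) = {z : Fin 2 → ℝ | z 0 ^ 2 + z 1 ^ 2 < 1 - (r / c) ^ 2}.indicator
            (fun _ => ENNReal.ofReal |r|) z := fun z => rfl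
        simp only [this]
        rw [lintegral_indicator hm, setLIntegral_const, volume_sq_norm_lt, mul_assoc]
    _ = _ := by
        rw [lintegral_mul_const _ (by fun_prop), lintegral_abs_mul_one_sub hc]

theorem volume_image_tanh_mul {ρ : ℝ} (hρ : ρ ≠ 0) {A : Set ℝ} (hA : MeasurableSet A) :
    volume ((fun p => Real.tanh p * ρ) '' A)
      = ∫⁻ p in A, ENNReal.ofReal |ρ| * ENNReal.ofReal (Real.cosh p ^ 2)⁻¹ := by
  have h := lintegral_image_eq_lintegral_abs_deriv_mul hA
    (fun p _ => ((hasDerivAt_tanh p).mul_const ρ).hasDerivWithinAt)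
    (fun x _ y _ hxy => tanh_injective (mul_right_cancel₀ hρ hxy)) (fun _ => 1)
  simp only [lintegral_const, Measure.restrict_apply MeasurableSet.univ, Set.univ_inter, one_mul,
    mul_one] at h
  rw [h]
  refine lintegral_congr fun p => ?_
  rw [← ENNReal.ofReal_mul (abs_nonneg ρ), mul_comm, abs_mul]
  congr 2
  have := Real.cosh_pos p
  rw [abs_of_nonneg]
  positivity

/-- The spacelike vectors of square less than one whose orthogonal planes cross the segment of
length `L` issuing from the base point in the first coordinate direction. -/
def stdCrossing (L : ℝ) : Set Mink :=
  {n | 0 < form n n ∧ form n n < 1 ∧ n.2 0 ≠ 0 ∧ ∃ t ∈ Set.Ico 0 L, n.1 = Real.tanh t * n.2 0}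

/-- For `s = tanh t * w 0` the square is `w₁² + w₂² + (w₀ / cosh t)²`. It is positive since `w 0 ≠
0`, so only the upper bound is a condition. -/
theorem stdCrossing_slice (L : ℝ) {w : E3} (hw : w 0 ≠ 0) :
    (fun s : ℝ => ((s, w) : Mink)) ⁻¹' stdCrossing L = (fun t => Real.tanh t * w 0) ''
      (Set.Ico 0 L ∩ {t | w 1 ^ 2 + w 2 ^ 2 < 1 - (w 0 / Real.cosh t) ^ 2}) := by
  have key : ∀ t, form ((Real.tanh t * w 0, w) : Mink) (Real.tanh t * w 0, w)
      = w 1 ^ 2 + w 2 ^ 2 + (w 0 / Real.cosh t) ^ 2 := fun t => by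
    rw [form_self_eq, EuclideanSpace.real_norm_sq_eq, Fin.sum_univ_three, div_pow, div_eq_mul_inv,
      ← one_sub_tanh_sq]
    ring
  ext s
  constructor
  · rintro ⟨-, h1, -, t, ht, hs⟩
    change s = Real.tanh t * w 0 at hs
    subst hs
    refine ⟨t, ⟨ht, ?_⟩, rfl⟩
    rw [key] at h1
    have h2 : w 1 ^ 2 + w 2 ^ 2 < 1 - (w 0 / Real.cosh t) ^ 2 := by linarith
    exact h2
  · rintro ⟨t, ⟨ht, h1⟩, rfl⟩
    replace h1 : w 1 ^ 2 + w 2 ^ 2 < 1 - (w 0 / Real.cosh t) ^ 2 := h1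
    refine ⟨?_, ?_, hw, t, ht, rfl⟩
    · rw [key]
      have := Real.cosh_pos t
      positivity
    · rw [key]
      linarith

theorem measurableSet_stdCrossing (L : ℝ) : MeasurableSet (stdCrossing L) := by
  have hq : Measurable fun n : Mink => form n n :=
    (continuous_form continuous_id continuous_id).measurable
  have h0 : Measurable fun n : Mink => n.2 0 := by fun_prop
  have hI : MeasurableSet (Real.tanh '' Set.Ico 0 L) :=
    measurableSet_Ico.image_of_continuousOn_injOn continuous_tanh.continuousOn
      tanh_injective.injOn
  have : stdCrossing L = {n : Mink | 0 < form n n} ∩ ({n | form n n < 1} ∩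
      ({n | n.2 0 ≠ 0} ∩ (fun n : Mink => n.1 / n.2 0) ⁻¹' (Real.tanh '' Set.Ico 0 L))) := by
    ext n
    refine and_congr_right fun _ => and_congr_right fun _ => and_congr_right fun h => ?_
    refine exists_congr fun t => and_congr_right fun _ => ?_
    rw [eq_div_iff h, eq_comm]
  rw [this]
  exact (measurableSet_lt measurable_const hq).inter ((measurableSet_lt hq measurable_const).inter
    ((measurableSet_eq_fun h0 measurable_const).compl.inter ((measurable_fst.div h0) hI)))

/-- At fixed `t` the Jacobian `|w₀| / cosh² t` is integrated over an ellipsoid with semi-axes `cosh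
t, 1, 1`. The result is `π / 2` whatever `t` is, reflecting invariance under translation along the
axis. -/
theorem volume_stdCrossing (L : ℝ) :
    volume (stdCrossing L) = ENNReal.ofReal (Real.pi * L / 2) := by
  have hcosh : Measurable Real.cosh := Real.continuous_cosh.measurable
  have hD := measurableSet_stdCrossing L
  let E : Set (E3 × ℝ) := {z | z.1 1 ^ 2 + z.1 2 ^ 2 < 1 - (z.1 0 / Real.cosh z.2) ^ 2}
  have hE : MeasurableSet E := measurableSet_lt (by fun_prop) (by fun_prop)
  let F : E3 × ℝ → ℝ≥0∞ := E.indicator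
    fun z => ENNReal.ofReal |z.1 0| * ENNReal.ofReal (Real.cosh z.2 ^ 2)⁻¹
  have hF : Measurable F := Measurable.indicator (by fun_prop) hE
  have h1 : ∀ w : E3, volume ((fun s : ℝ => ((s, w) : Mink)) ⁻¹' stdCrossing L)
      = ∫⁻ t in Set.Ico 0 L, F (w, t) := by
    intro w
    by_cases hw : w 0 = 0
    -- The vectors with `w 0 = 0` are excluded on the left and have zero Jacobian on the right.
    · have e : (fun s : ℝ => ((s, w) : Mink)) ⁻¹' stdCrossing L = ∅ :=
        Set.eq_empty_of_forall_notMem fun s hs => hs.2.2.1 hw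
      have hz : ∀ t, F (w, t) = 0 := fun t => by
        by_cases ht : (w, t) ∈ E
        · change E.indicator _ _ = _
          rw [Set.indicator_of_mem ht]
          simp [hw]
        · exact Set.indicator_of_notMem ht _
      rw [e]
      simp [hz]
    · have hm : MeasurableSet {t : ℝ | w 1 ^ 2 + w 2 ^ 2 < 1 - (w 0 / Real.cosh t) ^ 2} :=
        measurableSet_lt (by fun_prop) (by fun_prop)
      rw [stdCrossing_slice L hw, volume_image_tanh_mul hw (measurableSet_Ico.inter hm),
        Set.inter_comm, ← Measure.restrict_restrict hm, ← lintegral_indicator hm]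
      rfl
  have h2 : ∀ t, ∫⁻ w, F (w, t) = ENNReal.ofReal (Real.pi / 2) := by
    intro t
    have hc := Real.cosh_pos t
    have e : ∀ w, F (w, t) = {w : E3 | w 1 ^ 2 + w 2 ^ 2 < 1 - (w 0 / Real.cosh t) ^ 2}.indicator
        (fun w => ENNReal.ofReal |w 0|) w * ENNReal.ofReal (Real.cosh t ^ 2)⁻¹ := fun w => by
      change E.indicator _ _ = _
      let E' : Set E3 := {w : E3 | w 1 ^ 2 + w 2 ^ 2 < 1 - (w 0 / Real.cosh t) ^ 2}
      by_cases h : (w, t) ∈ E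
      · have h' : w ∈ E' := h
        rw [Set.indicator_of_mem h, Set.indicator_of_mem h']
      · have h' : w ∉ E' := h
        rw [Set.indicator_of_notMem h, Set.indicator_of_notMem h', zero_mul]
    simp only [e]
    rw [lintegral_mul_const' _ _ ENNReal.ofReal_ne_top, lintegral_abs_ellipsoid hc,
      ← ENNReal.ofReal_mul (by positivity), ← ENNReal.ofReal_mul (by positivity)]
    congr 1
    field_simp
  rw [Measure.volume_eq_prod, Measure.prod_apply_symm hD]
  simp only [h1]
  rw [lintegral_lintegral_swap (f := fun w t => F (w, t)) hF.aemeasurable]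
  simp only [h2]
  rw [setLIntegral_const, Real.volume_Ico, sub_zero, ← ENNReal.ofReal_mul (by positivity)]
  congr 1
  ring

/-- The line `a` is `t ↦ cosh t • x + sinh t • v`, and `u` is the pair of its end points. -/
structure IsFrame (a : ℝ → Hyp3) (u : GeodEnds) (x v : Mink) : Prop where
  mem : x ∈ hyperboloid
  orth : form x v = 0
  unit : form v v = 1
  line : ∀ t, (a t : Mink) = Real.cosh t • x + Real.sinh t • v
  ends : ∃ (p q : S2) (h : p ≠ q) (c d : ℝ), u = GeodEnds.mk p q h ∧ 0 < c ∧ 0 < d ∧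
    x - v = c • lightVec p ∧ x + v = d • lightVec q

/-! ### Linking and crossing read off from a frame of the geodesic -/

theorem ClosedGeodesic.exists_isFrame {Γ : Subgroup IsomPlus} {κ : FreeHomotopyClass Γ}
    (α : ClosedGeodesic κ) : ∃ x v, IsFrame α.line (GeodEnds.mk α.p α.q α.p_ne_q) x v := by
  obtain ⟨x, v, hxv, hv, ha⟩ := α.isGeodesicLine
  have hx : x ∈ hyperboloid := by
    have h := (α.line 0).2
    rw [ha 0, Real.cosh_zero, Real.sinh_zero, one_smul, zero_smul, add_zero] at h
    exact h
  have hxv' : form x (-v) = 0 := by rw [form_neg_right, hxv, neg_zero]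
  have hv' : form (-v) (-v) = 1 := by rw [form_neg_left, form_neg_right, neg_neg, hv]
  have hq := tendsto_nhds_unique α.tendsto_q (tendstoBdry_atTop hxv hv hx ha)
  have hp := tendsto_nhds_unique α.tendsto_p (tendstoBdry_atBot hxv' hv' hx ha)
  have hpos := (frame_lightlike hx hxv hv).2
  have hpos' := (frame_lightlike hx hxv' hv').2
  refine ⟨x, v, hx, hxv, hv, ha, α.p, α.q, α.p_ne_q, _, _, rfl, hpos', hpos, ?_, ?_⟩
  · rw [Subtype.ext hp, lightVec_endOf, smul_smul, mul_inv_cancel₀ hpos'.ne', one_smul,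
      sub_eq_add_neg]
  · rw [Subtype.ext hq, lightVec_endOf, smul_smul, mul_inv_cancel₀ hpos.ne', one_smul]

section Frame

variable {a : ℝ → Hyp3} {u : GeodEnds} {x v : Mink} (hF : IsFrame a u x v)
include hF

theorem IsFrame.form_line (t : ℝ) : form (a t) v = Real.sinh t := by
  rw [hF.line, form_add_left, form_smul_left, form_smul_left, hF.orth, hF.unit]
  ring

theorem IsFrame.injective : Function.Injective a := fun s t h => by
  have := hF.form_line s
  rw [h, hF.form_line] at this
  exact (Real.sinh_injective this).symm

/-- The ends are the rays of `x - v` and `x + v`, and the product of the pairings of `n` with these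
is `form n x ^ 2 - form n v ^ 2`. -/
theorem IsFrame.linked_iff {n : Mink} {σ : RoundCircle} (hn : IsNormal n σ) :
    Linked σ u ↔ form n x ^ 2 < form n v ^ 2 := by
  obtain ⟨p, q, h, c, d, rfl, hc, hd, hp, hq⟩ := hF.ends
  rw [hn.linked_iff]
  have h1 : form n (x - v) * form n (x + v) = c * d * (form n (lightVec p) * form n (lightVec q)) := by
    rw [hp, hq, form_smul_right, form_smul_right]
    ring
  have h2 : form n (x - v) * form n (x + v) = form n x ^ 2 - form n v ^ 2 := by
    rw [form_sub_right, form_add_right]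
    ring
  have h3 : 0 < c * d := mul_pos hc hd
  rw [← sub_neg (a := form n x ^ 2), ← h2, h1]
  exact ⟨fun h => mul_neg_of_pos_of_neg h3 h, fun h => (pos_iff_neg_of_mul_neg h).1 h3⟩

theorem IsFrame.meets_iff {n : Mink} {σ : RoundCircle} (hn : IsNormal n σ) (t : ℝ) :
    Meets σ u (a t) ↔ form n x = -(Real.tanh t * form n v) := by
  have hcosh := Real.cosh_pos t
  have h1 : form n (a t) = 0 ↔ form n x = -(Real.tanh t * form n v) := by
    rw [hF.line, form_add_right, form_smul_right, form_smul_right, Real.tanh_eq_sinh_div_cosh,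
      eq_neg_iff_add_eq_zero]
    constructor
    · intro h
      field_simp
      linarith
    · intro h
      field_simp at h
      linarith
  rw [← h1]
  constructor
  · rintro ⟨n', ξ, η, h, b, c, hn', -, -, -, -, h0⟩
    obtain ⟨k, -, rfl⟩ := hn'.exists_smul hn
    rw [form_smul_left, h0, mul_zero]
  · intro h0
    obtain ⟨p, q, h, c, d, rfl, hc, hd, hp, hq⟩ := hF.ends
    have he := Real.exp_pos t
    have he' := Real.exp_pos (-t)
    refine ⟨n, p, q, h, Real.exp (-t) / 2 * c, Real.exp t / 2 * d, hn, rfl, by positivity,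
      by positivity, ?_, h0⟩
    rw [hF.line, geodesic_eq_exp, hp, hq, smul_smul, smul_smul, add_comm]

theorem IsFrame.exists_meets {σ : RoundCircle} (hl : Linked σ u) : ∃ t, Meets σ u (a t) := by
  obtain ⟨n, hn⟩ := exists_isNormal σ
  have h := (hF.linked_iff hn).1 hl
  have hv : form n v ≠ 0 := fun h0 => by
    rw [h0] at h
    nlinarith [sq_nonneg (form n x)]
  refine ⟨Real.artanh (-form n x / form n v), (hF.meets_iff hn _).2 ?_⟩
  have h1 : |-form n x / form n v| < 1 := by
    rw [abs_div, div_lt_one (abs_pos.2 hv), abs_neg]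
    exact sq_lt_sq.1 h
  rw [Real.tanh_artanh (abs_lt.1 h1), div_mul_cancel₀ _ hv, neg_neg]

/-- A solution `t` already forces linking when `form n v ≠ 0`, because `|tanh t| < 1`. The
right-hand side is the condition that defines `stdCrossing`. -/
theorem IsFrame.crossing_iff {n : Mink} {σ : RoundCircle} (hn : IsNormal n σ) (I : Set ℝ) :
    (Linked σ u ∧ ∃ t ∈ I, Meets σ u (a t)) ↔
      form n v ≠ 0 ∧ ∃ t ∈ I, form n x = -(Real.tanh t * form n v) := by
  simp only [hF.linked_iff hn, hF.meets_iff hn]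
  constructor
  · refine fun ⟨h, ht⟩ => ⟨fun h0 => ?_, ht⟩
    rw [h0] at h
    nlinarith [sq_nonneg (form n x)]
  · rintro ⟨h, t, ht, e⟩
    refine ⟨?_, t, ht, e⟩
    have h1 : Real.tanh t ^ 2 < 1 := by
      rw [sq_lt_one_iff_abs_lt_one]
      exact Real.abs_tanh_lt_one t
    have h2 : 0 < form n v ^ 2 := by positivity
    rw [e, neg_sq, mul_pow]
    nlinarith

omit hF in
variable (a u) in
/-- The planes which cross the geodesic with end points `u` in a point of `a '' [0, L)`. -/
def crossing (L : ℝ) : Set {σ : RoundCircle // Linked σ u} :=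
  {s | crossPoint ⟨(s.1, u), s.2⟩ ∈ a '' Set.Ico 0 L}

omit hF in
theorem continuous_crossPoint_mk :
    Continuous fun s : {σ : RoundCircle // Linked σ u} => crossPoint ⟨(s.1, u), s.2⟩ :=
  continuous_crossPoint.comp (by fun_prop)

theorem IsFrame.measurableSet_crossing (L : ℝ) : MeasurableSet (crossing a u L) := by
  have ha : Continuous a := IsGeodesicLine.continuous ⟨x, v, hF.orth, hF.unit, hF.line⟩
  exact continuous_crossPoint_mk.measurable
    (measurableSet_Ico.image_of_continuousOn_injOn ha.continuousOn hF.injective.injOn)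

omit hF in
theorem measurableSet_linked (u : GeodEnds) : MeasurableSet {σ : RoundCircle | Linked σ u} :=
  (isOpen_linked.preimage (f := fun σ : RoundCircle => (σ, u)) (by fun_prop)).measurableSet

omit hF in
theorem mem_image_crossing {L : ℝ} {σ : RoundCircle} :
    σ ∈ Subtype.val '' crossing a u L ↔ Linked σ u ∧ ∃ t ∈ Set.Ico 0 L, Meets σ u (a t) := by
  constructor
  · rintro ⟨s, ⟨t, ht, h⟩, rfl⟩
    exact ⟨s.2, t, ht, h ▸ meets_crossPoint ⟨(s.1, u), s.2⟩⟩
  · rintro ⟨hl, t, ht, h⟩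
    exact ⟨⟨σ, hl⟩, ⟨t, ht, (crossPoint_eq h).symm⟩, rfl⟩

/-- The Crofton formula. A Lorentz map `A` taking the frame to the standard one identifies the cone
over the crossing planes with `stdCrossing L`, of volume `π L / 2`. Both `form n x` and the pairing
with `(1, 0)` carry a minus sign, which cancels. -/
theorem IsFrame.santaloMeasure_crossing (L : ℝ) :
    santaloMeasure (Subtype.val '' crossing a u L) = ENNReal.ofReal (Real.pi * L) := by
  have hm : MeasurableSet (Subtype.val '' crossing a u L) :=
    (measurableSet_linked u).subtype_image (hF.measurableSet_crossing L)
  obtain ⟨A, hA, hAx, hAv⟩ := exists_isLorentz_frame hF.mem hF.orth hF.unit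
    (EuclideanSpace.single 0 1) (by simp)
  have hcone : coneOver (Subtype.val '' crossing a u L) = A ⁻¹' stdCrossing L := by
    ext n
    have h1 : form n x = -(A n).1 := by
      rw [← hA.1, hAx]
      simp [form]
    have h2 : form n v = (A n).2 0 := by
      rw [← hA.1, hAv]
      simp [form, EuclideanSpace.inner_single_right]
    change (_ ∧ _ ∧ _) ↔ (0 < form (A n) (A n) ∧ form (A n) (A n) < 1 ∧ (A n).2 0 ≠ 0 ∧
      ∃ t ∈ Set.Ico 0 L, (A n).1 = Real.tanh t * (A n).2 0)
    rw [hA.1]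
    refine and_congr_right fun h0 => and_congr_right fun h3 => ?_
    have key : ∀ σ, IsNormal n σ → (σ ∈ Subtype.val '' crossing a u L ↔ (A n).2 0 ≠ 0 ∧
        ∃ t ∈ Set.Ico 0 L, (A n).1 = Real.tanh t * (A n).2 0) := fun σ hn => by
      rw [mem_image_crossing, hF.crossing_iff hn, h1, h2]
      simp only [neg_inj]
    constructor
    · rintro ⟨σ, hσ, hn⟩
      exact (key σ hn).1 hσ
    · intro h
      -- Every spacelike vector of square less than one is normal to some circle: `coneOver_eq` with
      -- all circles allowed.
      have hmem : n ∈ coneOver Set.univ := by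
        rw [coneOver_eq]
        exact ⟨h0, h3, trivial⟩
      obtain ⟨-, -, σ, -, hn⟩ := hmem
      exact ⟨σ, (key σ hn).2 h, hn⟩
  rw [santaloMeasure_apply hm, hcone, volume_preimage_isLorentz hA, volume_stdCrossing,
    show (2 : ℝ≥0∞) = ENNReal.ofReal 2 by simp, ← ENNReal.ofReal_mul zero_le_two]
  congr 1
  ring

end Frame

/-! ### Invariance under the translation -/

section Translation

variable {Γ : Subgroup IsomPlus} {a : ℝ → Hyp3} {u : GeodEnds} {x v : Mink} {h : Γ} {L : ℝ}

theorem zpow_smul_line (hh : ∀ t, h • a t = a (t + L)) (i : ℤ) (t : ℝ) :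
    (h ^ i) • a t = a (t + i * L) := by
  have hinv : ∀ t, h⁻¹ • a t = a (t - L) := fun t => by
    rw [inv_smul_eq_iff, hh, sub_add_cancel]
  induction i using Int.induction_on generalizing t with
  | zero => simp
  | succ i ih =>
    rw [zpow_add_one, mul_smul, hh, ih]
    push_cast
    congr 1
    ring
  | pred i ih =>
    rw [zpow_sub_one, mul_smul, hinv, ih]
    push_cast
    congr 1
    ring

theorem smul_eq_of_map_lightVec {g : IsomPlus} {p : S2} {c : ℝ}
    (hp : g.1 (lightVec p) = c • lightVec p) : g • p = p := by
  have hc : (g.1 (lightVec p)).1 = c := by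
    rw [hp]
    exact mul_one c
  have hpos := fst_map_lightVec_pos g p
  apply lightVec_injective
  rw [lightVec_smul, hc, hp, smul_smul, inv_mul_cancel₀ (hc ▸ hpos).ne', one_smul]

/-- The vectors `x + v` and `x - v` are eigenvectors of `h`, so their rays are fixed. -/
theorem IsFrame.smul_ends (hF : IsFrame a u x v) (hh : ∀ t, h • a t = a (t + L)) : h • u = u := by
  obtain ⟨p, q, hpq, c, d, rfl, hc, hd, hp, hq⟩ := hF.ends
  obtain ⟨h1, h2⟩ := apply_frame_of_translate (h := h.1) hF.line hh
  have hq' : h.1.1 (x + v) = (Real.cosh L + Real.sinh L) • (x + v) := by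
    rw [map_add, h1, h2]
    module
  have hp' : h.1.1 (x - v) = (Real.cosh L - Real.sinh L) • (x - v) := by
    rw [map_sub, h1, h2]
    module
  rw [hq, map_smul, smul_comm] at hq'
  rw [hp, map_smul, smul_comm] at hp'
  have e1 : h.1 • p = p := smul_eq_of_map_lightVec (smul_right_injective Mink hc.ne' hp')
  have e2 : h.1 • q = q := smul_eq_of_map_lightVec (smul_right_injective Mink hd.ne' hq')
  change h.1 • GeodEnds.mk p q hpq = _
  simp only [GeodEnds.smul_mk, e1, e2]

theorem IsFrame.zpowers_smul_ends (hF : IsFrame a u x v) (hh : ∀ t, h • a t = a (t + L))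
    (g : Subgroup.zpowers h) : g • u = u := by
  have : Subgroup.zpowers h ≤ MulAction.stabilizer Γ u := by
    rw [Subgroup.zpowers_le]
    exact hF.smul_ends hh
  exact this g.2

theorem Meets.smul_zpow (hF : IsFrame a u x v) (hh : ∀ t, h • a t = a (t + L)) {σ : RoundCircle}
    {t : ℝ} (hm : Meets σ u (a t)) (i : ℤ) : Meets ((h ^ i) • σ) u (a (t + i * L)) := by
  have h1 := hm.smul (h ^ i).1
  have h2 : (h ^ i).1 • u = u := hF.zpowers_smul_ends hh ⟨h ^ i, i, rfl⟩
  have h3 : (h ^ i).1 • a t = a (t + i * L) := zpow_smul_line hh i t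
  rwa [h2, h3] at h1

theorem IsFrame.linked_smul_iff (hF : IsFrame a u x v) (hh : ∀ t, h • a t = a (t + L))
    (g : Subgroup.zpowers h) {σ : RoundCircle} : Linked (g • σ) u ↔ Linked σ u := by
  have key : ∀ (g : Subgroup.zpowers h) {σ : RoundCircle}, Linked σ u → Linked (g • σ) u :=
    fun g σ hl => by
      have h1 := hl.smul g.1.1
      have h2 : g.1.1 • u = u := hF.zpowers_smul_ends hh g
      rwa [h2] at h1
  refine ⟨fun hl => ?_, key g⟩
  have := key g⁻¹ hl
  rwa [inv_smul_smul] at this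

instance {Γ : Subgroup IsomPlus} (H : Subgroup Γ) : MeasurableConstSMul H RoundCircle :=
  ⟨fun g => (continuous_const_smul (g.1.1 : IsomPlus)).measurable⟩

instance {Γ : Subgroup IsomPlus} (H : Subgroup Γ) :
    SMulInvariantMeasure H RoundCircle santaloMeasure :=
  ⟨fun g _ hs => (measurePreserving_smul_santalo g.1.1).measure_preimage hs.nullMeasurableSet⟩

theorem IsFrame.smulInvariant (hF : IsFrame a u x v) (hh : ∀ t, h • a t = a (t + L)) :
    SMulInvariantMeasure (Subgroup.zpowers h) RoundCircle
      (santaloMeasure.restrict {σ | Linked σ u}) := by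
  refine ⟨fun g s hs => ?_⟩
  have hW := measurableSet_linked u
  rw [Measure.restrict_apply (hs.preimage (measurable_const_smul g)), Measure.restrict_apply hs,
    ← measure_preimage_smul_of_nullMeasurableSet (μ := santaloMeasure)
      (hs.inter hW).nullMeasurableSet g]
  congr 1
  ext σ
  exact and_congr_right fun _ => (hF.linked_smul_iff hh g).symm

/-- A linked plane has exactly one crossing parameter, and `h ^ i` adds `i * L` to it; so this is
the fundamental domain `[0, L)` of `ℝ` modulo `L`. The half-open interval makes the translates
honestly disjoint. -/
theorem IsFrame.isFundamentalDomain (hF : IsFrame a u x v) (hL : 0 < L)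
    (hh : ∀ t, h • a t = a (t + L)) :
    IsFundamentalDomain (Subgroup.zpowers h) (Subtype.val '' crossing a u L)
      (santaloMeasure.restrict {σ | Linked σ u}) := by
  have hW := measurableSet_linked u
  refine ⟨(hW.subtype_image (hF.measurableSet_crossing L)).nullMeasurableSet, ?_, ?_⟩
  · filter_upwards [ae_restrict_mem hW] with σ hσ
    obtain ⟨t, ht⟩ := hF.exists_meets hσ
    -- Subtracting `⌊t / L⌋ * L` brings the parameter into `[0, L)`.
    let g : Subgroup.zpowers h := ⟨h ^ (-⌊t / L⌋), -⌊t / L⌋, rfl⟩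
    refine ⟨g, mem_image_crossing.2 ⟨(hF.linked_smul_iff hh g).2 hσ, _, ?_,
      ht.smul_zpow hF hh (-⌊t / L⌋)⟩⟩
    have h1 := Int.floor_le (t / L)
    have h2 := Int.lt_floor_add_one (t / L)
    rw [le_div_iff₀ hL] at h1
    rw [div_lt_iff₀ hL] at h2
    push_cast
    constructor <;> nlinarith
  · rintro ⟨_, i, rfl⟩ ⟨_, j, rfl⟩ hne
    refine Disjoint.aedisjoint (Set.disjoint_left.2 ?_)
    rintro _ ⟨σ, hσ, rfl⟩ ⟨τ, hτ, e⟩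
    obtain ⟨hlσ, s, hs, hms⟩ := mem_image_crossing.1 hσ
    obtain ⟨hlτ, t, ht, hmt⟩ := mem_image_crossing.1 hτ
    have h1 := hms.smul_zpow hF hh i
    have h2 := hmt.smul_zpow hF hh j
    have e' : h ^ j • τ = h ^ i • σ := e
    rw [e'] at h2
    have h3 : Linked (h ^ i • σ) u := (hF.linked_smul_iff hh ⟨h ^ i, i, rfl⟩).2 hlσ
    have h4 := hF.injective (h1.unique h3 h2)
    refine hne (Subtype.ext ?_)
    change h ^ i = h ^ j
    -- From `s + i L = t + j L` with `s, t ∈ [0, L)` it follows that `|i - j| < 1`.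
    have h5 : i = j := by
      have a1 : ((i : ℝ) - j) * L < 1 * L := by linarith [hs.1, ht.2]
      have a2 : ((j : ℝ) - i) * L < 1 * L := by linarith [ht.1, hs.2]
      have b1 := lt_of_mul_lt_mul_right a1 hL.le
      have b2 := lt_of_mul_lt_mul_right a2 hL.le
      have c1 : i - j < 1 := by exact_mod_cast b1
      have c2 : j - i < 1 := by exact_mod_cast b2
      omega
    rw [h5]

end Translation

/-- Each element is uniquely the chosen representative of its coset times an element of `H`. -/
theorem tsum_eq_tsum_quotient {G : Type*} [Group G] (H : Subgroup G) (φ : G → ℝ≥0∞) :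
    ∑' g, φ g = ∑' (c : G ⧸ H) (k : H), φ (c.out * k) := by
  have hb : Function.Bijective fun z : (G ⧸ H) × H => z.1.out * (z.2 : G) := by
    constructor
    · rintro ⟨c, k⟩ ⟨c', k'⟩ e
      change c.out * (k : G) = c'.out * (k' : G) at e
      have h1 : c = c' := by
        have := congrArg (QuotientGroup.mk (s := H)) e
        rwa [QuotientGroup.mk_mul_of_mem _ k.2, QuotientGroup.mk_mul_of_mem _ k'.2,
          QuotientGroup.out_eq', QuotientGroup.out_eq'] at this
      subst h1
      exact Prod.ext rfl (Subtype.ext (mul_left_cancel e))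
    · intro g
      refine ⟨(QuotientGroup.mk g, ⟨(QuotientGroup.mk g : G ⧸ H).out⁻¹ * g, ?_⟩), ?_⟩
      · rw [← QuotientGroup.eq, QuotientGroup.out_eq']
      · exact mul_inv_cancel_left _ _
  rw [← (Equiv.ofBijective _ hb).tsum_eq, ENNReal.tsum_prod']
  rfl

/-- The orbit of the base point meets each compact set of an exhaustion for finitely many elements
only. Countability is needed to exchange sums over `Γ` with integrals. -/
theorem countable_of_properlyDiscontinuous {Γ : Subgroup IsomPlus}
    (hΓ : ProperlyDiscontinuousSMul Γ Hyp3) : Countable Γ := by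
  have hU : (Set.univ : Set Γ) = ⋃ n : ℕ, {g : Γ | g • basePoint ∈ compactCovering Hyp3 n} := by
    refine (Set.eq_univ_of_forall fun g => Set.mem_iUnion.2 ?_).symm
    have : g • basePoint ∈ ⋃ n, compactCovering Hyp3 n := by
      rw [iUnion_compactCovering]
      trivial
    obtain ⟨n, hn⟩ := Set.mem_iUnion.1 this
    exact ⟨n, hn⟩
  rw [← Set.countable_univ_iff, hU]
  refine Set.countable_iUnion fun n => Set.Finite.countable ?_
  refine (hΓ.finite_disjoint_inter_image (isCompact_singleton (x := basePoint))
    (isCompact_compactCovering Hyp3 n)).subset fun g hg => ?_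
  exact ⟨g • basePoint, ⟨basePoint, rfl, rfl⟩, hg⟩

/-! ### The quotient measure -/

section Quotient

variable {Γ : Subgroup IsomPlus} {a : ℝ → Hyp3} {u : GeodEnds} {x v : Mink} {h : Γ} {L : ℝ}

theorem measurableSet_linkedPairs :
    MeasurableSet {z : RoundCircle × GeodEnds | Linked z.1 z.2} := isOpen_linked.measurableSet

/-- The extension by zero of a function on the space of linked pairs. -/
def extendZero (f : LinkedPairs → ℝ≥0∞) : RoundCircle × GeodEnds → ℝ≥0∞ :=
  Function.extend Subtype.val f 0

theorem extendZero_coe (f : LinkedPairs → ℝ≥0∞) (z : LinkedPairs) : extendZero f z.1 = f z :=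
  Subtype.val_injective.extend_apply f 0 z

theorem extendZero_of_not_linked (f : LinkedPairs → ℝ≥0∞) {z : RoundCircle × GeodEnds}
    (hz : ¬ Linked z.1 z.2) : extendZero f z = 0 :=
  Function.extend_apply' _ _ _ (by rintro ⟨w, rfl⟩; exact hz w.2)

theorem measurable_extendZero {f : LinkedPairs → ℝ≥0∞} (hf : Measurable f) :
    Measurable (extendZero f) :=
  (MeasurableEmbedding.subtype_coe measurableSet_linkedPairs).measurable_extend hf measurable_const

theorem lintegral_linkedMeasure (μ : Measure RoundCircle) (lam : Measure GeodEnds)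
    (f : LinkedPairs → ℝ≥0∞) :
    ∫⁻ z, f z ∂(linkedMeasure μ lam) = ∫⁻ z, extendZero f z ∂(μ.prod lam) := by
  have h1 := lintegral_subtype_comap (μ := μ.prod lam) measurableSet_linkedPairs (extendZero f)
  rw [← lintegral_indicator measurableSet_linkedPairs] at h1
  have h2 : {z : RoundCircle × GeodEnds | Linked z.1 z.2}.indicator (extendZero f)
      = extendZero f := by
    rw [Set.indicator_eq_self]
    intro z hz
    by_contra hc
    exact hz (extendZero_of_not_linked f hc)
  rw [h2] at h1
  rw [← h1]
  exact lintegral_congr fun z => (extendZero_coe f z).symm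

theorem lintegral_linkedMeasure_sum_dirac {ι : Type*} [Countable ι] (μ : Measure RoundCircle)
    (w : ι → GeodEnds) {f : LinkedPairs → ℝ≥0∞} (hf : Measurable f) :
    ∫⁻ z, f z ∂(linkedMeasure μ (Measure.sum fun i => Measure.dirac (w i)))
      = ∑' i, ∫⁻ σ, extendZero f (σ, w i) ∂μ := by
  have he := measurable_extendZero hf
  have hm : ∀ i, Measurable fun σ : RoundCircle => extendZero f (σ, w i) := fun i =>
    he.comp (measurable_id.prodMk measurable_const)
  rw [lintegral_linkedMeasure, lintegral_prod _ he.aemeasurable,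
    ← lintegral_tsum fun i => (hm i).aemeasurable]
  refine lintegral_congr fun σ => ?_
  rw [lintegral_sum_measure]
  refine tsum_congr fun i => ?_
  exact lintegral_dirac' _ (he.comp (measurable_const.prodMk measurable_id))

theorem setLIntegral_comap_subtype {α : Type*} [MeasurableSpace α] {p : α → Prop}
    (hp : MeasurableSet {x | p x}) (μ : Measure α) {C : Set {x // p x}}
    (hC : MeasurableSet C) (f : α → ℝ≥0∞) :
    ∫⁻ s in C, f s ∂(μ.comap Subtype.val) = ∫⁻ x in Subtype.val '' C, f x ∂μ := by
  have hemb : MeasurableEmbedding (Subtype.val : {x // p x} → α) :=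
    MeasurableEmbedding.subtype_coe hp
  have hC' : MeasurableSet (Subtype.val '' C) := hemb.measurableSet_image' hC
  have h1 := hemb.restrict_map (μ.comap Subtype.val) (Subtype.val '' C)
  have h2 : (Subtype.val : {x // p x} → α) ⁻¹' (Subtype.val '' C) = C :=
    Set.preimage_image_eq _ Subtype.val_injective
  rw [h2, hemb.map_comap, Measure.restrict_restrict hC', Set.inter_eq_left.2
    (Set.image_subset_range _ _)] at h1
  rw [h1, hemb.lintegral_map]

/-- Invariance of `ν` moves the geodesic `c • u` back to `u`; the integral then splits over the
`H`-translates of the fundamental domain, and each `k ∈ H` fixes `u`. -/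
theorem IsFrame.lintegral_extendZero [Countable Γ] (hF : IsFrame a u x v) (hL : 0 < L)
    (hh : ∀ t, h • a t = a (t + L)) {f : LinkedPairs → ℝ≥0∞} (hf : Measurable f) (c : Γ) :
    ∫⁻ σ, extendZero f (σ, c • u) ∂santaloMeasure
      = ∑' k : Subgroup.zpowers h, ∫⁻ σ in Subtype.val '' crossing a u L,
        extendZero f ((c * k : Γ) • σ, (c * k : Γ) • u) ∂santaloMeasure := by
  have hW := measurableSet_linked u
  have hD : MeasurableSet (Subtype.val '' crossing a u L) :=
    hW.subtype_image (hF.measurableSet_crossing L)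
  have hinv := hF.smulInvariant hh
  have hm : Measurable fun σ : RoundCircle => extendZero f (σ, c • u) :=
    (measurable_extendZero hf).comp (measurable_id.prodMk measurable_const)
  have h1 : ∫⁻ σ, extendZero f (c • σ, c • u) ∂santaloMeasure
      = ∫⁻ σ, extendZero f (σ, c • u) ∂santaloMeasure :=
    (measurePreserving_smul_santalo c.1).lintegral_comp hm
  have h2 : {σ : RoundCircle | Linked σ u}.indicator (fun σ => extendZero f (c • σ, c • u))
      = fun σ => extendZero f (c • σ, c • u) := by
    rw [Set.indicator_eq_self]
    intro σ hσ
    by_contra hn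
    refine hσ (extendZero_of_not_linked f fun hl => hn ?_)
    have h3 := hl.smul c.1⁻¹
    change Linked (c.1⁻¹ • c.1 • σ) (c.1⁻¹ • c.1 • u) at h3
    rwa [inv_smul_smul, inv_smul_smul] at h3
  have h4 : Subtype.val '' crossing a u L ⊆ {σ : RoundCircle | Linked σ u} := by
    rintro _ ⟨s, -, rfl⟩
    exact s.2
  rw [← h1, ← h2, lintegral_indicator hW, (hF.isFundamentalDomain hL hh).lintegral_eq_tsum'',
    Measure.restrict_restrict hD, Set.inter_eq_left.2 h4]
  refine tsum_congr fun k => lintegral_congr fun σ => ?_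
  have hk : (k : Γ) • u = u := hF.zpowers_smul_ends hh k
  rw [mul_smul, mul_smul, hk]
  rfl

/-- Unfolding: the cosets of the current together with the `H`-translates of the fundamental domain
make up one sum over `Γ`. -/
theorem IsFrame.lintegral_linkedMeasure_current [Countable Γ] (hF : IsFrame a u x v) (hL : 0 < L)
    (hh : ∀ t, h • a t = a (t + L)) {f : LinkedPairs → ℝ≥0∞} (hf : Measurable f) :
    ∫⁻ z, f z ∂(linkedMeasure santaloMeasure
        (Measure.sum fun c : Γ ⧸ Subgroup.zpowers h => Measure.dirac (c.out • u)))
      = ∫⁻ s in crossing a u L, ∑' g : Γ, f (g • ⟨(s.1, u), s.2⟩)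
        ∂(santaloMeasure.comap Subtype.val) := by
  let H := Subgroup.zpowers h
  let e := extendZero f
  have he : Measurable e := measurable_extendZero hf
  have hW := measurableSet_linked u
  have hD : MeasurableSet (Subtype.val '' crossing a u L) :=
    hW.subtype_image (hF.measurableSet_crossing L)
  have hes : ∀ g : Γ, Measurable fun σ : RoundCircle => e (g • σ, g • u) := fun g =>
    he.comp ((continuous_const_smul g.1).measurable.prodMk measurable_const)
  have : Countable (Γ ⧸ H) := Quotient.countable
  have hR : ∫⁻ s in crossing a u L, ∑' g : Γ, f (g • ⟨(s.1, u), s.2⟩)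
        ∂(santaloMeasure.comap Subtype.val)
      = ∫⁻ σ in Subtype.val '' crossing a u L, ∑' g : Γ, e (g • σ, g • u) ∂santaloMeasure := by
    have h1 : ∀ s : {σ : RoundCircle // Linked σ u}, ∑' g : Γ, f (g • ⟨(s.1, u), s.2⟩)
        = ∑' g : Γ, e (g • s.1, g • u) := fun s =>
      tsum_congr fun g => (extendZero_coe f (g • ⟨(s.1, u), s.2⟩)).symm
    simp only [h1]
    exact setLIntegral_comap_subtype hW santaloMeasure (hF.measurableSet_crossing L)
      fun σ => ∑' g : Γ, e (g • σ, g • u)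
  rw [lintegral_linkedMeasure_sum_dirac _ _ hf, hR, lintegral_tsum fun g => (hes g).aemeasurable, tsum_eq_tsum_quotient H]
  exact tsum_congr fun c => hF.lintegral_extendZero hL hh hf c.out

/-! ### The induced measure on `X/Γ` and its total mass -/

variable (Γ) in
/-- The projection `X → X/Γ`. -/
def linkedProj (z : LinkedPairs) : LinkedQuot Γ := Quotient.mk (MulAction.orbitRel Γ LinkedPairs) z

variable (Γ) in
theorem isOpenQuotientMap_linkedProj : IsOpenQuotientMap (linkedProj Γ) :=
  MulAction.isOpenQuotientMap_quotientMk

theorem linkedProj_eq_iff {z w : LinkedPairs} :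
    linkedProj Γ z = linkedProj Γ w ↔ ∃ g : Γ, g • w = z := Quotient.eq''

variable (Γ a u L) in
/-- The push-forward to `X/Γ` of the invariant measure on the planes crossing a fundamental
segment of a geodesic. -/
def crossingMeasure : Measure (LinkedQuot Γ) :=
  Measure.map (fun s : {σ : RoundCircle // Linked σ u} => linkedProj Γ ⟨(s.1, u), s.2⟩)
    ((santaloMeasure.comap Subtype.val).restrict (crossing a u L))

theorem continuous_linkedProj_mk : Continuous fun s : {σ : RoundCircle // Linked σ u} =>
    linkedProj Γ ⟨(s.1, u), s.2⟩ :=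
  (isOpenQuotientMap_linkedProj Γ).continuous.comp (by fun_prop)

theorem IsFrame.crossingMeasure_univ (hF : IsFrame a u x v) :
    crossingMeasure Γ a u L Set.univ = ENNReal.ofReal (Real.pi * L) := by
  rw [crossingMeasure, Measure.map_apply continuous_linkedProj_mk.measurable
    MeasurableSet.univ, Set.preimage_univ, ← hF.santaloMeasure_crossing, ← setLIntegral_one,
    ← setLIntegral_one, Measure.restrict_univ]
  exact setLIntegral_comap_subtype (measurableSet_linked u) _ (hF.measurableSet_crossing L) 1

theorem t2Space_linkedQuot (hΓ : ProperlyDiscontinuousSMul Γ Hyp3) : T2Space (LinkedQuot Γ) := by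
  have := properlyDiscontinuousSMul_linkedPairs hΓ
  exact inferInstanceAs (T2Space (Quotient (MulAction.orbitRel Γ LinkedPairs)))

instance : SecondCountableTopology LinkedPairs :=
  TopologicalSpace.Subtype.secondCountableTopology {z : RoundCircle × GeodEnds | Linked z.1 z.2}

instance : SecondCountableTopology (LinkedQuot Γ) :=
  (isOpenQuotientMap_linkedProj Γ).isQuotientMap.secondCountableTopology
    (isOpenQuotientMap_linkedProj Γ).isOpenMap

instance : LocallyCompactSpace (LinkedQuot Γ) :=
  (isOpenQuotientMap_linkedProj Γ).locallyCompactSpace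

/-- Its finite mass makes the measure regular on this locally compact, second countable Hausdorff
quotient, and the unfolding identity is the required formula. -/
theorem IsFrame.isQuotientMeasure (hΓ : ProperlyDiscontinuousSMul Γ Hyp3) (hF : IsFrame a u x v)
    (hL : 0 < L) (hh : ∀ t, h • a t = a (t + L)) :
    IsQuotientMeasure Γ santaloMeasure
      (Measure.sum fun c : Γ ⧸ Subgroup.zpowers h => Measure.dirac (c.out • u))
      (crossingMeasure Γ a u L) := by
  have := t2Space_linkedQuot hΓ
  have := properlyDiscontinuousSMul_linkedPairs hΓ
  have := countable_of_properlyDiscontinuous hΓ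
  have hfin : IsFiniteMeasure (crossingMeasure Γ a u L) :=
    ⟨by rw [hF.crossingMeasure_univ]; exact ENNReal.ofReal_lt_top⟩
  have hreg : (crossingMeasure Γ a u L).Regular := inferInstance
  refine ⟨hreg, fun f hf hfc => ?_⟩
  refine integral_descend (G := Γ) (isOpenQuotientMap_linkedProj Γ)
    (fun _ _ => linkedProj_eq_iff) (fun f F hf hF' hfF => ?_) hf hfc (fun _ => rfl)
  rw [hF.lintegral_linkedMeasure_current hL hh hf, crossingMeasure,
    lintegral_map hF' continuous_linkedProj_mk.measurable]
  simp only [hfF]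

/-- Uniqueness by `regular_measure_ext` selects the first branch of the definition, so the form is
the total mass of `crossingMeasure`. -/
theorem IsFrame.intersectionForm_eq (hΓ : ProperlyDiscontinuousSMul Γ Hyp3) (hF : IsFrame a u x v)
    (hL : 0 < L) (hh : ∀ t, h • a t = a (t + L)) :
    intersectionForm Γ santaloMeasure
      (Measure.sum fun c : Γ ⧸ Subgroup.zpowers h => Measure.dirac (c.out • u))
      = ENNReal.ofReal (Real.pi * L) := by
  have := t2Space_linkedQuot hΓ
  have := properlyDiscontinuousSMul_linkedPairs hΓ
  have hm := hF.isQuotientMeasure hΓ hL hh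
  have huniq : ∀ m, IsQuotientMeasure Γ santaloMeasure
      (Measure.sum fun c : Γ ⧸ Subgroup.zpowers h => Measure.dirac (c.out • u)) m →
      m = crossingMeasure Γ a u L := by
    intro m hm'
    have := hm.1
    have := hm'.1
    refine regular_measure_ext (G := Γ) (isOpenQuotientMap_linkedProj Γ)
      (fun _ _ => linkedProj_eq_iff) fun f F hf hfc hfF => ?_
    have e : F = descend Γ f := by
      funext q
      obtain ⟨z, rfl⟩ := (isOpenQuotientMap_linkedProj Γ).surjective q
      exact hfF z
    rw [e, hm'.2 f hf hfc, hm.2 f hf hfc]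
  have hex : ∃! m, IsQuotientMeasure Γ santaloMeasure
      (Measure.sum fun c : Γ ⧸ Subgroup.zpowers h => Measure.dirac (c.out • u)) m :=
    ⟨_, hm, huniq⟩
  rw [intersectionForm, dif_pos hex, huniq _ hex.choose_spec.1, hF.crossingMeasure_univ]

end Quotient

end HypCurrents

end

/-! ### Conclusion -/

theorem mainTheorem11 (Γ : Subgroup HypCurrents.IsomPlus)
    (hΓ : HypCurrents.IsClosedManifoldGroup Γ)
    (κ : HypCurrents.FreeHomotopyClass Γ) (hκ : κ.Nontrivial) :
    HypCurrents.classLength κ < ⊤ ∧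
      HypCurrents.intersectionForm Γ HypCurrents.santaloMeasure (HypCurrents.classCurrent κ)
        = ENNReal.ofReal Real.pi * HypCurrents.classLength κ := by
  have hne := HypCurrents.exists_closedGeodesic hΓ hκ
  obtain ⟨x, v, hF⟩ := hne.some.exists_isFrame
  have hI := hF.intersectionForm_eq hΓ.properlyDiscontinuous hne.some.len_pos hne.some.translate
  rw [hne.some.classLength_eq hΓ, HypCurrents.classCurrent, dif_pos hne]
  refine ⟨ENNReal.ofReal_lt_top, ?_⟩
  rw [← ENNReal.ofReal_mul Real.pi_pos.le]
  exact hI
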